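/- Notation. Frequencies are pairs $n=(n_1,n_2)\in\mathbb Z^*\times\mathbb Z$ (so $n_1\ne 0$), $|n|=|n_1|+|n_2|$, $nz=n_1x+n_2y$ for $z=(x,y)\in\mathbb T^2=(\mathbb R/2\pi\mathbb Z)^2$, $\omega_n=n_1^3-\frac{n_2^2}{n_1}$, and $\Delta_n^{k,l}=\omega_k+\omega_l-\omega_n$ when $k+l=n$. $H^s$ is the space of real functions $u=\sum_n u_n e^{inz}$ on $\mathbb T^2$ with $\int u\,dx=0$ and $\|u\|_{H^s}^2=\sum_{n_1\neq0}|n|^{2s}|u_n|^2<\infty$. For $\varepsilon\ge 0$, KP-II is the equation $$\partial_x\Big(\partial_t u+\partial_x^3u+\tfrac{\varepsilon}{2}\partial_x(u^2)\Big)+\partial_y^2u=0\quad\text{on }\mathbb T^2 .$$ Theorem. Fix $s>1$. There exist constants $C_s,T_1,\varepsilon_1>0$, depending only on $s$, such that the following holds. Let $(g_n)_{n\in\mathbb N^*\times\mathbb Z}$ be independent identically distributed complex random variables on a probability space $(\Omega,\mathcal A,\mathbb P)$ whose law is invariant under multiplication by $e^{i\theta}$ for every $\theta\in\mathbb R$,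 and let $(\lambda_n)_{n\in\mathbb N^*\times\mathbb Z}$ be complex numbers. Set $g_{-n}=\overline{g_n}$ and $\lambda_{-n}=\overline{\lambda_n}$, and assume that $u_0=\sum_{n\in\mathbb Z^*\times\mathbb Z}g_n\lambda_ne^{inz}$ has norm $1$ in $L^\infty(\Omega,H^s(\mathbb T^2))$. Then the second and fourth absolute moments $E(|g_n|^2)$, $E(|g_n|^4)$ are finite. Put $$\begin{aligned}F_{n,n}(t)={}&n_1E(|g_n|^2)^2\sum_{k+l=n}\frac{\cos(\Delta_n^{k,l}t)-1}{(\Delta_n^{k,l})^2}\Big(k_1|\lambda_n|^2|\lambda_l|^2+l_1|\lambda_n|^2|\lambda_k|^2-n_1|\lambda_k|^2|\lambda_l|^2\Big)\\&+n_1\big(E(|g_n|^4)-2E(|g_n|^2)^2\big)\Big(2n_1\frac{\cos(\Delta_n^{-n,2n}t)-1}{(\Delta_n^{-n,2n})^2}|\lambda_n|^4-\delta_{n/2\in\mathbb Z^2}\frac{n_1}{2}\,\frac{\cos(\Delta_n^{n/2,n/2}t)-1}{(\Delta_n^{n/2,n/2})^2}|\lambda_{n/2}|^4\Big),\end{aligned}$$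 where the sum runs over $k,l\in\mathbb Z^*\times\mathbb Z$ and converges absolutely, and $F_{n,m}(t)=0$ if $n\ne m$. Then $$\sum_{n,m}\sqrt{|n_1m_1|}\,(|n||m|)^s|F_{n,m}(t)|$$ is bounded uniformly in $t\in\mathbb R$. Moreover, let $\varepsilon\in[0,\varepsilon_1[$, let $T>0$ with $T\le T_1\varepsilon^{-5/3}$ (any $T>0$ if $\varepsilon=0$), and let $u=\sum_n u_n(t)e^{inz}$ be the random solution of KP-II on $[-T,T]$ with initial datum $u_0$, that is, almost surely, $u$ belongs to $C([-T,T],H^s)$ and solves the equation in the sense of distributions. Then for all $n,m\in\mathbb Z^*\times\mathbb Z$ and all $t\in[-T,T]$, $$E(u_n(t)\overline{u_m(t)})=\delta_n^mE(|g_n|^2)|\lambda_n|^2+\varepsilon^2F_{n,m}(t)+\varepsilon^4\widetilde R(n,m,t,\varepsilon),$$ with $$|\widetilde R(n,m,t,\varepsilon)|\le C_s\min(|n|,|m|)^{-s}\,|t|(1+|t|)^{7/5}.$$ -/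

import Mathlib

open MeasureTheory ProbabilityTheory Set Filter Topology
open scoped ENNReal ComplexConjugate

noncomputable section

namespace KPII

/-- The admissible frequencies: pairs of integers whose first component is not zero. -/
abbrev Freq : Type := {n : ℤ × ℤ // n.1 ≠ 0}

/-- The size `|n| = |n₁| + |n₂|` of a frequency. -/
def size (n : ℤ × ℤ) : ℝ := |(n.1 : ℝ)| + |(n.2 : ℝ)|

/-- The dispersion relation `ω_n = n₁³ - n₂² / n₁`. -/
def disp (n : ℤ × ℤ) : ℝ := (n.1 : ℝ) ^ 3 - (n.2 : ℝ) ^ 2 / (n.1 : ℝ)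

/-- The three waves frequency `Δ_n^{k,l} = ω_k + ω_l - ω_n`. -/
def Delta (n k l : ℤ × ℤ) : ℝ := disp k + disp l - disp n

/-- The integral over the torus `(ℝ / 2πℤ)²` of a function that is `2π`-periodic in each of its two
variables. -/
def torusInt (f : ℝ × ℝ → ℂ) : ℂ :=
  ∫ x in (0 : ℝ)..(2 * Real.pi), ∫ y in (0 : ℝ)..(2 * Real.pi), f (x, y)

/-- `2π`-periodicity in each of the two variables. -/
def IsPeriodic {E : Type*} (f : ℝ × ℝ → E) : Prop :=
  ∀ x y : ℝ, f (x + 2 * Real.pi, y) = f (x, y) ∧ f (x, y + 2 * Real.pi) = f (x, y)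

/-- The Fourier coefficient `(2π)⁻² ∫ f(x, y) exp(-i (n₁ x + n₂ y)) dx dy` of a real function. -/
def coeff (f : ℝ × ℝ → ℝ) (n : ℤ × ℤ) : ℂ :=
  ((2 * Real.pi : ℝ) : ℂ)⁻¹ ^ 2 *
    torusInt (fun z => (f z : ℂ) *
      Complex.exp (-(Complex.I * ((n.1 : ℂ) * (z.1 : ℂ) + (n.2 : ℂ) * (z.2 : ℂ)))))

/-- The `H^s` norm, with values in `[0, ∞]`, of a family of Fourier coefficients. -/
def hsNorm (s : ℝ) (c : ℤ × ℤ → ℂ) : ℝ≥0∞ :=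
  (∑' n : Freq, ENNReal.ofReal (size n ^ (2 * s)) * ‖c n‖ₑ ^ 2) ^ (1 / 2 : ℝ)

/-- Membership in the space `H^s` of real functions on the torus whose mean in the first variable
is zero. It is used for `s > 1` only, where each class of functions modulo null sets has exactly one
continuous representative, and this representative is the one that is considered. -/
structure MemHs (s : ℝ) (f : ℝ × ℝ → ℝ) : Prop where
  continuous : Continuous f
  periodic : IsPeriodic f
  mean_zero : ∀ y : ℝ, ∫ x in (0 : ℝ)..(2 * Real.pi), f (x, y) = 0
  norm_lt_top : hsNorm s (coeff f) < ⊤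

/-- `∂_x^j φ` -/
def dx (j : ℕ) (φ : ℝ × ℝ → ℂ) (z : ℝ × ℝ) : ℂ := iteratedDeriv j (fun x => φ (x, z.2)) z.1

/-- `∂_y^j φ` -/
def dy (j : ℕ) (φ : ℝ × ℝ → ℂ) (z : ℝ × ℝ) : ℂ := iteratedDeriv j (fun y => φ (z.1, y)) z.2

/-- `u` belongs to `C([-T, T], H^s)` and solves
`∂_x (∂_t u + ∂_x³ u + (ε / 2) ∂_x (u²)) + ∂_y² u = 0` on `[-T, T]` in the sense of distributions on
the torus, with initial datum the function whose Fourier coefficients are the `c n`. -/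
structure IsSolution (s ε T : ℝ) (c : ℤ × ℤ → ℂ) (u : ℝ → ℝ × ℝ → ℝ) : Prop where
  mem : ∀ t ∈ Icc (-T) T, MemHs s (u t)
  continuous_in_time : ∀ t ∈ Icc (-T) T,
    Tendsto (fun τ => hsNorm s (coeff (fun z => u τ z - u t z))) (𝓝[Icc (-T) T] t) (𝓝 0)
  initial : ∀ n : ℤ × ℤ, n.1 ≠ 0 → coeff (u 0) n = c n
  equation : ∀ φ : ℝ × ℝ → ℂ, ContDiff ℝ ((⊤ : ℕ∞) : WithTop ℕ∞) φ → IsPeriodic φ → ∀ t ∈ Icc (-T) T,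
    HasDerivWithinAt (fun τ => torusInt (fun z => (u τ z : ℂ) * dx 1 φ z))
      (torusInt (fun z => (u t z : ℂ) * (dx 4 φ z + dy 2 φ z)
        + (ε / 2 : ℂ) * (u t z : ℂ) ^ 2 * dx 2 φ z))
      (Icc (-T) T) t

/-- A random solution on `[-T, T]` with random initial datum `∑ λ_n g_n e^{i n z}`: almost every
path is a solution, and the Fourier coefficients at each time are random variables. -/
structure IsRandomSolution {Ω : Type*} [MeasurableSpace Ω] (μ : Measure Ω) (s ε T : ℝ)
    (g : ℤ × ℤ → Ω → ℂ) (lam : ℤ × ℤ → ℂ) (u : ℝ → Ω → ℝ × ℝ → ℝ) : Prop where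
  path : ∀ᵐ ω ∂μ, IsSolution s ε T (fun n => lam n * g n ω) (fun t => u t ω)
  measurable_coeff : ∀ t ∈ Icc (-T) T, ∀ n : ℤ × ℤ, n.1 ≠ 0 →
    AEMeasurable (fun ω => coeff (u t ω) n) μ

/-- `(cos (Δ_n^{k,l} t) - 1) / (Δ_n^{k,l})²` -/
def osc (n k l : ℤ × ℤ) (t : ℝ) : ℝ := (Real.cos (Delta n k l * t) - 1) / Delta n k l ^ 2

/-- The term of index `(k, l)` with `l = n - k` of the series in `F_{n,n}(t)`; it is present when
`k₁ ≠ 0` and `l₁ ≠ 0`. -/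
def seriesTerm (lam : ℤ × ℤ → ℂ) (n : ℤ × ℤ) (t : ℝ) (k : ℤ × ℤ) : ℝ :=
  if k.1 ≠ 0 ∧ (n - k).1 ≠ 0 then
    osc n k (n - k) t *
      ((k.1 : ℝ) * ‖lam n‖ ^ 2 * ‖lam (n - k)‖ ^ 2
        + ((n - k).1 : ℝ) * ‖lam n‖ ^ 2 * ‖lam k‖ ^ 2
        - (n.1 : ℝ) * ‖lam k‖ ^ 2 * ‖lam (n - k)‖ ^ 2)
  else 0

/-- The second order coefficient on the diagonal, as a function of the second and fourth absolute
moments `m₂`, `m₄` of the `g_n`. -/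
def diagF (lam : ℤ × ℤ → ℂ) (m₂ m₄ : ℝ) (n : ℤ × ℤ) (t : ℝ) : ℝ :=
  (n.1 : ℝ) * m₂ ^ 2 * ∑' k : ℤ × ℤ, seriesTerm lam n t k
    + (n.1 : ℝ) * (m₄ - 2 * m₂ ^ 2) *
      (2 * (n.1 : ℝ) * osc n (-n) (n + n) t * ‖lam n‖ ^ 4
        - if Even n.1 ∧ Even n.2 then
            (n.1 : ℝ) / 2 * osc n (n.1 / 2, n.2 / 2) (n.1 / 2, n.2 / 2) t
              * ‖lam (n.1 / 2, n.2 / 2)‖ ^ 4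
          else 0)

/-- The second order coefficient `F_{n,m}(t)`. -/
def secondOrder {Ω : Type*} [MeasurableSpace Ω] (μ : Measure Ω)
    (g : ℤ × ℤ → Ω → ℂ) (lam : ℤ × ℤ → ℂ) (n m : ℤ × ℤ) (t : ℝ) : ℝ :=
  if n = m then diagF lam (∫ ω, ‖g n ω‖ ^ 2 ∂μ) (∫ ω, ‖g n ω‖ ^ 4 ∂μ) n t else 0

end KPII

end

noncomputable section

namespace KPII

/-! ### Frequencies and the three waves frequency -/

/-! KP-II has no resonances: with l = n - k, the product Δ_n^{k,l}·n₁k₁l₁ is minus a sum of squares,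
whence |Δ_n^{k,l}| ≥ 3|n₁k₁l₁| (`le_abs_Delta`). For v_n(t) = e^{-iω_n t} u_n(t) the equation reads
∂_t v_n = -(iε/2) n₁ ∑_k e^{iΔt} v_k v_{n-k}. Integration by parts in time replaces n₁ by n₁/Δ, of
size at most 1/|k₁l₁|, and this gain absorbs the derivative that appears when ∂_t falls on one of
the two factors. So the Duhamel operator loses no derivative (`IsPath.duh`) in the space ℓ¹ ∩ (ℓ^∞
with weight |n|^s), which contains H^s for s > 1 and is stable under convolution (`Bdd.kernel`).

On [-L, L] each Duhamel iteration costs ε√(1+L) (`HasOrder.duh`). A bootstrap bounds v as long as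
ε²T is small (`IsInteraction.bdd`), which covers the scale ε^{-5/3}. Then v = a + `order1` +
`order2` + `order3` + `rem4`, and in v_n conj(v_m) all that is not a product of terms of total order
at most 3 has size ε⁴(1+|t|)². For small times the factor |t| comes from the vanishing of the
remainders at time 0.

The law of the datum is invariant under independent rotations of its coefficients. The term of order
j is homogeneous of degree j + 1 in the datum and commutes with translations of the torus, so
expectations of products vanish for n ≠ m and for odd total order (`integral_mul_conj_eq_zero`).
What remains at order ε² is E|order1|² + 2 Re E(order2 conj a) on the diagonal. Four point
correlations vanish unless the frequencies are paired, which makes this sum explicit: the Gaussian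
part of the moments gives the series in F, and the defect m₄ - 2m₂² lives on k = -n, k = 2n and k =
n/2 (`re_integral_second_order`).

The uniform bound on F uses the same lower bound on Δ, now squared, together with the summability of
|n|^{2s}|λ_n|² and the stability of that weighted ℓ¹ space under convolution. -/

theorem size_nonneg (n : ℤ × ℤ) : 0 ≤ size n := by unfold size; positivity

theorem one_le_size {n : ℤ × ℤ} (h : n.1 ≠ 0) : 1 ≤ size n := by
  have h1 : (1 : ℝ) ≤ |(n.1 : ℝ)| := by exact_mod_cast Int.one_le_abs h
  have := abs_nonneg (n.2 : ℝ)
  unfold size; linarith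

theorem abs_fst_le_size (n : ℤ × ℤ) : |(n.1 : ℝ)| ≤ size n := by
  have := abs_nonneg (n.2 : ℝ)
  unfold size; linarith

theorem size_le_add (n k : ℤ × ℤ) : size n ≤ size k + size (n - k) := by
  have h1 : |(n.1 : ℝ)| ≤ |(k.1 : ℝ)| + |((n - k).1 : ℝ)| := by
    have := abs_add_le (k.1 : ℝ) ((n - k).1 : ℝ)
    simpa using this
  have h2 : |(n.2 : ℝ)| ≤ |(k.2 : ℝ)| + |((n - k).2 : ℝ)| := by
    have := abs_add_le (k.2 : ℝ) ((n - k).2 : ℝ)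
    simpa using this
  unfold size; linarith

/-- The larger of |k| and |n - k| is at least |n|/2. This lets the weight be moved onto one factor
of a convolution. -/
theorem size_rpow_le {r : ℝ} (hr : 0 ≤ r) (n k : ℤ × ℤ) :
    size n ^ r ≤ 2 ^ r * (size k ^ r + size (n - k) ^ r) := by
  have hk := size_nonneg k
  have hl := size_nonneg (n - k)
  have h := size_le_add n k
  have hk' : 0 ≤ size k ^ r := Real.rpow_nonneg hk _
  have hl' : 0 ≤ size (n - k) ^ r := Real.rpow_nonneg hl _
  have h2 : (0 : ℝ) ≤ 2 ^ r := by positivity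
  rcases le_total (size k) (size (n - k)) with hle | hle
  · calc size n ^ r ≤ (2 * size (n - k)) ^ r :=
          Real.rpow_le_rpow (size_nonneg n) (by linarith) hr
      _ = 2 ^ r * size (n - k) ^ r := Real.mul_rpow (by norm_num) hl
      _ ≤ _ := by gcongr; linarith
  · calc size n ^ r ≤ (2 * size k) ^ r :=
          Real.rpow_le_rpow (size_nonneg n) (by linarith) hr
      _ = 2 ^ r * size k ^ r := Real.mul_rpow (by norm_num) hk
      _ ≤ _ := by gcongr; linarith

/-- KP-II has no resonances. -/
theorem le_abs_Delta {n k : ℤ × ℤ} (hn : n.1 ≠ 0) (hk : k.1 ≠ 0) (hl : (n - k).1 ≠ 0) :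
    3 * (|(n.1 : ℝ)| * |(k.1 : ℝ)| * |((n - k).1 : ℝ)|) ≤ |Delta n k (n - k)| := by
  have hn' : (n.1 : ℝ) ≠ 0 := by exact_mod_cast hn
  have hk' : (k.1 : ℝ) ≠ 0 := by exact_mod_cast hk
  have hl' : (n.1 : ℝ) - k.1 ≠ 0 := by
    have : ((n - k).1 : ℝ) ≠ 0 := by exact_mod_cast hl
    simpa using this
  set p : ℝ := n.1 * k.1 * ((n.1 : ℝ) - k.1) with hp
  set q : ℝ := k.2 * ((n.1 : ℝ) - k.1) - ((n.2 : ℝ) - k.2) * k.1 with hq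
  have hp0 : p ≠ 0 := by rw [hp]; positivity
  -- Both squares come with the same sign. With the opposite sign in front of n₂²/n₁ (KP-I) they
  -- would compete and Δ could vanish.
  have hD : Delta n k (n - k) * p = -(3 * p ^ 2 + q ^ 2) := by
    simp only [Delta, disp, hp, hq, Prod.fst_sub, Prod.snd_sub, Int.cast_sub]
    field_simp
    ring
  have h1 : |Delta n k (n - k)| * |p| = 3 * |p| ^ 2 + q ^ 2 := by
    rw [← abs_mul, hD, abs_neg, abs_of_nonneg (by positivity), sq_abs]
  have hpp : |(n.1 : ℝ)| * |(k.1 : ℝ)| * |((n - k).1 : ℝ)| = |p| := by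
    rw [hp, abs_mul, abs_mul]; simp
  rw [hpp]
  have hpos : 0 < |p| := abs_pos.2 hp0
  by_contra! hlt
  nlinarith [sq_nonneg q]

theorem Delta_ne_zero {n k : ℤ × ℤ} (hn : n.1 ≠ 0) (hk : k.1 ≠ 0) (hl : (n - k).1 ≠ 0) :
    Delta n k (n - k) ≠ 0 := by
  intro h
  have := le_abs_Delta hn hk hl
  rw [h, abs_zero] at this
  have : 0 < |(n.1 : ℝ)| * |(k.1 : ℝ)| * |((n - k).1 : ℝ)| := by
    have h1 : (n.1 : ℝ) ≠ 0 := by exact_mod_cast hn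
    have h2 : (k.1 : ℝ) ≠ 0 := by exact_mod_cast hk
    have h3 : ((n - k).1 : ℝ) ≠ 0 := by exact_mod_cast hl
    positivity
  linarith

theorem disp_neg (n : ℤ × ℤ) : disp (-n) = -disp n := by
  simp only [disp, Prod.fst_neg, Prod.snd_neg, Int.cast_neg]
  rw [neg_sq, div_neg]
  ring

/-! ### The weight `|n|^{-s}` -/

/-- The weight `|n|^{-s}`. -/
def wt (s : ℝ) (n : ℤ × ℤ) : ℝ := size n ^ (-s)

theorem wt_nonneg (s : ℝ) (n : ℤ × ℤ) : 0 ≤ wt s n := Real.rpow_nonneg (size_nonneg n) _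

theorem wt_mul_size_rpow {s : ℝ} {n : ℤ × ℤ} (h : n.1 ≠ 0) : wt s n * size n ^ s = 1 := by
  have h1 := one_le_size h
  rw [wt, ← Real.rpow_add (by linarith)]; simp

theorem wt_le_one {s : ℝ} (hs : 0 ≤ s) {n : ℤ × ℤ} (h : n.1 ≠ 0) : wt s n ≤ 1 :=
  Real.rpow_le_one_of_one_le_of_nonpos (one_le_size h) (by linarith)

theorem summable_wt_sq {s : ℝ} (hs : 1 < s) : Summable (fun n => wt s n ^ 2) := by
  -- The sum over ℤ² of the sup norm to the power -2s converges for 2s > 2, and the sup norm is at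
  -- most `size`.
  have h := EisensteinSeries.summable_one_div_norm_rpow (k := 2 * s) (by linarith)
  rw [← (finTwoArrowEquiv ℤ).symm.summable_iff] at h
  refine Summable.of_nonneg_of_le (fun n => sq_nonneg _) (fun n => ?_) h
  have hw : wt s n ^ 2 = size n ^ (-(2 * s)) := by
    rw [wt, ← Real.rpow_natCast, ← Real.rpow_mul (size_nonneg n)]; congr 1; push_cast; ring
  rw [hw]
  have hx : ‖(finTwoArrowEquiv ℤ).symm n‖ ≤ size n := by
    refine (pi_norm_le_iff_of_nonneg (size_nonneg n)).2 fun i => ?_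
    have h1 := abs_nonneg (n.1 : ℝ)
    have h2 := abs_nonneg (n.2 : ℝ)
    fin_cases i <;> simp [size, Int.norm_eq_abs]
  -- The frequency 0 belongs to the sum and is treated apart: there the weight is 0 raised to a
  -- nonzero power, which is 0.
  rcases (norm_nonneg ((finTwoArrowEquiv ℤ).symm n)).eq_or_lt with h0 | h0
  · have : n = 0 := by
      have h1 := norm_eq_zero.1 h0.symm
      have h2 := congrFun h1 0
      have h3 := congrFun h1 1
      simp at h2 h3
      exact Prod.ext h2 h3
    subst this
    have : size (0 : ℤ × ℤ) = 0 := by simp [size]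
    rw [this, Real.zero_rpow (by linarith)]
    exact Real.rpow_nonneg (norm_nonneg _) _
  · exact Real.rpow_le_rpow_of_nonpos h0 hx (by linarith)

/-- By xy ≤ x² + y². This family is the dominating sequence in the later exchanges of the
convolution sum with derivatives, time integrals and expectations. -/
theorem summable_wt_mul_wt {s : ℝ} (hs : 1 < s) (n : ℤ × ℤ) :
    Summable (fun k => wt s k * wt s (n - k)) := by
  have h := summable_wt_sq hs
  have h' : Summable (fun k => wt s (n - k) ^ 2) := (Equiv.subLeft n).summable_iff.2 h
  refine Summable.of_nonneg_of_le (fun k => mul_nonneg (wt_nonneg _ _) (wt_nonneg _ _))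
    (fun k => ?_) ((h.add h'))
  nlinarith [sq_nonneg (wt s k - wt s (n - k)), sq_nonneg (wt s k), sq_nonneg (wt s (n - k))]

/-! ### Families bounded in `ℓ¹` and in the weighted `ℓ^∞` -/

/-- The family `v` is bounded by `A` in `ℓ¹`, and in `ℓ^∞` with weight `|n|^s`. -/
structure Bdd (s A : ℝ) (v : ℤ × ℤ → ℂ) : Prop where
  sum_le : ∀ S : Finset (ℤ × ℤ), ∑ k ∈ S, ‖v k‖ ≤ A
  decay : ∀ n, size n ^ s * ‖v n‖ ≤ A

namespace Bdd

variable {s A B : ℝ} {v w : ℤ × ℤ → ℂ}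

theorem nonneg (h : Bdd s A v) : 0 ≤ A := by simpa using h.sum_le ∅

theorem summable_norm (h : Bdd s A v) : Summable (fun n => ‖v n‖) :=
  summable_of_sum_le (fun _ => norm_nonneg _) h.sum_le

theorem tsum_le (h : Bdd s A v) : ∑' n, ‖v n‖ ≤ A :=
  h.summable_norm.tsum_le_of_sum_le h.sum_le

theorem norm_le (h : Bdd s A v) (n : ℤ × ℤ) : ‖v n‖ ≤ A := by simpa using h.sum_le {n}

theorem norm_le_wt (h : Bdd s A v) {n : ℤ × ℤ} (hn : n.1 ≠ 0) : ‖v n‖ ≤ A * wt s n := by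
  have h1 := h.decay n
  have h2 := wt_mul_size_rpow (s := s) hn
  calc ‖v n‖ = (wt s n * size n ^ s) * ‖v n‖ := by rw [h2, one_mul]
    _ = (size n ^ s * ‖v n‖) * wt s n := by ring
    _ ≤ _ := by gcongr; exact wt_nonneg _ _

theorem norm_le_wt' (h : Bdd s A v) (h0 : ∀ n : ℤ × ℤ, n.1 = 0 → v n = 0) (n : ℤ × ℤ) :
    ‖v n‖ ≤ A * wt s n := by
  by_cases hn : n.1 = 0
  · rw [h0 n hn, norm_zero]; exact mul_nonneg h.nonneg (wt_nonneg _ _)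
  · exact h.norm_le_wt hn

theorem of_norm_le (h : Bdd s A v) (hw : ∀ n, ‖w n‖ ≤ ‖v n‖) : Bdd s A w where
  sum_le S := (Finset.sum_le_sum fun n _ => hw n).trans (h.sum_le S)
  decay n := (mul_le_mul_of_nonneg_left (hw n)
    (Real.rpow_nonneg (size_nonneg n) _)).trans (h.decay n)

theorem mono (h : Bdd s A v) (hAB : A ≤ B) : Bdd s B v :=
  ⟨fun S => (h.sum_le S).trans hAB, fun n => (h.decay n).trans hAB⟩

theorem add (hv : Bdd s A v) (hw : Bdd s B w) : Bdd s (A + B) (fun n => v n + w n) where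
  sum_le S := by
    calc ∑ k ∈ S, ‖v k + w k‖ ≤ ∑ k ∈ S, (‖v k‖ + ‖w k‖) :=
          Finset.sum_le_sum fun k _ => norm_add_le _ _
      _ ≤ A + B := by rw [Finset.sum_add_distrib]; exact add_le_add (hv.sum_le S) (hw.sum_le S)
  decay n := by
    have h1 := hv.decay n
    have h2 := hw.decay n
    have h3 := norm_add_le (v n) (w n)
    have h4 : 0 ≤ size n ^ s := Real.rpow_nonneg (size_nonneg n) _
    nlinarith

theorem const_mul (hv : Bdd s A v) (c : ℂ) : Bdd s (‖c‖ * A) (fun n => c * v n) where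
  sum_le S := by
    simp_rw [norm_mul, ← Finset.mul_sum]
    exact mul_le_mul_of_nonneg_left (hv.sum_le S) (norm_nonneg c)
  decay n := by
    rw [norm_mul, mul_left_comm]
    exact mul_le_mul_of_nonneg_left (hv.decay n) (norm_nonneg c)

theorem sub (hv : Bdd s A v) (hw : Bdd s B w) : Bdd s (A + B) (fun n => v n - w n) := by
  have := hv.add (hw.of_norm_le (w := fun n => -w n) (fun n => by simp))
  simpa [sub_eq_add_neg] using this

/-- Each of the two bounds involves finitely many coordinates at a time, so coordinatewise
convergence suffices. -/
theorem of_tendsto {α : Type*} {l : Filter α} [l.NeBot] {u : α → ℤ × ℤ → ℂ}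
    (hu : ∀ᶠ a in l, Bdd s A (u a)) (h : ∀ n, Tendsto (fun a => u a n) l (𝓝 (v n))) :
    Bdd s A v where
  sum_le S := le_of_tendsto (tendsto_finsetSum S fun n _ => (h n).norm)
    (hu.mono fun _ ha => ha.sum_le S)
  decay n := le_of_tendsto ((h n).norm.const_mul _) (hu.mono fun _ ha => ha.decay n)

theorem zero (hA : 0 ≤ A) : Bdd s A (fun _ => 0) := ⟨fun S => by simpa, fun n => by simpa⟩

theorem summable_mul_norm (hv : Bdd s A v) (hw : Bdd s B w) (n : ℤ × ℤ) :
    Summable (fun k => ‖v k‖ * ‖w (n - k)‖) :=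
  Summable.of_nonneg_of_le (fun _ => by positivity)
    (fun k => mul_le_mul_of_nonneg_left (hw.norm_le _) (norm_nonneg _))
    (hv.summable_norm.mul_right B)

/-- Convolution with a kernel bounded by one. -/
theorem kernel (hs : 0 ≤ s) (hv : Bdd s A v) (hw : Bdd s B w) {m : ℤ × ℤ → ℤ × ℤ → ℂ}
    (hm : ∀ n k, ‖m n k‖ ≤ 1) :
    Bdd s (2 ^ (s + 1) * (A * B)) (fun n => ∑' k, m n k * v k * w (n - k)) := by
  have hA := hv.nonneg
  have hB := hw.nonneg
  have hsum := hv.summable_mul_norm hw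
  have hterm : ∀ n k, ‖m n k * v k * w (n - k)‖ ≤ ‖v k‖ * ‖w (n - k)‖ := fun n k => by
    rw [norm_mul, norm_mul]
    have := mul_le_mul_of_nonneg_right (hm n k) (by positivity : 0 ≤ ‖v k‖ * ‖w (n - k)‖)
    linarith
  have hle : ∀ n, ‖∑' k, m n k * v k * w (n - k)‖ ≤ ∑' k, ‖v k‖ * ‖w (n - k)‖ := fun n =>
    tsum_of_norm_bounded (hsum n).hasSum (hterm n)
  have hK : (1 : ℝ) ≤ 2 ^ (s + 1) := Real.one_le_rpow (by norm_num) (by linarith)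
  -- The ℓ¹ bound is Young's inequality. For the weighted bound, |n|^s is put on one of the factors,
  -- which is then bounded pointwise, while the other is summed in ℓ¹.
  refine ⟨fun S => ?_, fun n => ?_⟩
  · calc ∑ n ∈ S, ‖∑' k, m n k * v k * w (n - k)‖ ≤ ∑ n ∈ S, ∑' k, ‖v k‖ * ‖w (n - k)‖ :=
          Finset.sum_le_sum fun n _ => hle n
      _ = ∑' k, ∑ n ∈ S, ‖v k‖ * ‖w (n - k)‖ :=
          (Summable.tsum_finsetSum fun n _ => hsum n).symm
      _ ≤ ∑' k, ‖v k‖ * B := by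
          refine Summable.tsum_le_tsum (fun k => ?_) (summable_sum fun n _ => hsum n)
            (hv.summable_norm.mul_right B)
          rw [← Finset.mul_sum]
          refine mul_le_mul_of_nonneg_left ?_ (norm_nonneg _)
          have := hw.sum_le (S.map (Equiv.subRight k).toEmbedding)
          simpa using this
      _ = (∑' k, ‖v k‖) * B := tsum_mul_right
      _ ≤ A * B := mul_le_mul_of_nonneg_right hv.tsum_le hB
      _ ≤ _ := le_mul_of_one_le_left (by positivity) hK
  · have hn0 : 0 ≤ size n ^ s := Real.rpow_nonneg (size_nonneg n) _
    have h1 : Summable (fun k => A * ‖w (n - k)‖) :=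
      ((Equiv.subLeft n).summable_iff.2 hw.summable_norm).mul_left A
    have h2 : Summable (fun k => ‖v k‖ * B) := hv.summable_norm.mul_right B
    have h3 : ∑' k, ‖w (n - k)‖ = ∑' k, ‖w k‖ :=
      (Equiv.subLeft n).tsum_eq (fun k => ‖w k‖)
    calc size n ^ s * ‖∑' k, m n k * v k * w (n - k)‖
        ≤ size n ^ s * ∑' k, ‖v k‖ * ‖w (n - k)‖ := by gcongr; exact hle n
      _ = ∑' k, size n ^ s * (‖v k‖ * ‖w (n - k)‖) := tsum_mul_left.symm
      _ ≤ ∑' k, 2 ^ s * (A * ‖w (n - k)‖ + ‖v k‖ * B) := by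
          refine Summable.tsum_le_tsum (fun k => ?_) ((hsum n).mul_left _)
            ((h1.add h2).mul_left _)
          have e1 := size_rpow_le hs n k
          have e2 := hv.decay k
          have e3 := hw.decay (n - k)
          calc size n ^ s * (‖v k‖ * ‖w (n - k)‖)
              ≤ 2 ^ s * (size k ^ s + size (n - k) ^ s) * (‖v k‖ * ‖w (n - k)‖) := by gcongr
            _ = 2 ^ s * ((size k ^ s * ‖v k‖) * ‖w (n - k)‖
                + ‖v k‖ * (size (n - k) ^ s * ‖w (n - k)‖)) := by ring
            _ ≤ _ := by gcongr
      _ = 2 ^ s * (A * ∑' k, ‖w k‖ + (∑' k, ‖v k‖) * B) := by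
          rw [tsum_mul_left, h1.tsum_add h2, tsum_mul_left, tsum_mul_right, h3]
      _ ≤ 2 ^ s * (A * B + A * B) := by
          gcongr
          exacts [hw.tsum_le, hv.tsum_le]
      _ = _ := by rw [Real.rpow_add (by norm_num), Real.rpow_one]; ring

end Bdd

/-! ### Embedding of `H^s` -/

/-- The constant of the embedding of `H^s` into the space of families controlled by `Bdd`. -/
def embConst (s : ℝ) : ℝ := 1 + ∑' n, wt s n ^ 2

theorem one_le_embConst (s : ℝ) : 1 ≤ embConst s := by
  have : 0 ≤ ∑' n, wt s n ^ 2 := tsum_nonneg fun n => sq_nonneg _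
  unfold embConst; linarith

theorem sum_sq_le_of_hsNorm_le {s R : ℝ} (hR : 0 ≤ R) {c : ℤ × ℤ → ℂ}
    (h : hsNorm s c ≤ ENNReal.ofReal R) (S : Finset Freq) :
    ∑ n ∈ S, (size n ^ s * ‖c n‖) ^ 2 ≤ R ^ 2 := by
  have h1 : (∑' n : Freq, ENNReal.ofReal (size n ^ (2 * s)) * ‖c n‖ₑ ^ 2)
      ≤ ENNReal.ofReal R ^ (2 : ℝ) := by
    have := ENNReal.rpow_le_rpow h (by norm_num : (0 : ℝ) ≤ 2)
    rwa [hsNorm, ← ENNReal.rpow_mul, show (1 / 2 : ℝ) * 2 = 1 by norm_num, ENNReal.rpow_one] at this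
  have h2 := (ENNReal.sum_le_tsum S).trans h1
  rw [ENNReal.ofReal_rpow_of_nonneg hR (by norm_num)] at h2
  have h3 : ∀ n : Freq, ENNReal.ofReal (size n ^ (2 * s)) * ‖c n‖ₑ ^ 2
      = ENNReal.ofReal ((size n ^ s * ‖c n‖) ^ 2) := fun n => by
    rw [← ofReal_norm, ← ENNReal.ofReal_pow (norm_nonneg _), ← ENNReal.ofReal_mul
      (Real.rpow_nonneg (size_nonneg _) _), mul_pow, ← Real.rpow_natCast (size n ^ s),
      ← Real.rpow_mul (size_nonneg _)]
    congr 3; push_cast; ring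
  simp_rw [h3] at h2
  rw [← ENNReal.ofReal_sum_of_nonneg fun _ _ => sq_nonneg _] at h2
  have := (ENNReal.ofReal_le_ofReal_iff (by positivity)).1 h2
  simpa using this

/-- The ℓ¹ bound is Cauchy–Schwarz against |n|^{-s}, square summable on ℤ² exactly because s > 1;
the weighted ℓ^∞ bound follows from ℓ² ⊂ ℓ^∞. -/
theorem Bdd.of_hsNorm_le {s : ℝ} (hs : 1 < s) {R : ℝ} (hR : 0 ≤ R) {c : ℤ × ℤ → ℂ}
    (h0 : ∀ n : ℤ × ℤ, n.1 = 0 → c n = 0) (h : hsNorm s c ≤ ENNReal.ofReal R) :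
    Bdd s (embConst s * R) c := by
  classical
  have hfin := sum_sq_le_of_hsNorm_le hR h
  have hM := one_le_embConst s
  refine ⟨fun S => ?_, fun n => ?_⟩
  · have hsub : ∑ k ∈ S, ‖c k‖ = ∑ n ∈ S.subtype (fun n : ℤ × ℤ => n.1 ≠ 0), ‖c n‖ := by
      rw [Finset.sum_subtype_eq_sum_filter (f := fun k => ‖c k‖), Finset.sum_filter_of_ne]
      intro k _ hk hk1
      exact hk (by rw [h0 k hk1, norm_zero])
    rw [hsub]
    set U := S.subtype (fun n : ℤ × ℤ => n.1 ≠ 0)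
    have h1 : ∑ n ∈ U, ‖c n‖ = ∑ n ∈ U, wt s n * (size n ^ s * ‖c n‖) :=
      Finset.sum_congr rfl fun n _ => by rw [← mul_assoc, wt_mul_size_rpow n.2, one_mul]
    have h2 : (∑ n ∈ U, wt s n * (size n ^ s * ‖c n‖)) ^ 2
        ≤ (∑ n ∈ U, wt s n ^ 2) * ∑ n ∈ U, (size n ^ s * ‖c n‖) ^ 2 :=
      Finset.sum_mul_sq_le_sq_mul_sq _ _ _
    have h3 : ∑ n ∈ U, wt s n ^ 2 ≤ embConst s := by
      have := (summable_wt_sq hs).sum_le_tsum (U.map (Function.Embedding.subtype _))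
        (fun n _ => sq_nonneg _)
      rw [Finset.sum_map] at this
      simp only [Function.Embedding.subtype_apply] at this
      unfold embConst; linarith
    rw [h1]
    refine abs_le_of_sq_le_sq' ?_ (by positivity) |>.2
    calc _ ≤ _ := h2
      _ ≤ embConst s * R ^ 2 := by
          gcongr
          · exact hfin U
      -- `embConst` is at least 1, so it may replace its own square root in the constant.
      _ ≤ (embConst s * R) ^ 2 := by nlinarith [sq_nonneg R]
  · by_cases hn : n.1 = 0
    · rw [h0 n hn, norm_zero, mul_zero]; positivity
    · have := hfin {⟨n, hn⟩}
      rw [Finset.sum_singleton] at this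
      have h1 := (abs_le_of_sq_le_sq' this hR).2
      simp only at h1
      nlinarith

/-! ### Calculus of series and families -/

/-- The mean value inequality bounds the slopes of the i-th term by `u i`, so dominated convergence
applies to the series of slopes. Derivatives are taken within a convex set in order to include the
endpoints of the time interval. -/
theorem hasDerivWithinAt_tsum_of_le {ι : Type*} {S : Set ℝ} (hS : Convex ℝ S) {G G' : ι → ℝ → ℂ}
    {u : ι → ℝ} (hu : Summable u)
    (hG : ∀ i, ∀ t ∈ S, HasDerivWithinAt (G i) (G' i t) S t)
    (hb : ∀ i, ∀ t ∈ S, ‖G' i t‖ ≤ u i) (hsum : ∀ t ∈ S, Summable (fun i => G i t))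
    {t : ℝ} (ht : t ∈ S) :
    HasDerivWithinAt (fun τ => ∑' i, G i τ) (∑' i, G' i t) S t := by
  rw [hasDerivWithinAt_iff_tendsto_slope]
  have hlim : Tendsto (fun τ => ∑' i, slope (G i) t τ) (𝓝[S \ {t}] t) (𝓝 (∑' i, G' i t)) := by
    refine tendsto_tsum_of_dominated_convergence hu
      (fun i => hasDerivWithinAt_iff_tendsto_slope.1 (hG i t ht)) ?_
    filter_upwards [self_mem_nhdsWithin] with τ hτ i
    have hne : τ - t ≠ 0 := sub_ne_zero.2 hτ.2
    have := hS.norm_image_sub_le_of_norm_hasDerivWithin_le (hG i) (hb i) ht hτ.1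
    rw [slope_def_module, norm_smul, norm_inv, inv_mul_le_iff₀ (norm_pos_iff.2 hne)]
    linarith
  refine hlim.congr' ?_
  filter_upwards [self_mem_nhdsWithin] with τ hτ
  simp only [slope_def_module]
  rw [← (hsum τ hτ.1).tsum_sub (hsum t ht), tsum_const_smul'']

/-- A mean value inequality in the norm of `Bdd` for families that are only differentiable
coordinate by coordinate. Duality reduces it to scalar functions: each finite sum of norms is a
finite linear combination of the increments with coefficients of modulus at most 1. -/
theorem Bdd.of_hasDerivWithinAt {s A L : ℝ} {H H' : ℝ → ℤ × ℤ → ℂ}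
    (hd : ∀ t ∈ Icc (-L) L, ∀ n,
      HasDerivWithinAt (fun τ => H τ n) (H' t n) (Icc (-L) L) t)
    (hb : ∀ t ∈ Icc (-L) L, Bdd s A (H' t)) {t : ℝ} (ht : t ∈ Icc (-L) L) :
    Bdd s (A * L) (fun n => H t n - H 0 n) := by
  have hL : 0 ≤ L := by linarith [ht.1, ht.2]
  have h0 : (0 : ℝ) ∈ Icc (-L) L := ⟨by linarith, hL⟩
  have hA : 0 ≤ A := (hb t ht).nonneg
  have htL : |t| ≤ L := abs_le.2 ht
  refine ⟨fun S => ?_, fun n => ?_⟩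
  · let c : ℤ × ℤ → ℂ := fun n =>
      if H t n - H 0 n = 0 then 0 else conj (H t n - H 0 n) / ‖H t n - H 0 n‖
    have hc1 : ∀ n, ‖c n‖ ≤ 1 := fun n => by
      by_cases h : H t n - H 0 n = 0
      · simp [c, h]
      · simp only [c, h, if_false]
        rw [norm_div, RCLike.norm_conj, Complex.norm_real, norm_norm, div_self (norm_ne_zero_iff.2 h)]
    have hc2 : ∀ n, c n * (H t n - H 0 n) = ‖H t n - H 0 n‖ := fun n => by
      by_cases h : H t n - H 0 n = 0
      · simp [h]
      · have h' : (‖H t n - H 0 n‖ : ℂ) ≠ 0 := by exact_mod_cast norm_ne_zero_iff.2 h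
        simp only [c, h, if_false]
        rw [div_mul_eq_mul_div, Complex.conj_mul', pow_two, mul_div_assoc, div_self h', mul_one]
    have hmv := (convex_Icc (-L) L).norm_image_sub_le_of_norm_hasDerivWithin_le
      (f := fun τ => ∑ n ∈ S, c n * H τ n) (f' := fun τ => ∑ n ∈ S, c n * H' τ n) (C := A)
      (fun τ hτ => HasDerivWithinAt.fun_sum fun n _ => (hd τ hτ n).const_mul (c n))
      (fun τ hτ => (norm_sum_le _ _).trans ((Finset.sum_le_sum fun n _ => by
        rw [norm_mul]
        exact mul_le_of_le_one_left (norm_nonneg _) (hc1 n)).trans ((hb τ hτ).sum_le S))) h0 ht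
    have he : (∑ n ∈ S, c n * H t n) - ∑ n ∈ S, c n * H 0 n
        = ((∑ n ∈ S, ‖H t n - H 0 n‖ : ℝ) : ℂ) := by
      rw [← Finset.sum_sub_distrib]
      push_cast
      exact Finset.sum_congr rfl fun n _ => by rw [← mul_sub, hc2]
    rw [he, Complex.norm_real, Real.norm_of_nonneg (Finset.sum_nonneg fun _ _ => norm_nonneg _),
      sub_zero, Real.norm_eq_abs] at hmv
    exact hmv.trans (by gcongr)
  · have hn0 : 0 ≤ size n ^ s := Real.rpow_nonneg (size_nonneg n) _
    have hmv := (convex_Icc (-L) L).norm_image_sub_le_of_norm_hasDerivWithin_le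
      (f := fun τ => ((size n ^ s : ℝ) : ℂ) * H τ n)
      (f' := fun τ => ((size n ^ s : ℝ) : ℂ) * H' τ n) (C := A)
      (fun τ hτ => (hd τ hτ n).const_mul _)
      (fun τ hτ => by
        rw [norm_mul, Complex.norm_real, Real.norm_of_nonneg hn0]
        exact (hb τ hτ).decay n) h0 ht
    rw [← mul_sub, norm_mul, Complex.norm_real, Real.norm_of_nonneg hn0, sub_zero,
      Real.norm_eq_abs] at hmv
    exact hmv.trans (by gcongr)

/-! ### The quadratic interaction and the Duhamel operator -/

/-- The phase `exp(i Δ_n^{k,n-k} t)`. -/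
def ph (n k : ℤ × ℤ) (t : ℝ) : ℂ := Complex.exp ((Delta n k (n - k) * t : ℝ) * Complex.I)

theorem norm_ph (n k : ℤ × ℤ) (t : ℝ) : ‖ph n k t‖ = 1 := Complex.norm_exp_ofReal_mul_I _

theorem hasDerivAt_ph (n k : ℤ × ℤ) (t : ℝ) :
    HasDerivAt (ph n k) (Complex.I * Delta n k (n - k) * ph n k t) t := by
  have h : HasDerivAt (fun t : ℝ => ((Delta n k (n - k) * t : ℝ) : ℂ) * Complex.I)
      (((Delta n k (n - k) * 1 : ℝ) : ℂ) * Complex.I) t :=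
    (((hasDerivAt_id t).const_mul _).ofReal_comp).mul_const _
  convert! h.cexp using 1
  rw [mul_one, ph]; ring

theorem continuous_ph (n k : ℤ × ℤ) : Continuous (ph n k) :=
  continuous_iff_continuousAt.2 fun t => (hasDerivAt_ph n k t).continuousAt

/-- The quadratic interaction in the interaction representation. -/
def quad (t : ℝ) (v w : ℤ × ℤ → ℂ) (n : ℤ × ℤ) : ℂ := ∑' k, ph n k t * v k * w (n - k)

theorem Bdd.quad {s A B : ℝ} {v w : ℤ × ℤ → ℂ} (hs : 0 ≤ s) (hv : Bdd s A v) (hw : Bdd s B w)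
    (t : ℝ) : Bdd s (2 ^ (s + 1) * (A * B)) (quad t v w) :=
  hv.kernel hs hw (m := fun n k => ph n k t) fun n k => (norm_ph n k t).le

/-- The Duhamel term of the interaction of `f` and `g`. -/
def duh (ε : ℝ) (f g : ℝ → ℤ × ℤ → ℂ) (t : ℝ) (n : ℤ × ℤ) : ℂ :=
  -(Complex.I * ε / 2) * n.1 * ∫ τ in (0 : ℝ)..t, quad τ (f τ) (g τ) n

/-- On `[-L, L]`, the family `f` is bounded by `A` and `∂_t f_n = n₁ φ_n` with `φ` bounded
by `A'`. -/
structure IsPath (s L A A' : ℝ) (f φ : ℝ → ℤ × ℤ → ℂ) : Prop where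
  bdd : ∀ t ∈ Icc (-L) L, Bdd s A (f t)
  bdd_deriv : ∀ t ∈ Icc (-L) L, Bdd s A' (φ t)
  zero : ∀ t ∈ Icc (-L) L, ∀ n : ℤ × ℤ, n.1 = 0 → f t n = 0
  deriv : ∀ t ∈ Icc (-L) L, ∀ n,
    HasDerivWithinAt (fun τ => f τ n) ((n.1 : ℂ) * φ t n) (Icc (-L) L) t

/-- The kernel of the normal form transformation. -/
def nf (n k : ℤ × ℤ) : ℂ :=
  if n.1 ≠ 0 ∧ k.1 ≠ 0 ∧ (n - k).1 ≠ 0 then n.1 / (Complex.I * Delta n k (n - k)) else 0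

/-- The lower bound on Δ absorbs n₁ and leaves the full product k₁(n-k)₁ to spare. A time derivative
costs one factor k₁ or (n-k)₁ according to the input it hits, and the three bounds below are the
forms in which this surplus is spent. -/
theorem norm_nf_mul_le (n k : ℤ × ℤ) : ‖nf n k‖ * (|(k.1 : ℝ)| * |((n - k).1 : ℝ)|) ≤ 1 := by
  unfold nf
  split_ifs with h
  · obtain ⟨hn, hk, hl⟩ := h
    have h1 := le_abs_Delta hn hk hl
    have h2 : 0 < |Delta n k (n - k)| := abs_pos.2 (Delta_ne_zero hn hk hl)
    rw [norm_div, norm_mul, Complex.norm_I, one_mul, Complex.norm_real, Complex.norm_intCast,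
      Real.norm_eq_abs, div_mul_eq_mul_div, div_le_one h2]
    have : 0 ≤ |(n.1 : ℝ)| * |(k.1 : ℝ)| * |((n - k).1 : ℝ)| := by positivity
    linarith
  · simp

theorem one_le_abs_intCast {a : ℤ} (h : a ≠ 0) : (1 : ℝ) ≤ |(a : ℝ)| := by
  exact_mod_cast Int.one_le_abs h

theorem norm_nf_le (n k : ℤ × ℤ) : ‖nf n k‖ ≤ 1 := by
  by_cases h : n.1 ≠ 0 ∧ k.1 ≠ 0 ∧ (n - k).1 ≠ 0
  · have h1 := norm_nf_mul_le n k
    have h2 := one_le_mul_of_one_le_of_one_le (one_le_abs_intCast h.2.1) (one_le_abs_intCast h.2.2)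
    nlinarith [norm_nonneg (nf n k)]
  · rw [nf, if_neg h]; simp

theorem norm_nf_fst_le (n k : ℤ × ℤ) : ‖nf n k * k.1‖ ≤ 1 := by
  by_cases h : n.1 ≠ 0 ∧ k.1 ≠ 0 ∧ (n - k).1 ≠ 0
  · have h1 := norm_nf_mul_le n k
    have h2 := one_le_abs_intCast h.2.2
    rw [norm_mul, Complex.norm_intCast]
    have : 0 ≤ ‖nf n k‖ * |(k.1 : ℝ)| := by positivity
    nlinarith
  · rw [nf, if_neg h]; simp

theorem norm_nf_snd_le (n k : ℤ × ℤ) : ‖nf n k * (n - k).1‖ ≤ 1 := by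
  by_cases h : n.1 ≠ 0 ∧ k.1 ≠ 0 ∧ (n - k).1 ≠ 0
  · have h1 := norm_nf_mul_le n k
    have h2 := one_le_abs_intCast h.2.1
    rw [norm_mul, Complex.norm_intCast]
    have : 0 ≤ ‖nf n k‖ * |((n - k).1 : ℝ)| := by positivity
    nlinarith
  · rw [nf, if_neg h]; simp

/-! ### Paths, and integration by parts in time -/

namespace IsPath

variable {s L A A' B B' : ℝ} {f φ g γ : ℝ → ℤ × ℤ → ℂ}

theorem norm_le_wt (hf : IsPath s L A A' f φ) {t : ℝ} (ht : t ∈ Icc (-L) L) (n : ℤ × ℤ) :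
    ‖f t n‖ ≤ A * wt s n := (hf.bdd t ht).norm_le_wt' (hf.zero t ht) n

theorem continuousOn (hf : IsPath s L A A' f φ) (n : ℤ × ℤ) :
    ContinuousOn (fun t => f t n) (Icc (-L) L) :=
  fun t ht => (hf.deriv t ht n).continuousWithinAt

theorem mono (hf : IsPath s L A A' f φ) (hA : A ≤ B) (hA' : A' ≤ B') : IsPath s L B B' f φ :=
  ⟨fun t ht => (hf.bdd t ht).mono hA, fun t ht => (hf.bdd_deriv t ht).mono hA', hf.zero, hf.deriv⟩

theorem add (hf : IsPath s L A A' f φ) (hg : IsPath s L B B' g γ) :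
    IsPath s L (A + B) (A' + B') (fun t n => f t n + g t n) (fun t n => φ t n + γ t n) where
  bdd t ht := (hf.bdd t ht).add (hg.bdd t ht)
  bdd_deriv t ht := (hf.bdd_deriv t ht).add (hg.bdd_deriv t ht)
  zero t ht n hn := by rw [hf.zero t ht n hn, hg.zero t ht n hn, add_zero]
  deriv t ht n := by
    rw [mul_add]
    exact (hf.deriv t ht n).add (hg.deriv t ht n)

theorem congr (hf : IsPath s L A A' f φ) (h : ∀ t ∈ Icc (-L) L, ∀ n, g t n = f t n) :
    IsPath s L A A' g φ where
  bdd t ht := by rw [show g t = f t from funext (h t ht)]; exact hf.bdd t ht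
  bdd_deriv := hf.bdd_deriv
  zero t ht n hn := by rw [h t ht n]; exact hf.zero t ht n hn
  deriv t ht n := (hf.deriv t ht n).congr (fun τ hτ => h τ hτ n) (h t ht n)

theorem const {a : ℤ × ℤ → ℂ} (ha : Bdd s A a) (h0 : ∀ n : ℤ × ℤ, n.1 = 0 → a n = 0)
    (hA' : 0 ≤ A') : IsPath s L A A' (fun _ => a) (fun _ _ => 0) where
  bdd _ _ := ha
  bdd_deriv _ _ := Bdd.zero hA'
  zero _ _ := h0
  deriv t _ n := by simpa using hasDerivWithinAt_const t (Icc (-L) L) (a n)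

theorem summable (hf : IsPath s L A A' f φ) (hg : IsPath s L B B' g γ) {t : ℝ}
    (ht : t ∈ Icc (-L) L) {m : ℤ × ℤ → ℂ} (hm : ∀ k, ‖m k‖ ≤ 1) (n : ℤ × ℤ) :
    Summable (fun k => m k * f t k * g t (n - k)) := by
  refine Summable.of_norm_bounded ((hf.bdd t ht).summable_mul_norm (hg.bdd t ht) n) fun k => ?_
  rw [norm_mul, norm_mul, mul_assoc]
  exact mul_le_of_le_one_left (by positivity) (hm k)

theorem norm_mul_le (hf : IsPath s L A A' f φ) (hg : IsPath s L B B' g γ) {t : ℝ}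
    (ht : t ∈ Icc (-L) L) (n k : ℤ × ℤ) :
    ‖f t k‖ * ‖g t (n - k)‖ ≤ A * B * (wt s k * wt s (n - k)) := by
  calc _ ≤ (A * wt s k) * (B * wt s (n - k)) :=
        mul_le_mul (hf.norm_le_wt ht k) (hg.norm_le_wt ht _) (norm_nonneg _)
          (mul_nonneg (hf.bdd t ht).nonneg (wt_nonneg _ _))
    _ = _ := by ring

theorem continuousOn_quad (hs : 1 < s) (hf : IsPath s L A A' f φ) (hg : IsPath s L B B' g γ)
    (n : ℤ × ℤ) : ContinuousOn (fun t => quad t (f t) (g t) n) (Icc (-L) L) := by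
  unfold quad
  refine continuousOn_tsum (fun k => (((continuous_ph n k).continuousOn).mul
    (hf.continuousOn k)).mul (hg.continuousOn (n - k)))
    ((summable_wt_mul_wt hs n).mul_left (A * B)) fun k t ht => ?_
  rw [norm_mul, norm_mul, norm_ph, one_mul]
  exact hf.norm_mul_le hg ht n k

theorem intervalIntegrable_quad (hs : 1 < s) (hf : IsPath s L A A' f φ)
    (hg : IsPath s L B B' g γ) {t : ℝ} (ht : t ∈ Icc (-L) L) (n : ℤ × ℤ) :
    IntervalIntegrable (fun t => quad t (f t) (g t) n) volume 0 t := by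
  refine ((hf.continuousOn_quad hs hg n).mono ?_).intervalIntegrable
  have hL : 0 ≤ L := by linarith [ht.1, ht.2]
  exact uIcc_subset_Icc ⟨by linarith, hL⟩ ht

theorem hasDerivWithinAt_duh (hs : 1 < s) (hf : IsPath s L A A' f φ) (hg : IsPath s L B B' g γ)
    (ε : ℝ) {t : ℝ} (ht : t ∈ Icc (-L) L) (n : ℤ × ℤ) :
    HasDerivWithinAt (fun τ => duh ε f g τ n)
      ((n.1 : ℂ) * (-(Complex.I * ε / 2) * quad t (f t) (g t) n)) (Icc (-L) L) t := by
  have hc := hf.continuousOn_quad hs hg n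
  have : Fact (t ∈ Icc (-L) L) := ⟨ht⟩
  have h := intervalIntegral.integral_hasDerivWithinAt_right (s := Icc (-L) L) (t := Icc (-L) L)
    (hf.intervalIntegrable_quad hs hg ht n)
    (hc.stronglyMeasurableAtFilter_nhdsWithin measurableSet_Icc t) (hc t ht)
  convert! h.const_mul (-(Complex.I * ε / 2) * (n.1 : ℂ)) using 1
  ring

theorem duh_zero (ε : ℝ) (f g : ℝ → ℤ × ℤ → ℂ) (n : ℤ × ℤ) : duh ε f g 0 n = 0 := by simp [duh]

/-- The series on the left is the boundary term of the integration by parts. When the derivative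
hits the phase it produces iΔ, cancels the denominator of `nf` and restores the derivative-losing
interaction n₁·`quad`. When it hits an input it produces k₁φ_k or (n-k)₁γ_{n-k}, and `nf`
compensates that factor. -/
theorem hasDerivWithinAt_boundary (hs : 1 < s) (hf : IsPath s L A A' f φ)
    (hg : IsPath s L B B' g γ) {t : ℝ} (ht : t ∈ Icc (-L) L) (n : ℤ × ℤ) :
    HasDerivWithinAt (fun τ => ∑' k, (nf n k * ph n k τ) * f τ k * g τ (n - k))
      ((n.1 : ℂ) * quad t (f t) (g t) n
        + ((∑' k, (nf n k * k.1 * ph n k t) * φ t k * g t (n - k))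
          + ∑' k, (nf n k * (n - k).1 * ph n k t) * f t k * γ t (n - k))) (Icc (-L) L) t := by
  have hm1 : ∀ t k, ‖nf n k * ph n k t‖ ≤ 1 := fun t k => by
    rw [norm_mul, norm_ph, mul_one]; exact norm_nf_le n k
  have hm2 : ∀ t (k : ℤ × ℤ), ‖nf n k * k.1 * ph n k t‖ ≤ 1 := fun t k => by
    rw [norm_mul, norm_ph, mul_one]; exact norm_nf_fst_le n k
  have hm3 : ∀ t (k : ℤ × ℤ), ‖nf n k * (n - k).1 * ph n k t‖ ≤ 1 := fun t k => by
    rw [norm_mul, norm_ph, mul_one]; exact norm_nf_snd_le n k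
  have hd1 : ∀ τ ∈ Icc (-L) L, ∀ k, ‖(nf n k * k.1 * ph n k τ) * φ τ k * g τ (n - k)‖
      ≤ A' * B * (wt s k * wt s (n - k)) := fun τ hτ k => by
    have hA' := (hf.bdd_deriv τ hτ).nonneg
    have hB := (hg.bdd τ hτ).nonneg
    by_cases hk : k.1 = 0
    · simp only [hk, Int.cast_zero, mul_zero, zero_mul, norm_zero]
      have := wt_nonneg s k
      have := wt_nonneg s (n - k)
      positivity
    · rw [norm_mul, norm_mul, mul_assoc]
      calc _ ≤ 1 * ((A' * wt s k) * (B * wt s (n - k))) := by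
            refine mul_le_mul (hm2 τ k) (mul_le_mul ((hf.bdd_deriv τ hτ).norm_le_wt hk)
              (hg.norm_le_wt hτ _) (norm_nonneg _) (mul_nonneg hA' (wt_nonneg _ _)))
              (by positivity) zero_le_one
        _ = _ := by ring
  have hd2 : ∀ τ ∈ Icc (-L) L, ∀ k, ‖(nf n k * (n - k).1 * ph n k τ) * f τ k * γ τ (n - k)‖
      ≤ A * B' * (wt s k * wt s (n - k)) := fun τ hτ k => by
    have hA := (hf.bdd τ hτ).nonneg
    have hB' := (hg.bdd_deriv τ hτ).nonneg
    by_cases hk : (n - k).1 = 0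
    · simp only [hk, Int.cast_zero, mul_zero, zero_mul, norm_zero]
      have := wt_nonneg s k
      have := wt_nonneg s (n - k)
      positivity
    · rw [norm_mul, norm_mul, mul_assoc]
      calc _ ≤ 1 * ((A * wt s k) * (B' * wt s (n - k))) := by
            refine mul_le_mul (hm3 τ k) (mul_le_mul (hf.norm_le_wt hτ k)
              ((hg.bdd_deriv τ hτ).norm_le_wt hk) (norm_nonneg _)
              (mul_nonneg hA (wt_nonneg _ _))) (by positivity) zero_le_one
        _ = _ := by ring
  have hd0 : ∀ τ ∈ Icc (-L) L, ∀ k, ‖(n.1 : ℂ) * (ph n k τ * f τ k * g τ (n - k))‖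
      ≤ |(n.1 : ℝ)| * (A * B * (wt s k * wt s (n - k))) := fun τ hτ k => by
    rw [norm_mul, norm_mul, norm_mul, norm_ph, one_mul, Complex.norm_intCast]
    exact mul_le_mul_of_nonneg_left (hf.norm_mul_le hg hτ n k) (abs_nonneg _)
  have hW := summable_wt_mul_wt hs n
  have key := hasDerivWithinAt_tsum_of_le (convex_Icc (-L) L)
    (G := fun k τ => (nf n k * ph n k τ) * f τ k * g τ (n - k))
    (G' := fun k τ => (n.1 : ℂ) * (ph n k τ * f τ k * g τ (n - k))
      + ((nf n k * k.1 * ph n k τ) * φ τ k * g τ (n - k)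
        + (nf n k * (n - k).1 * ph n k τ) * f τ k * γ τ (n - k)))
    (((hW.mul_left (A * B)).mul_left |(n.1 : ℝ)|).add
      ((hW.mul_left (A' * B)).add (hW.mul_left (A * B')))) ?_ ?_ ?_ ht
  · convert! key using 1
    have s0 : Summable (fun k => (n.1 : ℂ) * (ph n k t * f t k * g t (n - k))) :=
      Summable.of_norm_bounded ((hW.mul_left (A * B)).mul_left |(n.1 : ℝ)|) (hd0 t ht)
    have s1 := Summable.of_norm_bounded (hW.mul_left (A' * B)) (hd1 t ht)
    have s2 := Summable.of_norm_bounded (hW.mul_left (A * B')) (hd2 t ht)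
    rw [s0.tsum_add (s1.add s2), s1.tsum_add s2, tsum_mul_left, quad]
  · intro k τ hτ
    have h1 := ((hasDerivAt_ph n k τ).hasDerivWithinAt (s := Icc (-L) L)).const_mul (nf n k)
    have h2 := (h1.mul (hf.deriv τ hτ k)).mul (hg.deriv τ hτ (n - k))
    refine h2.congr_deriv ?_
    -- Where `nf` is set to 0, one of n₁, f_k, g_{n-k} vanishes, so the cancellation of the
    -- denominator holds for every k.
    have hz : nf n k * (Complex.I * Delta n k (n - k)) * (f τ k * g τ (n - k))
        = (n.1 : ℂ) * (f τ k * g τ (n - k)) := by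
      by_cases h : n.1 ≠ 0 ∧ k.1 ≠ 0 ∧ (n - k).1 ≠ 0
      · rw [nf, if_pos h, div_mul_cancel₀]
        have : (Delta n k (n - k) : ℂ) ≠ 0 := by
          exact_mod_cast Delta_ne_zero h.1 h.2.1 h.2.2
        exact mul_ne_zero Complex.I_ne_zero this
      · rw [nf, if_neg h, zero_mul, zero_mul]
        by_cases h1 : n.1 = 0
        · simp [h1]
        · by_cases h2 : k.1 = 0
          · rw [hf.zero τ hτ k h2]; ring
          · have h3 : (n - k).1 = 0 := by
              by_contra h3
              exact h ⟨h1, h2, h3⟩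
            rw [hg.zero τ hτ _ h3]; ring
    simp only [Pi.mul_apply]
    linear_combination (ph n k τ) * hz
  · intro k τ hτ
    refine (norm_add_le _ _).trans (add_le_add (hd0 τ hτ k) ?_)
    exact (norm_add_le _ _).trans (add_le_add (hd1 τ hτ k) (hd2 τ hτ k))
  · intro τ hτ
    exact hf.summable hg hτ (hm1 τ) n

/-- The normal form estimate: the Duhamel operator loses no derivative. -/
theorem duh (hs : 1 < s) (hf : IsPath s L A A' f φ) (hg : IsPath s L B B' g γ) {ε : ℝ}
    (hε : 0 ≤ ε) (hL : 0 ≤ L) :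
    IsPath s L (ε * 2 ^ (s + 1) * (A * B + L * (A' * B + A * B'))) (ε * 2 ^ (s + 1) * (A * B))
      (duh ε f g) (fun t n => -(Complex.I * ε / 2) * quad t (f t) (g t) n) := by
  have hs0 : 0 ≤ s := by linarith
  have hL0 : (0 : ℝ) ∈ Icc (-L) L := ⟨by linarith, hL⟩
  have hA := (hf.bdd 0 hL0).nonneg
  have hA' := (hf.bdd_deriv 0 hL0).nonneg
  have hB := (hg.bdd 0 hL0).nonneg
  have hB' := (hg.bdd_deriv 0 hL0).nonneg
  have hnc : ‖Complex.I * (ε : ℂ) / 2‖ = ε / 2 := by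
    simp [abs_of_nonneg hε]
  have hK : (0 : ℝ) ≤ 2 ^ (s + 1) := by positivity
  refine ⟨fun t ht => ?_, fun t ht => ?_, fun t ht n hn => ?_, fun t ht n =>
    hf.hasDerivWithinAt_duh hs hg ε ht n⟩
  · set c : ℂ := Complex.I * ε / 2 with hc
    let b : ℝ → ℤ × ℤ → ℂ := fun τ n => ∑' k, (nf n k * ph n k τ) * f τ k * g τ (n - k)
    have hb : ∀ τ ∈ Icc (-L) L, Bdd s (2 ^ (s + 1) * (A * B)) (b τ) := fun τ hτ =>
      (hf.bdd τ hτ).kernel hs0 (hg.bdd τ hτ) (m := fun n k => nf n k * ph n k τ) fun n k => by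
        rw [norm_mul, norm_ph, mul_one]; exact norm_nf_le n k
    -- In the derivative of `duh` + c·b the two occurrences of n₁·`quad` cancel; what is left has
    -- bounded kernels and can be integrated in time.
    have hH := Bdd.of_hasDerivWithinAt (s := s) (L := L)
      (A := ‖c‖ * (2 ^ (s + 1) * (A' * B) + 2 ^ (s + 1) * (A * B')))
      (H := fun τ n => KPII.duh ε f g τ n + c * b τ n)
      (H' := fun τ n => c * ((∑' k, (nf n k * k.1 * ph n k τ) * φ τ k * g τ (n - k))
          + ∑' k, (nf n k * (n - k).1 * ph n k τ) * f τ k * γ τ (n - k)))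
      (fun τ hτ n => by
        refine ((hf.hasDerivWithinAt_duh hs hg ε hτ n).add
          ((hf.hasDerivWithinAt_boundary hs hg hτ n).const_mul c)).congr_deriv ?_
        rw [hc]; ring)
      (fun τ hτ => Bdd.const_mul (Bdd.add
        ((hf.bdd_deriv τ hτ).kernel hs0 (hg.bdd τ hτ)
          (m := fun n k => nf n k * k.1 * ph n k τ) fun n k => by
            rw [norm_mul, norm_ph, mul_one]; exact norm_nf_fst_le n k)
        ((hf.bdd τ hτ).kernel hs0 (hg.bdd_deriv τ hτ)
          (m := fun n k => nf n k * (n - k).1 * ph n k τ) fun n k => by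
            rw [norm_mul, norm_ph, mul_one]; exact norm_nf_snd_le n k)) c) ht
    have h2 := (hH.sub ((hb t ht).const_mul c)).add ((hb 0 hL0).const_mul c)
    have he : (fun n => KPII.duh ε f g t n + c * b t n - (KPII.duh ε f g 0 n + c * b 0 n)
        - c * b t n + c * b 0 n) = KPII.duh ε f g t := by
      funext n
      rw [duh_zero]; ring
    rw [he] at h2
    -- The boundary terms at t and at 0 give twice (ε/2)·2^(s+1)·AB, and the integrated term gives
    -- (ε/2)·2^(s+1)·L(A'B + AB').
    refine h2.mono ?_
    rw [hnc]
    have h3 : 0 ≤ ε * 2 ^ (s + 1) * (L * (A' * B + A * B')) := by positivity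
    nlinarith
  · have := ((hf.bdd t ht).quad hs0 (hg.bdd t ht) t).const_mul (-(Complex.I * ε / 2))
    refine this.mono ?_
    rw [norm_neg, hnc]
    have : 0 ≤ ε * 2 ^ (s + 1) * (A * B) := by positivity
    nlinarith
  · simp [KPII.duh, hn]

end IsPath

/-! ### Bilinearity of the Duhamel operator -/

namespace IsPath

variable {s L A A' B B' D D' : ℝ} {f φ g γ h η : ℝ → ℤ × ℤ → ℂ}

theorem duh_sub_left (hs : 1 < s) (hf : IsPath s L A A' f φ) (hh : IsPath s L D D' h η)
    (hg : IsPath s L B B' g γ) (ε : ℝ) {t : ℝ} (ht : t ∈ Icc (-L) L) (n : ℤ × ℤ) :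
    KPII.duh ε (fun τ n => f τ n - h τ n) g t n = KPII.duh ε f g t n - KPII.duh ε h g t n := by
  have hL : 0 ≤ L := by linarith [ht.1, ht.2]
  have hsub : uIcc 0 t ⊆ Icc (-L) L := uIcc_subset_Icc ⟨by linarith, hL⟩ ht
  unfold KPII.duh
  rw [← mul_sub, ← intervalIntegral.integral_sub (hf.intervalIntegrable_quad hs hg ht n)
    (hh.intervalIntegrable_quad hs hg ht n)]
  congr 1
  refine intervalIntegral.integral_congr fun τ hτ => ?_
  simp only [quad]
  have h1 := hf.summable hg (hsub hτ) (m := fun k => ph n k τ) (fun k => (norm_ph n k τ).le) n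
  have h2 := hh.summable hg (hsub hτ) (m := fun k => ph n k τ) (fun k => (norm_ph n k τ).le) n
  rw [← h1.tsum_sub h2]
  exact tsum_congr fun k => by ring

theorem duh_sub_right (hs : 1 < s) (hg : IsPath s L B B' g γ) (hf : IsPath s L A A' f φ)
    (hh : IsPath s L D D' h η) (ε : ℝ) {t : ℝ} (ht : t ∈ Icc (-L) L) (n : ℤ × ℤ) :
    KPII.duh ε g (fun τ n => f τ n - h τ n) t n = KPII.duh ε g f t n - KPII.duh ε g h t n := by
  have hL : 0 ≤ L := by linarith [ht.1, ht.2]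
  have hsub : uIcc 0 t ⊆ Icc (-L) L := uIcc_subset_Icc ⟨by linarith, hL⟩ ht
  unfold KPII.duh
  rw [← mul_sub, ← intervalIntegral.integral_sub (hg.intervalIntegrable_quad hs hf ht n)
    (hg.intervalIntegrable_quad hs hh ht n)]
  congr 1
  refine intervalIntegral.integral_congr fun τ hτ => ?_
  simp only [quad]
  have h1 := hg.summable hf (hsub hτ) (m := fun k => ph n k τ) (fun k => (norm_ph n k τ).le) n
  have h2 := hg.summable hh (hsub hτ) (m := fun k => ph n k τ) (fun k => (norm_ph n k τ).le) n
  rw [← h1.tsum_sub h2]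
  exact tsum_congr fun k => by ring

end IsPath

/-! ### Paths of a given order in the small parameter -/

/-- The path `f` is of size `C (ε √(1 + L))^k` on `[-L, L]`. -/
def HasOrder (s L ε : ℝ) (k : ℕ) (C : ℝ) (f : ℝ → ℤ × ℤ → ℂ) : Prop :=
  ∃ φ, IsPath s L (C * (ε * √(1 + L)) ^ k) (C * (ε * √(1 + L)) ^ k / √(1 + L)) f φ

namespace HasOrder

variable {s L ε C C' : ℝ} {k l : ℕ} {f g h : ℝ → ℤ × ℤ → ℂ}

theorem mono (hf : HasOrder s L ε k C f) (hε : 0 ≤ ε) (hC : C ≤ C') : HasOrder s L ε k C' f := by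
  obtain ⟨φ, hφ⟩ := hf
  refine ⟨φ, hφ.mono ?_ ?_⟩ <;> gcongr

theorem add (hf : HasOrder s L ε k C f) (hg : HasOrder s L ε k C' g) :
    HasOrder s L ε k (C + C') (fun t n => f t n + g t n) := by
  obtain ⟨φ, hφ⟩ := hf
  obtain ⟨γ, hγ⟩ := hg
  exact ⟨_, (hφ.add hγ).mono (by rw [add_mul]) (by rw [add_mul, add_div])⟩

theorem congr (hf : HasOrder s L ε k C f) (h : ∀ t ∈ Icc (-L) L, ∀ n, g t n = f t n) :
    HasOrder s L ε k C g := by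
  obtain ⟨φ, hφ⟩ := hf
  exact ⟨φ, hφ.congr h⟩

/-- The normal form estimate costs ε for the boundary terms and εL for the integrated ones, but the
latter contain a derivative profile, smaller by 1/√(1+L). The total is ε(1 + 2L/√(1+L)) ≤ 3ε√(1+L).
The profile of the result is `quad`, with cost ε only, hence again smaller by 1/√(1+L): the class
reproduces itself. -/
theorem duh (hs : 1 < s) (hε : 0 ≤ ε) (hL : 0 ≤ L) (hC : 0 ≤ C) (hC' : 0 ≤ C')
    (hf : HasOrder s L ε k C f) (hg : HasOrder s L ε l C' g) :
    HasOrder s L ε (k + l + 1) (3 * 2 ^ (s + 1) * (C * C')) (duh ε f g) := by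
  obtain ⟨φ, hφ⟩ := hf
  obtain ⟨γ, hγ⟩ := hg
  have hlam : 1 ≤ √(1 + L) := Real.one_le_sqrt.2 (by linarith)
  have hsq : √(1 + L) ^ 2 = 1 + L := Real.sq_sqrt (by linarith)
  set lam := √(1 + L)
  have hlam0 : 0 < lam := by linarith
  have hK : (0 : ℝ) < 2 ^ (s + 1) := by positivity
  refine ⟨_, (hφ.duh hs hγ hε hL).mono ?_ ?_⟩
  · have h1 : L / lam ≤ lam := by rw [div_le_iff₀ hlam0]; nlinarith
    calc ε * 2 ^ (s + 1) * (C * (ε * lam) ^ k * (C' * (ε * lam) ^ l)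
          + L * (C * (ε * lam) ^ k / lam * (C' * (ε * lam) ^ l)
            + C * (ε * lam) ^ k * (C' * (ε * lam) ^ l / lam)))
        = 2 ^ (s + 1) * (C * C') * (ε * lam) ^ (k + l) * ε * (1 + 2 * (L / lam)) := by
          rw [pow_add]; ring
      _ ≤ 2 ^ (s + 1) * (C * C') * (ε * lam) ^ (k + l) * ε * (3 * lam) := by
          gcongr; linarith
      _ = _ := by rw [pow_succ]; ring
  · calc ε * 2 ^ (s + 1) * (C * (ε * lam) ^ k * (C' * (ε * lam) ^ l))
        = 1 * 2 ^ (s + 1) * (C * C') * ((ε * lam) ^ (k + l) * ε) := by rw [pow_add]; ring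
      _ ≤ 3 * 2 ^ (s + 1) * (C * C') * ((ε * lam) ^ (k + l) * ε) := by gcongr; norm_num
      _ = 3 * 2 ^ (s + 1) * (C * C') * (ε * lam) ^ (k + l + 1) / lam := by
          rw [pow_succ]; field_simp

theorem norm_le (hf : HasOrder s L ε k C f) {t : ℝ} (ht : t ∈ Icc (-L) L) (n : ℤ × ℤ) :
    ‖f t n‖ ≤ C * (ε * √(1 + L)) ^ k * wt s n := by
  obtain ⟨φ, hφ⟩ := hf
  exact hφ.norm_le_wt ht n

/-- Integrating the derivative from time 0 gains |t| at the price of one factor |n₁|. It serves for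
|t| ≤ 1, where the bound of `HasOrder` does not tend to 0 with t. -/
theorem norm_le_of_zero (hf : HasOrder s L ε k C f) (hL : 0 ≤ L) {n : ℤ × ℤ} (hn : n.1 ≠ 0)
    (h0 : f 0 n = 0) {t : ℝ} (ht : t ∈ Icc (-L) L) :
    ‖f t n‖ ≤ |(n.1 : ℝ)| * (C * (ε * √(1 + L)) ^ k / √(1 + L) * wt s n) * |t| := by
  obtain ⟨φ, hφ⟩ := hf
  have h := (convex_Icc (-L) L).norm_image_sub_le_of_norm_hasDerivWithin_le
    (fun τ hτ => hφ.deriv τ hτ n) (fun τ hτ => by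
      rw [norm_mul, Complex.norm_intCast]
      exact mul_le_mul_of_nonneg_left ((hφ.bdd_deriv τ hτ).norm_le_wt hn) (abs_nonneg _))
    (show (0 : ℝ) ∈ Icc (-L) L from ⟨by linarith, hL⟩) ht
  rwa [h0, sub_zero, sub_zero, Real.norm_eq_abs] at h

end HasOrder

/-! ### The equation in the interaction representation -/

/-- The family `v` solves on `[-T, T]` the equation in the interaction representation with initial
datum `a`, and is continuous in time as far as bounds are concerned. -/
structure IsInteraction (s ε T : ℝ) (a : ℤ × ℤ → ℂ) (v : ℝ → ℤ × ℤ → ℂ) : Prop where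
  zero : ∀ t ∈ Icc (-T) T, ∀ n : ℤ × ℤ, n.1 = 0 → v t n = 0
  initial : v 0 = a
  deriv : ∀ t ∈ Icc (-T) T, ∀ n, HasDerivWithinAt (fun τ => v τ n)
    ((n.1 : ℂ) * (-(Complex.I * ε / 2) * quad t (v t) (v t) n)) (Icc (-T) T) t
  bdd_near : ∀ t ∈ Icc (-T) T, ∀ A, Bdd s A (v t) → ∀ η > 0,
    ∀ᶠ τ in 𝓝[Icc (-T) T] t, Bdd s (A + η) (v τ)

namespace IsInteraction

variable {s ε T M L : ℝ} {a : ℤ × ℤ → ℂ} {v : ℝ → ℤ × ℤ → ℂ}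

theorem isPath (hs : 0 ≤ s) (hε : 0 ≤ ε) (h : IsInteraction s ε T a v) (hLT : L ≤ T) {A : ℝ}
    (hb : ∀ t ∈ Icc (-L) L, Bdd s A (v t)) :
    IsPath s L A (ε / 2 * (2 ^ (s + 1) * (A * A))) v
      (fun t n => -(Complex.I * ε / 2) * quad t (v t) (v t) n) := by
  have hsub : Icc (-L) L ⊆ Icc (-T) T := Icc_subset_Icc (by linarith) hLT
  refine ⟨hb, fun t ht => ?_, fun t ht => h.zero t (hsub ht),
    fun t ht n => (h.deriv t (hsub ht) n).mono hsub⟩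
  have h1 := ((hb t ht).quad hs (hb t ht) t).const_mul (-(Complex.I * ε / 2))
  have h2 : ‖-(Complex.I * ε / 2)‖ = ε / 2 := by simp [abs_of_nonneg hε]
  rwa [h2] at h1

theorem eq_add_duh (hs : 1 < s) (hε : 0 ≤ ε) (h : IsInteraction s ε T a v) (hL : 0 ≤ L)
    (hLT : L ≤ T) {A : ℝ} (hb : ∀ t ∈ Icc (-L) L, Bdd s A (v t)) {t : ℝ} (ht : t ∈ Icc (-L) L)
    (n : ℤ × ℤ) : v t n = a n + duh ε v v t n := by
  have hp := h.isPath (by linarith) hε hLT hb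
  have hmv := (convex_Icc (-L) L).norm_image_sub_le_of_norm_hasDerivWithin_le
    (f := fun τ => v τ n - duh ε v v τ n) (f' := fun _ => 0) (C := 0)
    (fun τ hτ => by
      have := (hp.deriv τ hτ n).sub (hp.hasDerivWithinAt_duh hs hp ε hτ n)
      rwa [sub_self] at this) (fun _ _ => by simp)
    (show (0 : ℝ) ∈ Icc (-L) L from ⟨by linarith, hL⟩) ht
  rw [zero_mul, norm_le_zero_iff, IsPath.duh_zero, h.initial] at hmv
  linear_combination hmv

/-- The bootstrap step: inserting the bound 2M in the Duhamel formula returns 3M/2. One smallness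
condition controls the boundary terms, the other the terms integrated over a time L. -/
theorem bdd_improve (hs : 1 < s) (hε : 0 ≤ ε) (h : IsInteraction s ε T a v) (hM : 1 ≤ M)
    (ha : Bdd s M a) (hε1 : 16 * (ε * 2 ^ (s + 1) * M) ≤ 1)
    (hT1 : 32 * (ε ^ 2 * T) * (2 ^ (s + 1) * M) ^ 2 ≤ 1) (hL : 0 ≤ L) (hLT : L ≤ T)
    (hb : ∀ t ∈ Icc (-L) L, Bdd s (2 * M) (v t)) {t : ℝ} (ht : t ∈ Icc (-L) L) :
    Bdd s (3 / 2 * M) (v t) := by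
  have hp := h.isPath (by linarith) hε hLT hb
  have hd := ha.add ((hp.duh hs hp hε hL).bdd t ht)
  rw [show (fun n => a n + duh ε v v t n) = v t from
    funext fun n => (h.eq_add_duh hs hε hL hLT hb ht n).symm] at hd
  refine hd.mono ?_
  set K : ℝ := 2 ^ (s + 1) with hK
  have hK0 : 0 < K := by positivity
  have h1 : 32 * (ε ^ 2 * L) * (K * M) ^ 2 ≤ 1 := by
    refine le_trans ?_ hT1
    gcongr
  calc M + ε * K * (2 * M * (2 * M) + L * (ε / 2 * (K * (2 * M * (2 * M))) * (2 * M)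
        + 2 * M * (ε / 2 * (K * (2 * M * (2 * M))))))
      = M + (16 * (ε * K * M)) * M / 4 + (32 * (ε ^ 2 * L) * (K * M) ^ 2) * M / 4 := by ring
    _ ≤ M + 1 * M / 4 + 1 * M / 4 := by gcongr
    _ = _ := by ring

/-- The a priori bound on the time scale `ε^{-2}`. -/
theorem bdd (hs : 1 < s) (hε : 0 ≤ ε) (h : IsInteraction s ε T a v) (hM : 1 ≤ M)
    (ha : Bdd s M a) (hε1 : 16 * (ε * 2 ^ (s + 1) * M) ≤ 1)
    (hT1 : 32 * (ε ^ 2 * T) * (2 ^ (s + 1) * M) ^ 2 ≤ 1) (hT : 0 ≤ T) :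
    ∀ t ∈ Icc (-T) T, Bdd s (2 * M) (v t) := by
  -- The bound on the open interval passes to its endpoints by coordinatewise limits; for x = 0 only
  -- the datum is concerned.
  have hclosed : ∀ x ∈ Icc 0 T, (∀ τ, |τ| < x → Bdd s (2 * M) (v τ)) →
      ∀ τ ∈ Icc (-x) x, Bdd s (2 * M) (v τ) := by
    intro x hx hxb τ hτ
    rcases hx.1.eq_or_lt with h0 | h0
    · have : τ = 0 := by
        rw [← h0] at hτ
        simpa using hτ
      rw [this, h.initial]
      exact ha.mono (by linarith)
    · have hsub : Icc (-x) x ⊆ Icc (-T) T := Icc_subset_Icc (by linarith [hx.2]) hx.2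
      have hcl : τ ∈ closure (Ioo (-x) x) := by rwa [closure_Ioo (by linarith)]
      have : (𝓝[Ioo (-x) x] τ).NeBot := mem_closure_iff_nhdsWithin_neBot.1 hcl
      refine Bdd.of_tendsto (l := 𝓝[Ioo (-x) x] τ) (u := v) ?_ fun n => ?_
      · filter_upwards [self_mem_nhdsWithin] with y hy
        exact hxb y (abs_lt.2 hy)
      · exact ((h.deriv τ (hsub hτ) n).continuousWithinAt).mono
          (Ioo_subset_Icc_self.trans hsub)
  -- Continuous induction on the half-length x of a symmetric interval. The set of good x is an
  -- intersection of half-lines, hence closed.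
  have hS : Icc 0 T ⊆ {x | ∀ τ, |τ| < x → Bdd s (2 * M) (v τ)} := by
    refine IsClosed.Icc_subset_of_forall_exists_gt ?_ ?_ ?_
    · refine IsClosed.inter ?_ isClosed_Icc
      have : {x | ∀ τ, |τ| < x → Bdd s (2 * M) (v τ)}
          = ⋂ τ ∈ {τ | ¬ Bdd s (2 * M) (v τ)}, Iic |τ| := by
        ext x
        simp only [mem_ofPred_eq, mem_iInter, mem_Iic]
        exact forall_congr' fun τ => by rw [← not_lt, not_imp_not]
      rw [this]
      exact isClosed_biInter fun _ _ => isClosed_Iic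
    · intro τ hτ
      exact absurd hτ (not_lt.2 (abs_nonneg τ))
    · rintro x ⟨hxS, hx0, hxT⟩ y hy
      have hb := hclosed x ⟨hx0, hxT.le⟩ hxS
      have himp : ∀ τ ∈ Icc (-x) x, Bdd s (3 / 2 * M) (v τ) := fun τ hτ =>
        h.bdd_improve hs hε hM ha hε1 hT1 hx0 hxT.le hb hτ
      -- The improved bound 3M/2 leaves room M/2 for the continuity in time, so 2M persists near z.
      -- Only z = x and z = -x are needed to enlarge the interval.
      have hev : ∀ z ∈ Icc (-x) x, ∃ δ > 0, ∀ τ ∈ Icc (-T) T, |τ - z| < δ →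
          Bdd s (2 * M) (v τ) := by
        intro z hz
        have := h.bdd_near z ⟨by linarith [hz.1], by linarith [hz.2]⟩ _ (himp z hz) (M / 2)
          (by linarith)
        rw [Metric.nhdsWithin_basis_ball.eventually_iff] at this
        obtain ⟨δ, hδ, hh⟩ := this
        refine ⟨δ, hδ, fun τ hτ hd => ?_⟩
        convert! hh ⟨by rwa [Metric.mem_ball, Real.dist_eq], hτ⟩ using 1
        ring
      obtain ⟨δ₁, hδ₁, h1⟩ := hev x ⟨by linarith, le_rfl⟩
      obtain ⟨δ₂, hδ₂, h2⟩ := hev (-x) ⟨le_rfl, by linarith⟩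
      have hy' : x < y := hy
      refine ⟨min (min (x + δ₁) (x + δ₂)) (min y T), fun τ hτ => ?_, ?_, ?_⟩
      · simp only [lt_min_iff] at hτ
        obtain ⟨⟨hτ1, hτ2⟩, -, hτ3⟩ := hτ
        rcases le_or_gt |τ| x with hle | hgt
        · exact hb τ (abs_le.1 hle)
        · have hmem : τ ∈ Icc (-T) T := abs_le.1 hτ3.le
          rcases le_total 0 τ with hp | hn
          · rw [abs_of_nonneg hp] at hτ1 hgt
            exact h1 τ hmem (by rw [abs_lt]; constructor <;> linarith)
          · rw [abs_of_nonpos hn] at hτ2 hgt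
            exact h2 τ hmem (by rw [abs_lt]; constructor <;> linarith)
      · simp only [lt_min_iff]
        exact ⟨⟨by linarith, by linarith⟩, hy', hxT⟩
      · exact (min_le_right _ _).trans (min_le_left _ _)
  exact hclosed T ⟨hT, le_rfl⟩ (hS ⟨hT, le_rfl⟩)

end IsInteraction

/-! ### Expansion of the solution to the third order -/

/-- The first order term of the expansion. -/
def order1 (ε : ℝ) (a : ℤ × ℤ → ℂ) : ℝ → ℤ × ℤ → ℂ := duh ε (fun _ => a) (fun _ => a)

/-- The second order term of the expansion. -/
def order2 (ε : ℝ) (a : ℤ × ℤ → ℂ) (t : ℝ) (n : ℤ × ℤ) : ℂ :=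
  duh ε (fun _ => a) (order1 ε a) t n + duh ε (order1 ε a) (fun _ => a) t n

/-- The third order term of the expansion. -/
def order3 (ε : ℝ) (a : ℤ × ℤ → ℂ) (t : ℝ) (n : ℤ × ℤ) : ℂ :=
  duh ε (fun _ => a) (order2 ε a) t n + duh ε (order2 ε a) (fun _ => a) t n
    + duh ε (order1 ε a) (order1 ε a) t n

/-- The first remainder of the expansion. -/
def rem1 (a : ℤ × ℤ → ℂ) (v : ℝ → ℤ × ℤ → ℂ) (t : ℝ) (n : ℤ × ℤ) : ℂ := v t n - a n

/-- The second remainder of the expansion. -/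
def rem2 (ε : ℝ) (a : ℤ × ℤ → ℂ) (v : ℝ → ℤ × ℤ → ℂ) (t : ℝ) (n : ℤ × ℤ) : ℂ :=
  rem1 a v t n - order1 ε a t n

/-- The third remainder of the expansion. -/
def rem3 (ε : ℝ) (a : ℤ × ℤ → ℂ) (v : ℝ → ℤ × ℤ → ℂ) (t : ℝ) (n : ℤ × ℤ) : ℂ :=
  rem2 ε a v t n - order2 ε a t n

/-- The fourth remainder of the expansion. -/
def rem4 (ε : ℝ) (a : ℤ × ℤ → ℂ) (v : ℝ → ℤ × ℤ → ℂ) (t : ℝ) (n : ℤ × ℤ) : ℂ :=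
  rem3 ε a v t n - order3 ε a t n

theorem HasOrder.order1 {s L ε C : ℝ} {a : ℤ × ℤ → ℂ} (hs : 1 < s) (hε : 0 ≤ ε) (hL : 0 ≤ L)
    (hC : 0 ≤ C) (ha : HasOrder s L ε 0 C (fun _ => a)) :
    HasOrder s L ε 1 (3 * 2 ^ (s + 1) * (C * C)) (order1 ε a) :=
  ha.duh hs hε hL hC hC ha

theorem HasOrder.order2 {s L ε C D : ℝ} {a : ℤ × ℤ → ℂ} (hs : 1 < s) (hε : 0 ≤ ε) (hL : 0 ≤ L)
    (hC : 0 ≤ C) (hD : 0 ≤ D) (ha : HasOrder s L ε 0 C (fun _ => a))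
    (h1 : HasOrder s L ε 1 D (KPII.order1 ε a)) :
    HasOrder s L ε 2 (3 * 2 ^ (s + 1) * (C * D) + 3 * 2 ^ (s + 1) * (D * C)) (order2 ε a) :=
  (ha.duh hs hε hL hC hD h1).add (h1.duh hs hε hL hD hC ha)

/-- Each remainder is a sum of Duhamel terms of earlier remainders and earlier terms whose orders
add up, with one more order from the operator itself. These identities follow from bilinearity
alone; the full solution v, of order 0, stays in some of the slots. -/
theorem exists_hasOrder_expansion {s M : ℝ} (hs : 1 < s) (hM : 1 ≤ M) :
    ∃ C, 0 ≤ C ∧ ∀ (ε T L : ℝ) (a : ℤ × ℤ → ℂ) (v : ℝ → ℤ × ℤ → ℂ),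
      0 ≤ ε → 0 ≤ L → L ≤ T → ε * √(1 + L) ≤ 1 → Bdd s M a → IsInteraction s ε T a v →
      (∀ t ∈ Icc (-L) L, Bdd s (2 * M) (v t)) →
      HasOrder s L ε 0 C v ∧ HasOrder s L ε 0 C (fun _ => a) ∧ HasOrder s L ε 1 C (order1 ε a) ∧
      HasOrder s L ε 2 C (order2 ε a) ∧ HasOrder s L ε 3 C (order3 ε a) ∧
      HasOrder s L ε 1 C (rem1 a v) ∧ HasOrder s L ε 2 C (rem2 ε a v) ∧
      HasOrder s L ε 3 C (rem3 ε a v) ∧ HasOrder s L ε 4 C (rem4 ε a v) := by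
  set K : ℝ := 3 * 2 ^ (s + 1) with hK
  have hK0 : 0 ≤ K := by positivity
  -- C0 bounds the size 2M of v and also its profile 2·2^(s+1)·M²·ε, where ε√(1+L) ≤ 1 turns ε into
  -- 1/√(1+L). The next constants follow the recursion of `HasOrder.duh`.
  obtain ⟨C0, hC0⟩ : ∃ C, C = 2 * M + 2 * 2 ^ (s + 1) * M ^ 2 := ⟨_, rfl⟩
  obtain ⟨C1, hC1⟩ : ∃ C, C = K * (C0 * C0) := ⟨_, rfl⟩
  obtain ⟨C2, hC2⟩ : ∃ C, C = K * (C0 * C1) + K * (C1 * C0) := ⟨_, rfl⟩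
  obtain ⟨C3, hC3⟩ : ∃ C, C = K * (C0 * C2) + K * (C2 * C0) + K * (C1 * C1) := ⟨_, rfl⟩
  obtain ⟨C4, hC4⟩ : ∃ C, C = K * (C0 * C3) + K * (C3 * C0) + K * (C1 * C2) + K * (C2 * C1) :=
    ⟨_, rfl⟩
  have h0 : 0 ≤ C0 := by rw [hC0]; positivity
  have h1 : 0 ≤ C1 := by rw [hC1]; positivity
  have h2 : 0 ≤ C2 := by rw [hC2]; positivity
  have h3 : 0 ≤ C3 := by rw [hC3]; positivity
  have h4 : 0 ≤ C4 := by rw [hC4]; positivity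
  refine ⟨C0 + C1 + C2 + C3 + C4, by positivity, ?_⟩
  intro ε T L a v hε hL hLT hδ ha h hb
  have hlam : 1 ≤ √(1 + L) := Real.one_le_sqrt.2 (by linarith)
  have hlam0 : 0 < √(1 + L) := by linarith
  have h2s : (0 : ℝ) < 2 ^ (s + 1) := by positivity
  have hsub : Icc (-L) L ⊆ Icc (-T) T := Icc_subset_Icc (by linarith) hLT
  have ha0 : ∀ n : ℤ × ℤ, n.1 = 0 → a n = 0 := fun n hn => by
    rw [← h.initial]; exact h.zero 0 ⟨by linarith, by linarith⟩ n hn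
  have oa : HasOrder s L ε 0 C0 (fun _ => a) := by
    refine ⟨_, IsPath.const (ha.mono ?_) ha0 (by positivity)⟩
    rw [pow_zero, mul_one, hC0]
    have : 0 ≤ 2 * 2 ^ (s + 1) * M ^ 2 := by positivity
    linarith
  have ov : HasOrder s L ε 0 C0 v := by
    refine ⟨_, (h.isPath (by linarith) hε hLT hb).mono ?_ ?_⟩
    · rw [pow_zero, mul_one, hC0]
      have : 0 ≤ 2 * 2 ^ (s + 1) * M ^ 2 := by positivity
      linarith
    · rw [pow_zero, mul_one, le_div_iff₀ hlam0, hC0]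
      calc ε / 2 * (2 ^ (s + 1) * (2 * M * (2 * M))) * √(1 + L)
          = (2 * 2 ^ (s + 1) * M ^ 2) * (ε * √(1 + L)) := by ring
        _ ≤ (2 * 2 ^ (s + 1) * M ^ 2) * 1 := by gcongr
        _ ≤ _ := by linarith
  have o1 : HasOrder s L ε 1 C1 (order1 ε a) := hC1 ▸ oa.order1 hs hε hL h0
  have o2 : HasOrder s L ε 2 C2 (order2 ε a) := hC2 ▸ oa.order2 hs hε hL h0 h1 o1
  have o3 : HasOrder s L ε 3 C3 (order3 ε a) := hC3 ▸
    ((oa.duh hs hε hL h0 h2 o2).add (o2.duh hs hε hL h2 h0 oa)).add (o1.duh hs hε hL h1 h1 o1)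
  obtain ⟨_, pa⟩ := oa
  obtain ⟨_, pv⟩ := ov
  obtain ⟨_, p1⟩ := o1
  obtain ⟨_, p2⟩ := o2
  have oa : HasOrder s L ε 0 C0 (fun _ => a) := ⟨_, pa⟩
  have ov : HasOrder s L ε 0 C0 v := ⟨_, pv⟩
  have o1 : HasOrder s L ε 1 C1 (order1 ε a) := ⟨_, p1⟩
  have o2 : HasOrder s L ε 2 C2 (order2 ε a) := ⟨_, p2⟩
  have r1 : HasOrder s L ε 1 C1 (rem1 a v) := by
    rw [hC1]
    refine (ov.duh hs hε hL h0 h0 ov).congr fun t ht n => ?_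
    rw [rem1, h.eq_add_duh hs hε hL hLT hb ht n]; ring
  obtain ⟨_, q1⟩ := r1
  have r1 : HasOrder s L ε 1 C1 (rem1 a v) := ⟨_, q1⟩
  -- With B for `duh`: B(v,v) - B(a,a) = B(a, v-a) + B(v-a, v). The next two identities come from
  -- the same splitting of differences of products.
  have e2 : ∀ t ∈ Icc (-L) L, ∀ n, rem2 ε a v t n
      = duh ε (fun _ => a) (rem1 a v) t n + duh ε (rem1 a v) v t n := fun t ht n => by
    have i1 := pa.duh_sub_right hs pv pa ε ht n
    have i2 := pv.duh_sub_left hs pa pv ε ht n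
    rw [rem2, rem1, h.eq_add_duh hs hε hL hLT hb ht n, order1]
    unfold rem1
    rw [i1, i2]
    ring
  have r2 : HasOrder s L ε 2 C2 (rem2 ε a v) := by
    rw [hC2]
    exact ((oa.duh hs hε hL h0 h1 r1).add (r1.duh hs hε hL h1 h0 ov)).congr e2
  obtain ⟨_, q2⟩ := r2
  have r2 : HasOrder s L ε 2 C2 (rem2 ε a v) := ⟨_, q2⟩
  have e3 : ∀ t ∈ Icc (-L) L, ∀ n, rem3 ε a v t n
      = duh ε (fun _ => a) (rem2 ε a v) t n + duh ε (rem2 ε a v) v t n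
        + duh ε (order1 ε a) (rem1 a v) t n := fun t ht n => by
    have i1 := pa.duh_sub_right hs q1 p1 ε ht n
    have i2 := q1.duh_sub_left hs p1 pv ε ht n
    have i3 := p1.duh_sub_right hs pv pa ε ht n
    rw [rem3, e2 t ht n, order2]
    change duh ε (fun _ => a) (rem2 ε a v) t n = _ at i1
    change duh ε (rem2 ε a v) v t n = _ at i2
    change duh ε (order1 ε a) (rem1 a v) t n = _ at i3
    rw [i1, i2, i3]
    ring
  have r3 : HasOrder s L ε 3 C3 (rem3 ε a v) := by
    rw [hC3]
    exact (((oa.duh hs hε hL h0 h2 r2).add (r2.duh hs hε hL h2 h0 ov)).add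
      (o1.duh hs hε hL h1 h1 r1)).congr e3
  obtain ⟨_, q3⟩ := r3
  have r3 : HasOrder s L ε 3 C3 (rem3 ε a v) := ⟨_, q3⟩
  have e4 : ∀ t ∈ Icc (-L) L, ∀ n, rem4 ε a v t n
      = duh ε (fun _ => a) (rem3 ε a v) t n + duh ε (rem3 ε a v) v t n
        + duh ε (order1 ε a) (rem2 ε a v) t n + duh ε (order2 ε a) (rem1 a v) t n :=
      fun t ht n => by
    have i1 := pa.duh_sub_right hs q2 p2 ε ht n
    have i2 := q2.duh_sub_left hs p2 pv ε ht n
    have i3 := p1.duh_sub_right hs q1 p1 ε ht n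
    have i4 := p2.duh_sub_right hs pv pa ε ht n
    rw [rem4, e3 t ht n, order3]
    change duh ε (fun _ => a) (rem3 ε a v) t n = _ at i1
    change duh ε (rem3 ε a v) v t n = _ at i2
    change duh ε (order1 ε a) (rem2 ε a v) t n = _ at i3
    change duh ε (order2 ε a) (rem1 a v) t n = _ at i4
    rw [i1, i2, i3, i4]
    ring
  have r4 : HasOrder s L ε 4 C4 (rem4 ε a v) := by
    rw [hC4]
    exact ((((oa.duh hs hε hL h0 h3 r3).add (r3.duh hs hε hL h3 h0 ov)).add
      (o1.duh hs hε hL h1 h2 r2)).add (o2.duh hs hε hL h2 h1 r1)).congr e4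
  exact ⟨ov.mono hε (by linarith), oa.mono hε (by linarith), o1.mono hε (by linarith),
    o2.mono hε (by linarith), o3.mono hε (by linarith), r1.mono hε (by linarith),
    r2.mono hε (by linarith), r3.mono hε (by linarith), r4.mono hε (by linarith)⟩

/-! ### Fourier series on the torus -/

/-- The character `exp(i (n₁ x + n₂ y))`. -/
def chr (n : ℤ × ℤ) (z : ℝ × ℝ) : ℂ :=
  Complex.exp (Complex.I * ((n.1 : ℂ) * (z.1 : ℂ) + (n.2 : ℂ) * (z.2 : ℂ)))

theorem norm_chr (n : ℤ × ℤ) (z : ℝ × ℝ) : ‖chr n z‖ = 1 := by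
  have : chr n z = Complex.exp ((n.1 * z.1 + n.2 * z.2 : ℝ) * Complex.I) := by
    rw [chr]; congr 1; push_cast; ring
  rw [this, Complex.norm_exp_ofReal_mul_I]

theorem chr_add (n k : ℤ × ℤ) (z : ℝ × ℝ) : chr (n + k) z = chr n z * chr k z := by
  rw [chr, chr, chr, ← Complex.exp_add]
  congr 1
  simp only [Prod.fst_add, Prod.snd_add, Int.cast_add]
  ring

theorem contDiff_chr (n : ℤ × ℤ) {m : WithTop ℕ∞} : ContDiff ℝ m (chr n) := by
  have h1 : ContDiff ℝ m (fun z : ℝ × ℝ => (z.1 : ℂ)) := Complex.ofRealCLM.contDiff.comp contDiff_fst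
  have h2 : ContDiff ℝ m (fun z : ℝ × ℝ => (z.2 : ℂ)) := Complex.ofRealCLM.contDiff.comp contDiff_snd
  exact (contDiff_const.mul ((contDiff_const.mul h1).add (contDiff_const.mul h2))).cexp

theorem continuous_chr (n : ℤ × ℤ) : Continuous (chr n) := (contDiff_chr n (m := 0)).continuous

theorem exp_periodic_aux (k : ℤ) (w : ℂ) (x : ℝ) :
    Complex.exp (Complex.I * (k * ((x + 2 * Real.pi : ℝ) : ℂ) + w))
      = Complex.exp (Complex.I * (k * (x : ℂ) + w)) := by
  rw [Complex.exp_eq_exp_iff_exists_int]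
  exact ⟨k, by push_cast; ring⟩

theorem isPeriodic_chr (n : ℤ × ℤ) : IsPeriodic (chr n) := fun x y =>
  ⟨exp_periodic_aux n.1 _ x, by
    have := exp_periodic_aux n.2 ((n.1 : ℂ) * x) y
    simp only [chr]
    rw [add_comm ((n.1 : ℂ) * (x : ℂ)), this, add_comm]⟩

theorem coeff_eq (f : ℝ × ℝ → ℝ) (n : ℤ × ℤ) :
    coeff f n = ((2 * Real.pi : ℝ) : ℂ)⁻¹ ^ 2 * torusInt (fun z => (f z : ℂ) * chr (-n) z) := by
  unfold coeff chr
  congr 2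
  funext z
  congr 2
  simp only [Prod.fst_neg, Prod.snd_neg, Int.cast_neg]
  ring

theorem torusInt_const_mul (c : ℂ) (f : ℝ × ℝ → ℂ) :
    torusInt (fun z => c * f z) = c * torusInt f := by
  simp only [torusInt, intervalIntegral.integral_const_mul]

theorem continuous_inner {f : ℝ × ℝ → ℂ} (hf : Continuous f) :
    Continuous (fun x => ∫ y in (0 : ℝ)..(2 * Real.pi), f (x, y)) :=
  intervalIntegral.continuous_parametric_intervalIntegral_of_continuous' (f := fun x y => f (x, y))
    hf 0 (2 * Real.pi)

theorem torusInt_add {f g : ℝ × ℝ → ℂ} (hf : Continuous f) (hg : Continuous g) :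
    torusInt (fun z => f z + g z) = torusInt f + torusInt g := by
  unfold torusInt
  rw [← intervalIntegral.integral_add ((continuous_inner hf).intervalIntegrable _ _)
    ((continuous_inner hg).intervalIntegrable _ _)]
  refine intervalIntegral.integral_congr fun x _ => ?_
  exact intervalIntegral.integral_add
    ((hf.comp (Continuous.prodMk_right x)).intervalIntegrable _ _)
    ((hg.comp (Continuous.prodMk_right x)).intervalIntegrable _ _)

theorem hasSum_torusInt {ι : Type*} [Countable ι] {F : ι → ℝ × ℝ → ℂ} {f : ℝ × ℝ → ℂ} {b : ι → ℝ}
    (hF : ∀ i, Continuous (F i)) (hb : Summable b) (hle : ∀ i z, ‖F i z‖ ≤ b i)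
    (hf : ∀ z, HasSum (fun i => F i z) (f z)) :
    HasSum (fun i => torusInt (F i)) (torusInt f) := by
  have hpi : 0 ≤ 2 * Real.pi := by positivity
  unfold torusInt
  refine intervalIntegral.hasSum_integral_of_dominated_convergence
    (fun i _ => b i * |2 * Real.pi - 0|)
    (fun i => (continuous_inner (hF i)).aestronglyMeasurable)
    (fun i => ae_of_all _ fun x _ => intervalIntegral.norm_integral_le_of_norm_le_const
      fun y _ => hle i (x, y))
    (ae_of_all _ fun x _ => hb.mul_right _) intervalIntegrable_const
    (ae_of_all _ fun x _ => ?_)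
  exact intervalIntegral.hasSum_integral_of_dominated_convergence (fun i _ => b i)
    (fun i => ((hF i).comp (Continuous.prodMk_right x)).aestronglyMeasurable)
    (fun i => ae_of_all _ fun y _ => hle i (x, y))
    (ae_of_all _ fun y _ => hb) intervalIntegrable_const (ae_of_all _ fun y _ => hf (x, y))

/-- Pointwise inversion for a continuous periodic function with summable coefficients, transported
from the circle. -/
theorem hasSum_fourier_of_periodic {f : ℝ → ℂ} (hf : Continuous f)
    (hp : ∀ x, f (x + 2 * Real.pi) = f x) {c : ℤ → ℂ}
    (hc : ∀ k : ℤ, c k = ((2 * Real.pi : ℝ) : ℂ)⁻¹ *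
      ∫ x in (0 : ℝ)..(2 * Real.pi), f x * Complex.exp (-(Complex.I * (k * x))))
    (hs : Summable c) (x : ℝ) :
    HasSum (fun k : ℤ => c k * Complex.exp (Complex.I * (k * x))) (f x) := by
  have hT : Fact (0 < 2 * Real.pi) := ⟨by positivity⟩
  have hper : Function.Periodic f (2 * Real.pi) := hp
  let F : C(AddCircle (2 * Real.pi), ℂ) := ⟨hper.lift, continuous_coinduced_dom.2 hf⟩
  have hF : ∀ x : ℝ, F x = f x := fun x => hper.lift_coe x
  have hexp : ∀ (k : ℤ) (x : ℝ), (fourier k (x : AddCircle (2 * Real.pi)) : ℂ)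
      = Complex.exp (Complex.I * (k * x)) := fun k x => by
    rw [fourier_coe_apply]
    congr 1
    have : (Real.pi : ℂ) ≠ 0 := by exact_mod_cast Real.pi_ne_zero
    push_cast
    field_simp
  have hco : ∀ k, fourierCoeff F k = c k := fun k => by
    rw [fourierCoeff_eq_intervalIntegral F k 0, hc k, zero_add, one_div, Complex.real_smul,
      Complex.ofReal_inv]
    congr 1
    refine intervalIntegral.integral_congr fun x _ => ?_
    simp only [smul_eq_mul]
    rw [hexp, hF, mul_comm]
    congr 2
    push_cast; ring
  have h := has_pointwise_sum_fourier_series_of_summable (f := F)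
    (by rwa [show fourierCoeff F = c from funext hco]) (x : AddCircle (2 * Real.pi))
  simp only [hco, hexp, hF, smul_eq_mul] at h
  exact h

/-- One-dimensional inversion is used twice: in x for each Fourier coefficient in y, then in y for
fixed x. Absolute summability glues the iterated sums into one sum over ℤ², with the pairs swapped
so that the frequency in y is the outer index. -/
theorem hasSum_coeff {f : ℝ × ℝ → ℝ} (hf : Continuous f) (hp : IsPeriodic f)
    (hs : Summable (coeff f)) (z : ℝ × ℝ) :
    HasSum (fun k => coeff f k * chr k z) (f z : ℂ) := by
  obtain ⟨x, y⟩ := z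
  have hfc : Continuous (fun z => (f z : ℂ)) := Complex.continuous_ofReal.comp hf
  let g : ℤ → ℝ → ℂ := fun m x => ((2 * Real.pi : ℝ) : ℂ)⁻¹ *
    ∫ y in (0 : ℝ)..(2 * Real.pi), (f (x, y) : ℂ) * Complex.exp (-(Complex.I * (m * y)))
  have hsn : Summable (fun p : ℤ × ℤ => ‖coeff f (p.2, p.1)‖) :=
    (Equiv.prodComm ℤ ℤ).summable_iff.2 hs.norm
  have hg : ∀ (m : ℤ) (x : ℝ), HasSum (fun l : ℤ => coeff f (l, m) * Complex.exp (Complex.I * (l * x)))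
      (g m x) := fun m x => by
    refine hasSum_fourier_of_periodic (f := g m) ?_ ?_ (fun l => ?_) ?_ x
    · refine continuous_const.mul (continuous_inner
        (f := fun z => (f z : ℂ) * Complex.exp (-(Complex.I * (m * z.2)))) (hfc.mul ?_))
      fun_prop
    · intro x
      simp only [g]
      congr 1
      refine intervalIntegral.integral_congr fun y _ => ?_
      simp only [(hp x y).1]
    · rw [coeff, pow_two, mul_assoc]
      congr 1
      rw [torusInt, ← intervalIntegral.integral_const_mul]
      refine intervalIntegral.integral_congr fun x _ => ?_
      simp only [g]
      rw [mul_assoc, ← intervalIntegral.integral_mul_const]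
      congr 1
      refine intervalIntegral.integral_congr fun y _ => ?_
      rw [mul_assoc, ← Complex.exp_add]
      congr 2
      ring
    · have := hs.comp_injective (i := fun l : ℤ => (l, m)) fun a b h => (Prod.ext_iff.1 h).1
      exact this
  have hnexp : ∀ (k : ℤ) (x : ℝ), ‖Complex.exp (Complex.I * (k * x))‖ = 1 := fun k x => by
    have : Complex.I * (k * x) = ((k * x : ℝ) : ℂ) * Complex.I := by push_cast; ring
    rw [this, Complex.norm_exp_ofReal_mul_I]
  have hgs : Summable (fun m => g m x) := by
    have h1 := hsn.prod
    refine Summable.of_norm_bounded h1 fun m => ?_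
    have h2 : Summable (fun l : ℤ => ‖coeff f (l, m)‖) := hsn.prod_factor m
    rw [← (hg m x).tsum_eq]
    refine tsum_of_norm_bounded h2.hasSum fun l => ?_
    rw [norm_mul, hnexp, mul_one]
  have hfx := hasSum_fourier_of_periodic (f := fun y => (f (x, y) : ℂ))
    (hfc.comp (Continuous.prodMk_right x)) (fun y => by rw [(hp x y).2]) (c := fun m => g m x)
    (fun m => rfl) hgs y
  have hall : Summable (fun p : ℤ × ℤ => coeff f (p.2, p.1) * chr (p.2, p.1) (x, y)) := by
    refine Summable.of_norm_bounded hsn fun p => ?_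
    rw [norm_mul, norm_chr, mul_one]
  have heq : (f (x, y) : ℂ) = ∑' p : ℤ × ℤ, coeff f (p.2, p.1) * chr (p.2, p.1) (x, y) := by
    rw [hall.tsum_prod, ← hfx.tsum_eq]
    refine tsum_congr fun m => ?_
    rw [← ((hg m x).mul_right _).tsum_eq]
    refine tsum_congr fun l => ?_
    rw [mul_assoc, ← Complex.exp_add, chr]
    congr 2
    ring
  have := hall.hasSum
  rw [← heq] at this
  exact (Equiv.prodComm ℤ ℤ).hasSum_iff.1 this

/-- Only one factor f is replaced by its Fourier series; integrating each term against the other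
factor gives a Fourier coefficient of f again. -/
theorem torusInt_sq_mul_chr {f : ℝ × ℝ → ℝ} (hf : Continuous f) (hp : IsPeriodic f)
    (hs : Summable (coeff f)) (n : ℤ × ℤ) :
    torusInt (fun z => (f z : ℂ) ^ 2 * chr (-n) z)
      = ((2 * Real.pi : ℝ) : ℂ) ^ 2 * ∑' k, coeff f k * coeff f (n - k) := by
  have hfc : Continuous (fun z => (f z : ℂ)) := Complex.continuous_ofReal.comp hf
  have hpi : ((2 * Real.pi : ℝ) : ℂ) ≠ 0 := by
    exact_mod_cast (by positivity : (2 * Real.pi : ℝ) ≠ 0)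
  have hbound : ∀ z, ‖(f z : ℂ)‖ ≤ ∑' k, ‖coeff f k‖ := fun z => by
    rw [← (hasSum_coeff hf hp hs z).tsum_eq]
    refine tsum_of_norm_bounded hs.norm.hasSum fun k => ?_
    rw [norm_mul, norm_chr, mul_one]
  have h := hasSum_torusInt (F := fun k z => coeff f k * ((f z : ℂ) * chr (-(n - k)) z))
    (f := fun z => (f z : ℂ) ^ 2 * chr (-n) z)
    (fun k => continuous_const.mul (hfc.mul (continuous_chr _)))
    (hs.norm.mul_right (∑' k, ‖coeff f k‖))
    (fun k z => by
      rw [norm_mul, norm_mul, norm_chr, mul_one]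
      exact mul_le_mul_of_nonneg_left (hbound z) (norm_nonneg _))
    (fun z => by
      convert! (hasSum_coeff hf hp hs z).mul_right ((f z : ℂ) * chr (-n) z) using 1
      · funext k
        rw [show -(n - k) = k + -n by ring, chr_add]
        ring
      · ring)
  rw [← h.tsum_eq, ← tsum_mul_left]
  refine tsum_congr fun k => ?_
  rw [torusInt_const_mul, coeff_eq f (n - k)]
  field_simp

/-- For n₁ = 0 the character does not depend on x, and integrating first in x gives the zero mean.
-/
theorem coeff_eq_zero {f : ℝ × ℝ → ℝ} (hf : Continuous f)
    (hm : ∀ y : ℝ, ∫ x in (0 : ℝ)..(2 * Real.pi), f (x, y) = 0) {n : ℤ × ℤ} (hn : n.1 = 0) :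
    coeff f n = 0 := by
  have hfc : Continuous (fun z => (f z : ℂ)) := Complex.continuous_ofReal.comp hf
  rw [coeff_eq, torusInt, intervalIntegral_intervalIntegral_swap]
  · convert! mul_zero _
    have : ∀ y : ℝ, ∫ x in (0 : ℝ)..(2 * Real.pi), (f (x, y) : ℂ) * chr (-n) (x, y) = 0 := by
      intro y
      have h1 : ∀ x : ℝ, chr (-n) (x, y) = chr (-n) (0, y) := fun x => by simp [chr, hn]
      simp_rw [h1]
      rw [intervalIntegral.integral_mul_const, intervalIntegral.integral_ofReal, hm y]
      simp
    simp [this]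
  · have hc : Continuous (Function.uncurry fun x y : ℝ => (f (x, y) : ℂ) * chr (-n) (x, y)) :=
      hfc.mul (continuous_chr _)
    refine (hc.continuousOn.integrableOn_compact
      (isCompact_uIcc (a := (0 : ℝ)) (b := 2 * Real.pi) |>.prod
        (isCompact_uIcc (a := (0 : ℝ)) (b := 2 * Real.pi)))).mono_set ?_
    exact Set.prod_mono uIoc_subset_uIcc uIoc_subset_uIcc

theorem coeff_sub {f g : ℝ × ℝ → ℝ} (hf : Continuous f) (hg : Continuous g) (n : ℤ × ℤ) :
    coeff (fun z => f z - g z) n = coeff f n - coeff g n := by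
  have hfc : Continuous (fun z => (f z : ℂ)) := Complex.continuous_ofReal.comp hf
  have hgc : Continuous (fun z => (g z : ℂ)) := Complex.continuous_ofReal.comp hg
  have h := torusInt_add (f := fun z => (f z : ℂ) * chr (-n) z)
    (g := fun z => -1 * ((g z : ℂ) * chr (-n) z)) (hfc.mul (continuous_chr _))
    (continuous_const.mul (hgc.mul (continuous_chr _)))
  rw [torusInt_const_mul] at h
  have h2 : (fun z => ((f z - g z : ℝ) : ℂ) * chr (-n) z)
      = fun z => (f z : ℂ) * chr (-n) z + -1 * ((g z : ℂ) * chr (-n) z) := by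
    funext z; push_cast; ring
  rw [coeff_eq, coeff_eq f, coeff_eq g, h2, h]
  ring

theorem iteratedDeriv_exp_affine (a b : ℂ) (j : ℕ) :
    iteratedDeriv j (fun x : ℝ => Complex.exp (a * x + b))
      = fun x : ℝ => a ^ j * Complex.exp (a * x + b) := by
  induction j with
  | zero => simp
  | succ j ih =>
    rw [iteratedDeriv_succ, ih]
    funext x
    have h : HasDerivAt (fun x : ℝ => a * (x : ℂ) + b) (a * ((1 : ℝ) : ℂ)) x :=
      (((hasDerivAt_id x).ofReal_comp).const_mul a).add_const b
    rw [(h.cexp.const_mul (a ^ j)).deriv]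
    push_cast; ring

theorem dx_chr (j : ℕ) (n : ℤ × ℤ) (z : ℝ × ℝ) :
    dx j (chr n) z = (Complex.I * n.1) ^ j * chr n z := by
  have : (fun x : ℝ => chr n (x, z.2))
      = fun x : ℝ => Complex.exp (Complex.I * n.1 * x + Complex.I * (n.2 * z.2)) := by
    funext x; simp only [chr]; congr 1; ring
  rw [dx, this, iteratedDeriv_exp_affine, chr]
  ring_nf

theorem dy_chr (j : ℕ) (n : ℤ × ℤ) (z : ℝ × ℝ) :
    dy j (chr n) z = (Complex.I * n.2) ^ j * chr n z := by
  have : (fun y : ℝ => chr n (z.1, y))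
      = fun y : ℝ => Complex.exp (Complex.I * n.2 * y + Complex.I * (n.1 * z.1)) := by
    funext x; simp only [chr]; congr 1; ring
  rw [dy, this, iteratedDeriv_exp_affine, chr]
  ring_nf

/-! ### From the equation to its interaction representation -/

theorem MemHs.coeff_zero {s : ℝ} {f : ℝ × ℝ → ℝ} (h : MemHs s f) {n : ℤ × ℤ} (hn : n.1 = 0) :
    coeff f n = 0 := coeff_eq_zero h.continuous h.mean_zero hn

theorem MemHs.summable_coeff {s : ℝ} (hs : 1 < s) {f : ℝ × ℝ → ℝ} (h : MemHs s f) :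
    Summable (coeff f) := by
  refine (Bdd.of_hsNorm_le hs (R := (hsNorm s (coeff f)).toReal) ENNReal.toReal_nonneg
    (fun n hn => h.coeff_zero hn) ?_).summable_norm.of_norm
  rw [ENNReal.ofReal_toReal h.norm_lt_top.ne]

/-- The Fourier coefficients in the interaction representation. -/
def interaction (u : ℝ → ℝ × ℝ → ℝ) (t : ℝ) (n : ℤ × ℤ) : ℂ :=
  Complex.exp ((-(disp n * t) : ℝ) * Complex.I) * coeff (u t) n

theorem norm_interaction (u : ℝ → ℝ × ℝ → ℝ) (t : ℝ) (n : ℤ × ℤ) :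
    ‖interaction u t n‖ = ‖coeff (u t) n‖ := by
  rw [interaction, norm_mul, Complex.norm_exp_ofReal_mul_I, one_mul]

theorem quad_interaction (u : ℝ → ℝ × ℝ → ℝ) (t : ℝ) (n : ℤ × ℤ) :
    quad t (interaction u t) (interaction u t) n
      = Complex.exp ((-(disp n * t) : ℝ) * Complex.I)
        * ∑' k, coeff (u t) k * coeff (u t) (n - k) := by
  rw [quad, ← tsum_mul_left]
  refine tsum_congr fun k => ?_
  have : Complex.exp ((-(disp n * t) : ℝ) * Complex.I)
      = ph n k t * Complex.exp ((-(disp k * t) : ℝ) * Complex.I)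
        * Complex.exp ((-(disp (n - k) * t) : ℝ) * Complex.I) := by
    rw [ph, ← Complex.exp_add, ← Complex.exp_add]
    congr 1
    rw [Delta]
    push_cast; ring
  rw [this, interaction, interaction]
  ring

namespace IsSolution

variable {s ε T : ℝ} {c : ℤ × ℤ → ℂ} {u : ℝ → ℝ × ℝ → ℝ}

/-- The weak equation is tested against e^{-inz}. It determines the derivative of -in₁ times the
coefficient, and n₁ ≠ 0 allows the division; n₁⁴ - n₂² = n₁ω_n then becomes the dispersion relation.
-/
theorem hasDerivWithinAt_coeff (hs : 1 < s) (h : IsSolution s ε T c u) {t : ℝ}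
    (ht : t ∈ Icc (-T) T) {n : ℤ × ℤ} (hn : n.1 ≠ 0) :
    HasDerivWithinAt (fun τ => coeff (u τ) n)
      (Complex.I * disp n * coeff (u t) n
        - Complex.I * ε / 2 * n.1 * ∑' k, coeff (u t) k * coeff (u t) (n - k))
      (Icc (-T) T) t := by
  have hu := h.mem t ht
  have huc : Continuous (fun z => (u t z : ℂ)) := Complex.continuous_ofReal.comp hu.continuous
  have hpi : ((2 * Real.pi : ℝ) : ℂ) ≠ 0 := by
    exact_mod_cast (by positivity : (2 * Real.pi : ℝ) ≠ 0)
  have hnc : (n.1 : ℂ) ≠ 0 := by exact_mod_cast hn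
  have heq := h.equation (chr (-n)) (contDiff_chr _) (isPeriodic_chr _) t ht
  set P : ℂ := ((2 * Real.pi : ℝ) : ℂ) with hP
  have hco : ∀ τ, torusInt (fun z => (u τ z : ℂ) * chr (-n) z) = P ^ 2 * coeff (u τ) n := by
    intro τ
    rw [coeff_eq, ← hP]
    field_simp
  have hL : (fun τ => torusInt fun z => (u τ z : ℂ) * dx 1 (chr (-n)) z)
      = fun τ => -(Complex.I * n.1) * P ^ 2 * coeff (u τ) n := by
    funext τ
    have : (fun z => (u τ z : ℂ) * dx 1 (chr (-n)) z)
        = fun z => -(Complex.I * n.1) * ((u τ z : ℂ) * chr (-n) z) := by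
      funext z
      rw [dx_chr]
      simp only [Prod.fst_neg, Int.cast_neg]
      ring
    rw [this, torusInt_const_mul, hco]
    ring
  have hR : torusInt (fun z => (u t z : ℂ) * (dx 4 (chr (-n)) z + dy 2 (chr (-n)) z)
        + (ε / 2 : ℂ) * (u t z : ℂ) ^ 2 * dx 2 (chr (-n)) z)
      = ((n.1 : ℂ) ^ 4 - (n.2 : ℂ) ^ 2) * (P ^ 2 * coeff (u t) n)
        + -((ε : ℂ) / 2) * n.1 ^ 2 * (P ^ 2 * ∑' k, coeff (u t) k * coeff (u t) (n - k)) := by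
    have hadd := torusInt_add
      (f := fun z => ((n.1 : ℂ) ^ 4 - (n.2 : ℂ) ^ 2) * ((u t z : ℂ) * chr (-n) z))
      (g := fun z => -((ε : ℂ) / 2) * n.1 ^ 2 * ((u t z : ℂ) ^ 2 * chr (-n) z))
      (continuous_const.mul (huc.mul (continuous_chr _)))
      (continuous_const.mul ((huc.pow 2).mul (continuous_chr _)))
    rw [← torusInt_sq_mul_chr hu.continuous hu.periodic (hu.summable_coeff hs) n, ← hco,
      ← torusInt_const_mul, ← torusInt_const_mul, ← hadd]
    congr 1
    funext z
    rw [dx_chr, dx_chr, dy_chr]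
    simp only [Prod.fst_neg, Prod.snd_neg, Int.cast_neg, mul_pow, Complex.I_sq, Complex.I_pow_four]
    ring
  rw [hL, hR] at heq
  have h2 := heq.const_mul ((-(Complex.I * n.1) * P ^ 2)⁻¹)
  have hne : -(Complex.I * n.1) * P ^ 2 ≠ 0 :=
    mul_ne_zero (neg_ne_zero.2 (mul_ne_zero Complex.I_ne_zero hnc)) (pow_ne_zero 2 hpi)
  have hfun : (fun τ => (-(Complex.I * n.1) * P ^ 2)⁻¹
      * (-(Complex.I * n.1) * P ^ 2 * coeff (u τ) n)) = fun τ => coeff (u τ) n := by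
    funext τ
    rw [← mul_assoc, inv_mul_cancel₀ hne, one_mul]
  rw [hfun] at h2
  refine h2.congr_deriv ?_
  rw [inv_mul_eq_iff_eq_mul₀ hne, disp]
  push_cast
  field_simp
  ring_nf
  simp only [Complex.I_sq]
  ring

theorem isInteraction (hs : 1 < s) (hT : 0 ≤ T) (h : IsSolution s ε T c u) :
    IsInteraction s ε T (fun n => if n.1 = 0 then 0 else c n) (interaction u) where
  zero t ht n hn := by rw [interaction, (h.mem t ht).coeff_zero hn, mul_zero]
  initial := by
    funext n
    split_ifs with hn
    · rw [interaction, (h.mem 0 ⟨by linarith, hT⟩).coeff_zero hn, mul_zero]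
    · rw [interaction, h.initial n hn]; simp
  deriv t ht n := by
    by_cases hn : n.1 = 0
    · rw [hn, Int.cast_zero, zero_mul]
      refine (hasDerivWithinAt_const t _ (0 : ℂ)).congr (fun τ hτ => ?_) ?_
      · rw [interaction, (h.mem τ hτ).coeff_zero hn, mul_zero]
      · rw [interaction, (h.mem t ht).coeff_zero hn, mul_zero]
    · have h1 : HasDerivAt (fun τ : ℝ => ((-(disp n * τ) : ℝ) : ℂ) * Complex.I)
          (((-(disp n * 1) : ℝ) : ℂ) * Complex.I) t :=
        ((((hasDerivAt_id t).const_mul _).neg).ofReal_comp).mul_const _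
      have h2 := (h1.cexp.hasDerivWithinAt (s := Icc (-T) T)).mul
        (h.hasDerivWithinAt_coeff hs ht hn)
      refine h2.congr_deriv ?_
      rw [quad_interaction]
      push_cast
      ring
  bdd_near t ht A hA η hη := by
    have hM := one_le_embConst s
    -- The embedding multiplies an H^s distance by `embConst s`, so this radius yields exactly η.
    have hR : 0 < η / embConst s := div_pos hη (by linarith)
    have hev := (h.continuous_in_time t ht).eventually_lt_const (ENNReal.ofReal_pos.2 hR)
    filter_upwards [hev, self_mem_nhdsWithin] with τ hτ hmem
    have ht' := h.mem t ht
    have hτ' := h.mem τ hmem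
    have h1 := Bdd.of_hsNorm_le hs hR.le (fun n hn => by
      rw [coeff_sub hτ'.continuous ht'.continuous, hτ'.coeff_zero hn, ht'.coeff_zero hn, sub_zero])
      hτ.le
    have h2 : Bdd s A (coeff (u t)) := hA.of_norm_le fun n => (norm_interaction u t n).ge
    have h3 := h2.add h1
    rw [mul_div_cancel₀ _ (by linarith : embConst s ≠ 0)] at h3
    refine h3.of_norm_le fun n => ?_
    rw [norm_interaction, coeff_sub hτ'.continuous ht'.continuous]
    exact le_of_eq (by congr 1; ring)

end IsSolution

/-! ### Measurability and equivariance of the terms of the expansion -/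

/-- Since the upper endpoint varies with the parameter, the domain of integration is encoded as an
indicator on the product space. -/
theorem measurable_intervalIntegral {X : Type*} [MeasurableSpace X] {f : X → ℝ → ℂ} {b : X → ℝ}
    (hf : Measurable (Function.uncurry f)) (hb : Measurable b) :
    Measurable (fun x => ∫ τ in (0 : ℝ)..b x, f x τ) := by
  have key : ∀ {S : X → Set ℝ}, (∀ x, MeasurableSet (S x)) →
      MeasurableSet {p : X × ℝ | p.2 ∈ S p.1} → Measurable (fun x => ∫ τ in S x, f x τ) := by
    intro S h1 h2
    have h3 : (fun x => ∫ τ in S x, f x τ) = fun x => ∫ τ, ({p : X × ℝ | p.2 ∈ S p.1}.indicator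
        (Function.uncurry f)) (x, τ) := by
      funext x
      rw [← integral_indicator (h1 x)]
      rfl
    rw [h3]
    exact (StronglyMeasurable.integral_prod_right'
      (hf.indicator h2).stronglyMeasurable).measurable
  unfold intervalIntegral
  refine (key (S := fun x => Ioc 0 (b x)) (fun _ => measurableSet_Ioc) ?_).sub
    (key (S := fun x => Ioc (b x) 0) (fun _ => measurableSet_Ioc) ?_)
  · exact (measurableSet_lt measurable_const measurable_snd).inter
      (measurableSet_le measurable_snd (hb.comp measurable_fst))
  · exact (measurableSet_lt (hb.comp measurable_fst) measurable_snd).inter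
      (measurableSet_le measurable_snd measurable_const)

/-- A functional of the initial datum with values in the paths of families, jointly measurable in
time and in the datum. -/
def MeasurableFamily (F : (ℤ × ℤ → ℂ) → ℝ → ℤ × ℤ → ℂ) : Prop :=
  ∀ n, Measurable (fun p : ℝ × (ℤ × ℤ → ℂ) => F p.2 p.1 n)

namespace MeasurableFamily

variable {F G : (ℤ × ℤ → ℂ) → ℝ → ℤ × ℤ → ℂ}

theorem datum : MeasurableFamily (fun a _ => a) := fun n =>
  (measurable_pi_apply n).comp measurable_snd

theorem add (hF : MeasurableFamily F) (hG : MeasurableFamily G) :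
    MeasurableFamily (fun a t n => F a t n + G a t n) := fun n => (hF n).add (hG n)

theorem quad (hF : MeasurableFamily F) (hG : MeasurableFamily G) :
    MeasurableFamily (fun a t n => quad t (F a t) (G a t) n) := fun n =>
  Measurable.tsum fun k =>
    ((((continuous_ph n k).measurable.comp measurable_fst).mul (hF k)).mul (hG (n - k)))

theorem comp_swap {Q : ℝ × (ℤ × ℤ → ℂ) → ℂ} (h : Measurable Q) :
    Measurable (fun q : (ℝ × (ℤ × ℤ → ℂ)) × ℝ => Q (q.2, q.1.2)) :=
  h.comp (measurable_snd.prodMk (measurable_snd.comp measurable_fst))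

theorem duh (hF : MeasurableFamily F) (hG : MeasurableFamily G) (ε : ℝ) :
    MeasurableFamily (fun a => duh ε (F a) (G a)) := fun n => by
  have h0 : Measurable (fun q : (ℝ × (ℤ × ℤ → ℂ)) × ℝ =>
      KPII.quad q.2 (F q.1.2 q.2) (G q.1.2 q.2) n) := comp_swap (hF.quad hG n)
  have key : Measurable (fun p : ℝ × (ℤ × ℤ → ℂ) =>
      ∫ τ in (0 : ℝ)..p.1, KPII.quad τ (F p.2 τ) (G p.2 τ) n) :=
    measurable_intervalIntegral
      (f := fun (p : ℝ × (ℤ × ℤ → ℂ)) τ => KPII.quad τ (F p.2 τ) (G p.2 τ) n) h0 measurable_fst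
  exact key.const_mul (-(Complex.I * ε / 2) * n.1)

theorem order1 (ε : ℝ) : MeasurableFamily (order1 ε) := datum.duh datum ε

theorem order2 (ε : ℝ) : MeasurableFamily (order2 ε) :=
  (datum.duh (order1 ε) ε).add ((order1 ε).duh datum ε)

theorem order3 (ε : ℝ) : MeasurableFamily (order3 ε) :=
  ((datum.duh (order2 ε) ε).add ((order2 ε).duh datum ε)).add ((order1 ε).duh (order1 ε) ε)

theorem apply (hF : MeasurableFamily F) (t : ℝ) (n : ℤ × ℤ) : Measurable (fun a => F a t n) :=
  (hF n).comp (measurable_const.prodMk measurable_id)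

end MeasurableFamily

/-- `F` is multiplied by `c^j χ` when its argument is multiplied by `c χ`, for a character `χ`. -/
def Equivariant (χ : ℤ × ℤ → ℂ) (c : ℂ) (j : ℕ) (F : (ℤ × ℤ → ℂ) → ℝ → ℤ × ℤ → ℂ) : Prop :=
  ∀ a t n, F (fun k => c * χ k * a k) t n = c ^ j * χ n * F a t n

namespace Equivariant

variable {χ : ℤ × ℤ → ℂ} {c : ℂ} {i j : ℕ} {F G : (ℤ × ℤ → ℂ) → ℝ → ℤ × ℤ → ℂ}

theorem datum : Equivariant χ c 1 (fun a _ => a) := fun a t n => by rw [pow_one]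

theorem add (hF : Equivariant χ c i F) (hG : Equivariant χ c i G) :
    Equivariant χ c i (fun a t n => F a t n + G a t n) := fun a t n => by
  simp only [hF a t n, hG a t n]; ring

/-- In a convolution the characters of the inputs multiply to that of the output, and the degrees of
homogeneity add. -/
theorem duh (hχ : ∀ n k, χ k * χ (n - k) = χ n) (hF : Equivariant χ c i F)
    (hG : Equivariant χ c j G) (ε : ℝ) :
    Equivariant χ c (i + j) (fun a => duh ε (F a) (G a)) := fun a t n => by
  have hq : ∀ τ, quad τ (F (fun k => c * χ k * a k) τ) (G (fun k => c * χ k * a k) τ) n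
      = c ^ (i + j) * χ n * quad τ (F a τ) (G a τ) n := fun τ => by
    simp only [quad]
    rw [← tsum_mul_left]
    refine tsum_congr fun k => ?_
    rw [hF a τ k, hG a τ (n - k), ← hχ n k, pow_add]
    ring
  simp only [KPII.duh, hq, intervalIntegral.integral_const_mul]
  ring

theorem order1 (hχ : ∀ n k, χ k * χ (n - k) = χ n) (ε : ℝ) : Equivariant χ c 2 (order1 ε) :=
  datum.duh hχ datum ε

theorem order2 (hχ : ∀ n k, χ k * χ (n - k) = χ n) (ε : ℝ) : Equivariant χ c 3 (order2 ε) :=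
  (datum.duh hχ (order1 hχ ε) ε).add ((order1 hχ ε).duh hχ datum ε)

theorem order3 (hχ : ∀ n k, χ k * χ (n - k) = χ n) (ε : ℝ) : Equivariant χ c 4 (order3 ε) :=
  ((datum.duh hχ (order2 hχ ε) ε).add ((order2 hχ ε).duh hχ datum ε)).add
    ((order1 hχ ε).duh hχ (order1 hχ ε) ε)

end Equivariant

/-! ### The random initial datum -/

/-- The hypotheses on the random initial datum. -/
structure RandomDatum {Ω : Type*} [MeasurableSpace Ω] (μ : Measure Ω) (s : ℝ)
    (g : ℤ × ℤ → Ω → ℂ) (lam : ℤ × ℤ → ℂ) : Prop where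
  one_lt : 1 < s
  meas : ∀ n : ℤ × ℤ, 0 < n.1 → Measurable (g n)
  indep : iIndepFun (fun n : {n : ℤ × ℤ // 0 < n.1} => g n) μ
  ident : ∀ n m : ℤ × ℤ, 0 < n.1 → 0 < m.1 → IdentDistrib (g n) (g m) μ μ
  rot : ∀ n : ℤ × ℤ, 0 < n.1 → ∀ θ : ℝ,
    IdentDistrib (fun ω => Complex.exp (Complex.I * θ) * g n ω) (g n) μ μ
  conj_g : ∀ n : ℤ × ℤ, 0 < n.1 → ∀ ω, g (-n) ω = conj (g n ω)
  conj_lam : ∀ n : ℤ × ℤ, 0 < n.1 → lam (-n) = conj (lam n)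
  norm_one : essSup (fun ω => hsNorm s (fun n => lam n * g n ω)) μ = 1

/-- The random initial datum. -/
def datum {Ω : Type*} (g : ℤ × ℤ → Ω → ℂ) (lam : ℤ × ℤ → ℂ) (ω : Ω) (n : ℤ × ℤ) : ℂ :=
  if n.1 = 0 then 0 else lam n * g n ω

/-- The second moment of the `g_n`. -/
def mom2 {Ω : Type*} [MeasurableSpace Ω] (μ : Measure Ω) (g : ℤ × ℤ → Ω → ℂ) : ℝ :=
  ∫ ω, ‖g (1, 0) ω‖ ^ 2 ∂μ

/-- The fourth moment of the `g_n`. -/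
def mom4 {Ω : Type*} [MeasurableSpace Ω] (μ : Measure Ω) (g : ℤ × ℤ → Ω → ℂ) : ℝ :=
  ∫ ω, ‖g (1, 0) ω‖ ^ 4 ∂μ

theorem neg_fst_pos {n : ℤ × ℤ} (hn : n.1 ≠ 0) (h : ¬ 0 < n.1) : 0 < (-n).1 := by
  simp only [Prod.fst_neg]; omega

namespace RandomDatum

variable {Ω : Type*} [MeasurableSpace Ω] {μ : Measure Ω} {s : ℝ} {g : ℤ × ℤ → Ω → ℂ}
  {lam : ℤ × ℤ → ℂ}

theorem norm_g_neg (h : RandomDatum μ s g lam) {n : ℤ × ℤ} (hn : n.1 ≠ 0) (ω : Ω) :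
    ‖g (-n) ω‖ = ‖g n ω‖ := by
  by_cases hp : 0 < n.1
  · rw [h.conj_g n hp, RCLike.norm_conj]
  · have := h.conj_g (-n) (neg_fst_pos hn hp) ω
    rw [neg_neg] at this
    rw [this, RCLike.norm_conj]

theorem norm_lam_neg (h : RandomDatum μ s g lam) {n : ℤ × ℤ} (hn : n.1 ≠ 0) :
    ‖lam (-n)‖ = ‖lam n‖ := by
  by_cases hp : 0 < n.1
  · rw [h.conj_lam n hp, RCLike.norm_conj]
  · have := h.conj_lam (-n) (neg_fst_pos hn hp)
    rw [neg_neg] at this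
    rw [this, RCLike.norm_conj]

theorem measurable_g (h : RandomDatum μ s g lam) {n : ℤ × ℤ} (hn : n.1 ≠ 0) :
    Measurable (g n) := by
  by_cases hp : 0 < n.1
  · exact h.meas n hp
  · have h1 := h.meas (-n) (neg_fst_pos hn hp)
    have : g n = fun ω => conj (g (-n) ω) := by
      funext ω
      rw [← h.conj_g (-n) (neg_fst_pos hn hp), neg_neg]
    rw [this]
    exact Complex.continuous_conj.measurable.comp h1

theorem datum_neg (h : RandomDatum μ s g lam) (n : ℤ × ℤ) (ω : Ω) :
    datum g lam ω (-n) = conj (datum g lam ω n) := by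
  unfold datum
  by_cases hn : n.1 = 0
  · simp [hn]
  · have hn' : (-n).1 ≠ 0 := by simpa using hn
    rw [if_neg hn, if_neg hn']
    by_cases hp : 0 < n.1
    · rw [h.conj_lam n hp, h.conj_g n hp, map_mul]
    · have h1 := h.conj_lam (-n) (neg_fst_pos hn hp)
      have h2 := h.conj_g (-n) (neg_fst_pos hn hp) ω
      rw [neg_neg] at h1 h2
      rw [h1, h2, map_mul, Complex.conj_conj, Complex.conj_conj]

theorem measurable_datum (h : RandomDatum μ s g lam) : Measurable (datum g lam) := by
  refine measurable_pi_lambda _ fun n => ?_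
  unfold datum
  by_cases hn : n.1 = 0
  · simp only [hn, if_true]; exact measurable_const
  · simp only [hn, if_false]
    exact (h.measurable_g hn).const_mul _

/-- The law of the initial datum is invariant under independent rotations. -/
theorem identDistrib_datum (h : RandomDatum μ s g lam) {σ : ℤ × ℤ → ℂ} (h1 : ∀ n, ‖σ n‖ = 1)
    (h2 : ∀ n, σ (-n) = conj (σ n)) :
    IdentDistrib (fun ω n => σ n * datum g lam ω n) (datum g lam) μ μ := by
  have hid : IdentDistrib (fun ω (i : {n : ℤ × ℤ // 0 < n.1}) => σ i * g i ω)
      (fun ω (i : {n : ℤ × ℤ // 0 < n.1}) => g i ω) μ μ := by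
    refine IdentDistrib.pi (X := fun (i : {n : ℤ × ℤ // 0 < n.1}) ω => σ i * g i ω)
      (Y := fun (i : {n : ℤ × ℤ // 0 < n.1}) ω => g i ω) (fun i => ?_) ?_ h.indep
    · have h3 := h.rot i i.2 (Complex.arg (σ i))
      have h4 : Complex.exp (Complex.I * (Complex.arg (σ i))) = σ i := by
        have := Complex.norm_mul_exp_arg_mul_I (σ i)
        rwa [h1, Complex.ofReal_one, one_mul, mul_comm] at this
      rwa [h4] at h3
    · exact h.indep.comp (fun i z => σ i * z) fun i => measurable_const_mul _
  -- The whole datum is one measurable function of the independent family with n₁ > 0, the other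
  -- half being its conjugate, so equality in law passes from that family to the datum.
  let Λ : ({n : ℤ × ℤ // 0 < n.1} → ℂ) → ℤ × ℤ → ℂ := fun x n =>
    if hn : 0 < n.1 then lam n * x ⟨n, hn⟩
    else if hn' : 0 < (-n).1 then conj (lam (-n) * x ⟨-n, hn'⟩) else 0
  have hΛ : Measurable Λ := by
    refine measurable_pi_lambda _ fun n => ?_
    simp only [Λ]
    split_ifs with hn hn'
    · exact (measurable_pi_apply _).const_mul _
    · exact Complex.continuous_conj.measurable.comp ((measurable_pi_apply _).const_mul _)
    · exact measurable_const
  have h5 : ∀ ω, Λ (fun i => g i ω) = datum g lam ω := fun ω => by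
    funext n
    simp only [Λ, datum]
    split_ifs with hn hn0 hn' hn0 hn0
    · omega
    · rfl
    · simp only [Prod.fst_neg] at hn'; omega
    · have e1 := h.conj_g (-n) hn' ω
      have e2 := h.conj_lam (-n) hn'
      rw [neg_neg] at e1 e2
      rw [e1, e2, map_mul]
    · rfl
    · exact absurd (neg_fst_pos hn0 hn) hn'
  have h6 : ∀ ω, Λ (fun i => σ i * g i ω) = fun n => σ n * datum g lam ω n := fun ω => by
    funext n
    rw [← h5]
    simp only [Λ]
    split_ifs with hn hn'
    · ring
    · have e1 : σ n = conj (σ (-n)) := by rw [h2 n, Complex.conj_conj]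
      rw [e1]
      simp only [map_mul]
      ring
    · ring
  have := hid.comp hΛ
  simp only [Function.comp_def, h5, h6] at this
  exact this

theorem integral_rotate (h : RandomDatum μ s g lam) {σ : ℤ × ℤ → ℂ} (h1 : ∀ n, ‖σ n‖ = 1)
    (h2 : ∀ n, σ (-n) = conj (σ n)) {Ψ : (ℤ × ℤ → ℂ) → ℂ} (hΨ : Measurable Ψ) :
    ∫ ω, Ψ (fun n => σ n * datum g lam ω n) ∂μ = ∫ ω, Ψ (datum g lam ω) ∂μ :=
  ((h.identDistrib_datum h1 h2).comp hΨ).integral_eq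

/-- The invariance of the law forces the expectation to equal z times itself. No integrability is
required. -/
theorem integral_eq_zero_of_rotate (h : RandomDatum μ s g lam) {σ : ℤ × ℤ → ℂ}
    (h1 : ∀ n, ‖σ n‖ = 1) (h2 : ∀ n, σ (-n) = conj (σ n)) {Ψ : (ℤ × ℤ → ℂ) → ℂ}
    (hΨ : Measurable Ψ) {z : ℂ} (hz : z ≠ 1)
    (hσ : ∀ a, Ψ (fun n => σ n * a n) = z * Ψ a) : ∫ ω, Ψ (datum g lam ω) ∂μ = 0 := by
  have h3 := h.integral_rotate h1 h2 hΨ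
  simp_rw [hσ] at h3
  rw [integral_const_mul] at h3
  have h4 : (z - 1) * ∫ ω, Ψ (datum g lam ω) ∂μ = 0 := by rw [sub_mul, h3]; ring
  exact (mul_eq_zero.1 h4).resolve_left (sub_ne_zero.2 hz)

/-- Correlations of equivariant functionals vanish off the diagonal and for an odd total degree. -/
theorem integral_mul_conj_eq_zero (h : RandomDatum μ s g lam)
    {F G : (ℤ × ℤ → ℂ) → ℝ → ℤ × ℤ → ℂ} {i j : ℕ}
    (hFm : MeasurableFamily F) (hGm : MeasurableFamily G)
    (hF : ∀ χ c, (∀ n k, χ k * χ (n - k) = χ n) → Equivariant χ c i F)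
    (hG : ∀ χ c, (∀ n k, χ k * χ (n - k) = χ n) → Equivariant χ c j G)
    (t : ℝ) {n m : ℤ × ℤ} (hnm : n ≠ m ∨ Odd (i + j)) :
    ∫ ω, F (datum g lam ω) t n * conj (G (datum g lam ω) t m) ∂μ = 0 := by
  have hΨ : Measurable (fun a => F a t n * conj (G a t m)) :=
    (hFm.apply t n).mul (Complex.continuous_conj.measurable.comp (hGm.apply t m))
  by_cases hodd : Odd (i + j)
  -- The datum is replaced by its opposite, which multiplies the product by (-1)^(i+j) = -1.
  · refine h.integral_eq_zero_of_rotate (σ := fun _ => -1 * 1) (z := -1) (by simp) (by simp) hΨ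
      (by norm_num) fun a => ?_
    have h1 : F (fun n => -1 * 1 * a n) t n = _ := hF (fun _ => 1) (-1) (by simp) a t n
    have h2 : G (fun n => -1 * 1 * a n) t m = _ := hG (fun _ => 1) (-1) (by simp) a t m
    rw [h1, h2]
    simp only [map_mul, map_pow, map_neg, map_one]
    have hp : (-1 : ℂ) ^ i * (-1) ^ j = -1 := by rw [← pow_add, hodd.neg_one_pow]
    linear_combination (F a t n * conj (G a t m)) * hp
  · have hne : n ≠ m := hnm.resolve_right hodd
    have hz : (z : ℝ × ℝ) → ∀ n, chr (-n) z = conj (chr n z) := fun z n => by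
      simp only [chr, ← Complex.exp_conj]
      congr 1
      simp
      ring
    -- For n ≠ m the datum is translated by z, which multiplies the correlation by e^{i(n-m)z}. Half
    -- a period in a component where n and m differ gives the factor -1.
    obtain ⟨z, hz1⟩ : ∃ z, chr (n - m) z ≠ 1 := by
      by_contra! hcon
      have hd : n - m ≠ 0 := sub_ne_zero.2 hne
      by_cases h0 : (n - m).1 = 0
      · have h0' : (n - m).2 ≠ 0 := fun h' => hd (Prod.ext h0 h')
        have := hcon (0, Real.pi / (n - m).2)
        have hc : ((n - m).2 : ℂ) ≠ 0 := by exact_mod_cast h0'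
        rw [chr, h0] at this
        push_cast at this
        rw [mul_div_cancel₀ _ hc, zero_mul, zero_add, mul_comm, Complex.exp_pi_mul_I] at this
        norm_num at this
      · have := hcon (Real.pi / (n - m).1, 0)
        have hc : ((n - m).1 : ℂ) ≠ 0 := by exact_mod_cast h0
        rw [chr] at this
        push_cast at this
        rw [mul_div_cancel₀ _ hc, mul_zero, add_zero, mul_comm, Complex.exp_pi_mul_I] at this
        norm_num at this
    have hχ : ∀ n k, chr k z * chr (n - k) z = chr n z := fun n k => by
      rw [← chr_add, add_sub_cancel]
    refine h.integral_eq_zero_of_rotate (σ := fun n => 1 * chr n z) (z := chr (n - m) z)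
      (fun n => by rw [one_mul, norm_chr]) (fun n => by rw [one_mul, one_mul, hz]) hΨ hz1
      fun a => ?_
    have h1 : F (fun n => 1 * chr n z * a n) t n = _ := hF (fun n => chr n z) 1 hχ a t n
    have h2 : G (fun n => 1 * chr n z * a n) t m = _ := hG (fun n => chr n z) 1 hχ a t m
    rw [h1, h2]
    simp only [map_mul, one_pow, one_mul]
    rw [sub_eq_add_neg, chr_add, hz]
    ring

end RandomDatum

/-! ### Moments of the random initial datum -/

theorem norm_datum {Ω : Type*} {g : ℤ × ℤ → Ω → ℂ} {lam : ℤ × ℤ → ℂ} {n : ℤ × ℤ} (hn : n.1 ≠ 0)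
    (ω : Ω) : ‖datum g lam ω n‖ = ‖lam n‖ * ‖g n ω‖ := by rw [datum, if_neg hn, norm_mul]

theorem hsNorm_datum {Ω : Type*} {g : ℤ × ℤ → Ω → ℂ} {lam : ℤ × ℤ → ℂ} (s : ℝ) (ω : Ω) :
    hsNorm s (datum g lam ω) = hsNorm s (fun n => lam n * g n ω) := by
  unfold hsNorm
  congr 1
  exact tsum_congr fun n => by rw [datum, if_neg n.2]

namespace RandomDatum

variable {Ω : Type*} [MeasurableSpace Ω] {μ : Measure Ω} {s : ℝ} {g : ℤ × ℤ → Ω → ℂ}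
  {lam : ℤ × ℤ → ℂ}

theorem ae_hsNorm_le (h : RandomDatum μ s g lam) :
    ∀ᵐ ω ∂μ, hsNorm s (datum g lam ω) ≤ ENNReal.ofReal 1 := by
  filter_upwards [ENNReal.ae_le_essSup (μ := μ) fun ω => hsNorm s (fun n => lam n * g n ω)] with ω hω
  rw [hsNorm_datum, ENNReal.ofReal_one, ← h.norm_one]
  exact hω

theorem ae_bdd (h : RandomDatum μ s g lam) : ∀ᵐ ω ∂μ, Bdd s (embConst s) (datum g lam ω) := by
  filter_upwards [h.ae_hsNorm_le] with ω hω
  have := Bdd.of_hsNorm_le h.one_lt zero_le_one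
    (fun n hn => by rw [datum, if_pos hn]) hω
  rwa [mul_one] at this

/-- Otherwise the datum vanishes almost surely, against the norm being 1. Such a frequency makes the
g_n bounded and their second moment positive. -/
theorem exists_pos_not_ae_zero (h : RandomDatum μ s g lam) :
    ∃ n : ℤ × ℤ, 0 < n.1 ∧ lam n ≠ 0 ∧ ¬ g n =ᵐ[μ] 0 := by
  by_contra! hcon
  have hall : ∀ n : Freq, ∀ᵐ ω ∂μ, lam n * g n ω = 0 := by
    intro n
    obtain ⟨p, hp, hpn⟩ : ∃ p : ℤ × ℤ, 0 < p.1 ∧ ∀ ω, ‖lam n * g n ω‖ = ‖lam p * g p ω‖ := by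
      by_cases hp : 0 < n.1.1
      · exact ⟨n, hp, fun ω => rfl⟩
      · exact ⟨-n, neg_fst_pos n.2 hp, fun ω => by
          rw [norm_mul, norm_mul, h.norm_g_neg n.2, h.norm_lam_neg n.2]⟩
    by_cases hl : lam p = 0
    · exact ae_of_all _ fun ω => by rw [← norm_eq_zero, hpn, hl, zero_mul, norm_zero]
    · filter_upwards [hcon p hp hl] with ω hω
      rw [← norm_eq_zero, hpn, hω]; simp
  have hz : (fun ω => hsNorm s (fun n => lam n * g n ω)) =ᵐ[μ] 0 := by
    filter_upwards [ae_all_iff.2 hall] with ω hω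
    simp [hsNorm, hω]
  have := h.norm_one
  rw [essSup_congr_ae hz] at this
  have h0 : essSup (0 : Ω → ℝ≥0∞) μ ≤ 0 := essSup_le_of_ae_le _ (ae_of_all _ fun _ => le_rfl)
  rw [this] at h0
  simp at h0

/-- At one frequency p with λ_p ≠ 0 the bound on the datum bounds g_p; equality of laws carries it
to all g_n. All moments are therefore finite. -/
theorem exists_bound_g (h : RandomDatum μ s g lam) :
    ∃ B : ℝ, ∀ n : ℤ × ℤ, n.1 ≠ 0 → ∀ᵐ ω ∂μ, ‖g n ω‖ ≤ B := by
  obtain ⟨p, hp, hl, -⟩ := h.exists_pos_not_ae_zero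
  have hpb : ∀ᵐ ω ∂μ, ‖g p ω‖ ≤ embConst s / ‖lam p‖ := by
    filter_upwards [h.ae_bdd] with ω hω
    rw [le_div_iff₀ (norm_pos_iff.2 hl), mul_comm, ← norm_mul]
    have := hω.norm_le p
    rwa [datum, if_neg hp.ne'] at this
  have hpos : ∀ n : ℤ × ℤ, 0 < n.1 → ∀ᵐ ω ∂μ, ‖g n ω‖ ≤ embConst s / ‖lam p‖ := fun n hn =>
    (h.ident p n hp hn).ae_snd (p := fun z => ‖z‖ ≤ embConst s / ‖lam p‖)
      (measurableSet_le measurable_norm measurable_const) hpb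
  refine ⟨embConst s / ‖lam p‖, fun n hn => ?_⟩
  by_cases hp : 0 < n.1
  · exact hpos n hp
  · filter_upwards [hpos (-n) (neg_fst_pos hn hp)] with ω hω
    rwa [h.norm_g_neg hn] at hω

theorem integral_norm_g_pow (h : RandomDatum μ s g lam) {n : ℤ × ℤ} (hn : n.1 ≠ 0) (j : ℕ) :
    ∫ ω, ‖g n ω‖ ^ j ∂μ = ∫ ω, ‖g (1, 0) ω‖ ^ j ∂μ := by
  have hpos : ∀ n : ℤ × ℤ, 0 < n.1 → ∫ ω, ‖g n ω‖ ^ j ∂μ = ∫ ω, ‖g (1, 0) ω‖ ^ j ∂μ :=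
    fun n hn => ((h.ident n (1, 0) hn one_pos).comp
      (u := fun z : ℂ => ‖z‖ ^ j) (measurable_norm.pow_const j)).integral_eq
  by_cases hp : 0 < n.1
  · exact hpos n hp
  · rw [← hpos (-n) (neg_fst_pos hn hp)]
    simp_rw [h.norm_g_neg hn]

theorem integrable_norm_g_pow [IsProbabilityMeasure μ] (h : RandomDatum μ s g lam) {n : ℤ × ℤ}
    (hn : n.1 ≠ 0) (j : ℕ) : Integrable (fun ω => ‖g n ω‖ ^ j) μ := by
  obtain ⟨B, hB⟩ := h.exists_bound_g
  refine Integrable.of_bound ((h.measurable_g hn).norm.pow_const j).aestronglyMeasurable (B ^ j) ?_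
  filter_upwards [hB n hn] with ω hω
  rw [Real.norm_of_nonneg (by positivity)]
  gcongr

theorem mom2_pos [IsProbabilityMeasure μ] (h : RandomDatum μ s g lam) : 0 < mom2 μ g := by
  obtain ⟨p, hp, -, hg⟩ := h.exists_pos_not_ae_zero
  rw [mom2, ← h.integral_norm_g_pow hp.ne' 2]
  refine lt_of_le_of_ne (integral_nonneg fun ω => by positivity) fun h0 => hg ?_
  have := (integral_eq_zero_iff_of_nonneg (fun ω => by positivity)
    (h.integrable_norm_g_pow hp.ne' 2)).1 h0.symm
  filter_upwards [this] with ω hω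
  simpa using hω

/-- Taking the expectation of the squared H^s norm, which is at most 1 almost surely, replaces each
|g_n|² by `mom2`. -/
theorem sum_sq_lam_le [IsProbabilityMeasure μ] (h : RandomDatum μ s g lam) (S : Finset Freq) :
    ∑ n ∈ S, (size n ^ s * ‖lam n‖) ^ 2 ≤ 1 / mom2 μ g := by
  rw [le_div_iff₀ h.mom2_pos, Finset.sum_mul]
  have hint : ∀ n ∈ S, Integrable (fun ω => (size n ^ s * ‖datum g lam ω n‖) ^ 2) μ := by
    intro n _
    have := (h.integrable_norm_g_pow n.2 2).const_mul ((size n ^ s * ‖lam n‖) ^ 2)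
    refine this.congr (ae_of_all _ fun ω => ?_)
    simp only [norm_datum n.2]; ring
  calc ∑ n ∈ S, (size n ^ s * ‖lam n‖) ^ 2 * mom2 μ g
      = ∑ n ∈ S, ∫ ω, (size n ^ s * ‖datum g lam ω n‖) ^ 2 ∂μ := by
        refine Finset.sum_congr rfl fun n _ => ?_
        rw [mom2, ← h.integral_norm_g_pow n.2 2, ← integral_const_mul]
        refine integral_congr_ae (ae_of_all _ fun ω => ?_)
        simp only [norm_datum n.2]; ring
    _ = ∫ ω, ∑ n ∈ S, (size n ^ s * ‖datum g lam ω n‖) ^ 2 ∂μ := (integral_finsetSum _ hint).symm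
    _ ≤ ∫ _, (1 : ℝ) ∂μ := by
        refine integral_mono_ae (integrable_finsetSum _ hint) (integrable_const _) ?_
        filter_upwards [h.ae_hsNorm_le] with ω hω
        simpa using sum_sq_le_of_hsNorm_le zero_le_one hω S
    _ = 1 := by simp

theorem measurable_datum_apply (h : RandomDatum μ s g lam) (n : ℤ × ℤ) :
    Measurable (fun ω => datum g lam ω n) := (measurable_pi_apply n).comp h.measurable_datum

/-- The four point correlations vanish unless the frequencies are paired. -/
theorem integral_four_eq_zero (h : RandomDatum μ s g lam) {k l p q : ℤ × ℤ} (hk : k.1 ≠ 0)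
    (hkl : (k + l).1 ≠ 0) (hp : k ≠ p) (hq : k ≠ q) :
    ∫ ω, datum g lam ω k * datum g lam ω l * conj (datum g lam ω p * datum g lam ω q) ∂μ = 0 := by
  -- A number of modulus 1 with z, z², z³, z⁴ all different from 1. Only the coefficients at k and
  -- -k are rotated. The factor at k contributes z and each of the other three contributes z or 1,
  -- so the total is z^j with 1 ≤ j ≤ 4.
  let z : ℂ := ⟨3 / 5, 4 / 5⟩
  have hz1 : conj z * z = 1 := by
    simp only [z, Complex.ext_iff, Complex.mul_re, Complex.mul_im, Complex.conj_re, Complex.conj_im,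
      Complex.one_re, Complex.one_im]
    norm_num
  have hzn : ‖z‖ = 1 := by
    have : ‖z‖ * ‖z‖ = 1 := by
      rw [← RCLike.norm_conj z, RCLike.norm_conj z, ← NormOneClass.norm_one (α := ℂ), ← hz1, norm_mul,
        RCLike.norm_conj]
    nlinarith [norm_nonneg z]
  have hkk : -k ≠ k := fun hc => hk (by
    have := congrArg Prod.fst hc
    simp only [Prod.fst_neg] at this
    omega)
  have hlk : l ≠ -k := fun hc => hkl (by rw [hc]; simp)
  let σ : ℤ × ℤ → ℂ := fun n => if n = k then z else if n = -k then conj z else 1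
  have hσn : ∀ n, ‖σ n‖ = 1 := fun n => by
    simp only [σ]
    split_ifs
    · exact hzn
    · rw [RCLike.norm_conj, hzn]
    · exact NormOneClass.norm_one
  have hσc : ∀ n, σ (-n) = conj (σ n) := fun n => by
    simp only [σ]
    by_cases h1 : n = k
    · subst h1
      rw [if_neg hkk, if_pos rfl, if_pos rfl]
    · by_cases h2 : n = -k
      · subst h2
        rw [neg_neg, if_pos rfl, if_neg hkk, if_pos rfl, Complex.conj_conj]
      · rw [if_neg (fun hc => h2 (by rw [← hc, neg_neg])), if_neg (fun hc => h1 (neg_inj.1 hc)),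
          if_neg h1, if_neg h2, map_one]
  have hσk : σ k = z := by simp [σ]
  have hσl : σ l = z ∨ σ l = 1 := by
    by_cases h1 : l = k
    · left; simp [σ, h1]
    · right; simp [σ, h1, hlk]
  have hσp : ∀ m, k ≠ m → conj (σ m) = z ∨ conj (σ m) = 1 := fun m hm => by
    by_cases h1 : m = -k
    · left
      simp only [σ]
      rw [if_neg (Ne.symm hm), if_pos h1, Complex.conj_conj]
    · right
      simp only [σ]
      rw [if_neg (Ne.symm hm), if_neg h1, map_one]
  have hm : ∀ m, Measurable (fun a : ℤ × ℤ → ℂ => a m) := measurable_pi_apply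
  refine h.integral_eq_zero_of_rotate (σ := σ)
    (Ψ := fun a => a k * a l * conj (a p * a q)) hσn hσc ?_
    (z := σ k * σ l * (conj (σ p) * conj (σ q))) ?_ fun a => ?_
  · exact ((hm k).mul (hm l)).mul (Complex.continuous_conj.measurable.comp ((hm p).mul (hm q)))
  · rw [hσk]
    rcases hσl with e1 | e1 <;> rcases hσp p hp with e2 | e2 <;> rcases hσp q hq with e3 | e3 <;>
      rw [e1, e2, e3] <;>
      simp only [z, ne_eq, Complex.ext_iff, Complex.mul_re, Complex.mul_im, Complex.one_re,
        Complex.one_im] <;> norm_num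
  · simp only [map_mul]; ring

theorem integral_norm_datum_sq (h : RandomDatum μ s g lam) {n : ℤ × ℤ} (hn : n.1 ≠ 0) :
    ∫ ω, ‖datum g lam ω n‖ ^ 2 ∂μ = mom2 μ g * ‖lam n‖ ^ 2 := by
  simp_rw [norm_datum hn, mul_pow]
  rw [integral_const_mul, h.integral_norm_g_pow hn 2, mom2, mul_comm]

theorem integral_norm_datum_pow_four (h : RandomDatum μ s g lam) {n : ℤ × ℤ} (hn : n.1 ≠ 0) :
    ∫ ω, ‖datum g lam ω n‖ ^ 4 ∂μ = mom4 μ g * ‖lam n‖ ^ 4 := by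
  simp_rw [norm_datum hn, mul_pow]
  rw [integral_const_mul, h.integral_norm_g_pow hn 4, mom4, mul_comm]

/-- Each frequency is represented by whichever of n and -n has a positive first component. The
representatives of k and l differ because k ≠ ±l, so independence applies. -/
theorem integral_norm_datum_sq_mul (h : RandomDatum μ s g lam) {k l : ℤ × ℤ} (hk : k.1 ≠ 0)
    (hl : l.1 ≠ 0) (h1 : k ≠ l) (h2 : k ≠ -l) :
    ∫ ω, ‖datum g lam ω k‖ ^ 2 * ‖datum g lam ω l‖ ^ 2 ∂μ
      = mom2 μ g ^ 2 * (‖lam k‖ ^ 2 * ‖lam l‖ ^ 2) := by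
  have hpos : ∀ n : ℤ × ℤ, n.1 ≠ 0 → ∃ p : {n : ℤ × ℤ // 0 < n.1}, (p.1 = n ∨ p.1 = -n) ∧
      ∀ ω, ‖g n ω‖ = ‖g p ω‖ := fun n hn => by
    by_cases hp : 0 < n.1
    · exact ⟨⟨n, hp⟩, Or.inl rfl, fun ω => rfl⟩
    · exact ⟨⟨-n, neg_fst_pos hn hp⟩, Or.inr rfl, fun ω => (h.norm_g_neg hn ω).symm⟩
  obtain ⟨p, hp, hpg⟩ := hpos k hk
  obtain ⟨q, hq, hqg⟩ := hpos l hl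
  have hpq : p ≠ q := by
    rintro rfl
    rcases hp with e1 | e1 <;> rcases hq with e2 | e2 <;> rw [e1] at e2
    · exact h1 e2
    · exact h2 e2
    · exact h2 (by rw [← e2, neg_neg])
    · exact h1 (neg_inj.1 e2)
  have hi := (h.indep.indepFun hpq).comp (φ := fun z : ℂ => ‖z‖ ^ 2) (ψ := fun z : ℂ => ‖z‖ ^ 2)
    (measurable_norm.pow_const 2) (measurable_norm.pow_const 2)
  have hi2 := hi.integral_fun_mul_eq_mul_integral
    (((h.meas p p.2).norm.pow_const 2).aestronglyMeasurable)
    (((h.meas q q.2).norm.pow_const 2).aestronglyMeasurable)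
  simp only [Function.comp_def] at hi2
  rw [h.integral_norm_g_pow p.2.ne' 2, h.integral_norm_g_pow q.2.ne' 2] at hi2
  simp_rw [norm_datum hk, norm_datum hl, hpg, hqg]
  have : ∀ ω, (‖lam k‖ * ‖g p ω‖) ^ 2 * (‖lam l‖ * ‖g q ω‖) ^ 2
      = (‖lam k‖ ^ 2 * ‖lam l‖ ^ 2) * (‖g p ω‖ ^ 2 * ‖g q ω‖ ^ 2) := fun ω => by ring
  simp_rw [this]
  rw [integral_const_mul, hi2, mom2]
  ring

/-- The paired four point correlations. -/
theorem integral_four_paired (h : RandomDatum μ s g lam) {k l : ℤ × ℤ} (hk : k.1 ≠ 0)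
    (hl : l.1 ≠ 0) (hkl : (k + l).1 ≠ 0) :
    ∫ ω, datum g lam ω k * datum g lam ω l * conj (datum g lam ω k * datum g lam ω l) ∂μ
      = ((if k = l then mom4 μ g * ‖lam k‖ ^ 4
          else mom2 μ g ^ 2 * (‖lam k‖ ^ 2 * ‖lam l‖ ^ 2) : ℝ) : ℂ) := by
  have hne : k ≠ -l := fun hc => hkl (by rw [hc]; simp)
  have : ∀ ω, datum g lam ω k * datum g lam ω l * conj (datum g lam ω k * datum g lam ω l)
      = ((‖datum g lam ω k‖ ^ 2 * ‖datum g lam ω l‖ ^ 2 : ℝ) : ℂ) := fun ω => by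
    rw [Complex.mul_conj', norm_mul]; push_cast; ring
  simp_rw [this]
  rw [integral_complex_ofReal]
  congr 1
  split_ifs with he
  · subst he
    rw [← h.integral_norm_datum_pow_four hk]
    congr 1; funext ω; ring
  · exact h.integral_norm_datum_sq_mul hk hl he hne

end RandomDatum

/-! ### The second order correlations -/

/-- The primitive of the phase that vanishes at time zero. -/
def phInt (n k : ℤ × ℤ) (t : ℝ) : ℂ := ∫ τ in (0 : ℝ)..t, ph n k τ

theorem norm_phInt_le (n k : ℤ × ℤ) (t : ℝ) : ‖phInt n k t‖ ≤ |t| := by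
  have := intervalIntegral.norm_integral_le_of_norm_le_const (a := (0 : ℝ)) (b := t) (C := 1)
    (f := ph n k) fun τ _ => (norm_ph n k τ).le
  rw [one_mul, sub_zero] at this
  exact this

theorem Delta_sub_left (n k : ℤ × ℤ) : Delta n (n - k) (n - (n - k)) = Delta n k (n - k) := by
  rw [sub_sub_cancel, Delta, Delta, add_comm (disp (n - k))]

theorem ph_sub_left (n k : ℤ × ℤ) (t : ℝ) : ph n (n - k) t = ph n k t := by
  rw [ph, ph, Delta_sub_left]

theorem phInt_sub_left (n k : ℤ × ℤ) (t : ℝ) : phInt n (n - k) t = phInt n k t := by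
  simp only [phInt, ph_sub_left]

/-- The dispersion relation is odd, so the interactions n = k + (n-k) and k = n + (k-n) have
opposite Δ. -/
theorem ph_swap (n k : ℤ × ℤ) (t : ℝ) : ph k n t = conj (ph n k t) := by
  have : Delta k n (k - n) = -Delta n k (n - k) := by
    rw [← neg_sub n k, Delta, Delta, disp_neg]; ring
  rw [ph, ph, this, ← Complex.exp_conj]
  congr 1
  simp

theorem phInt_eq {n k : ℤ × ℤ} (hD : Delta n k (n - k) ≠ 0) (t : ℝ) :
    phInt n k t = (ph n k t - 1) / (Complex.I * Delta n k (n - k)) := by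
  have hD' : Complex.I * (Delta n k (n - k) : ℂ) ≠ 0 :=
    mul_ne_zero Complex.I_ne_zero (by exact_mod_cast hD)
  have h1 : ∀ τ ∈ uIcc 0 t, HasDerivAt
      (fun τ => ph n k τ / (Complex.I * Delta n k (n - k))) (ph n k τ) τ := fun τ _ => by
    refine ((hasDerivAt_ph n k τ).div_const _).congr_deriv ?_
    rw [mul_div_assoc, mul_div_cancel₀ _ hD']
  rw [phInt, intervalIntegral.integral_eq_sub_of_hasDerivAt h1
    ((continuous_ph n k).intervalIntegrable _ _), ← sub_div]
  congr 2
  simp [ph]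

/-- Through this identity the nested time integral in the second order term collapses to the
integral of a single `phInt`. -/
theorem phInt_swap {n k : ℤ × ℤ} (hD : Delta n k (n - k) ≠ 0) (t : ℝ) :
    ph n k t * phInt k n t = phInt n k t := by
  have h1 : phInt k n t = conj (phInt n k t) := by
    simp only [phInt, ph_swap n k]
    simp only [intervalIntegral, map_sub, integral_conj]
  have hp : ph n k t * conj (ph n k t) = 1 := by rw [Complex.mul_conj', norm_ph]; simp
  have hI : Complex.I * (Delta n k (n - k) : ℂ) ≠ 0 :=
    mul_ne_zero Complex.I_ne_zero (by exact_mod_cast hD)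
  rw [h1, phInt_eq hD, map_div₀, map_sub, map_one, map_mul, Complex.conj_I, Complex.conj_ofReal,
    neg_mul, div_neg, mul_neg, ← mul_div_assoc, mul_sub, hp]
  ring

theorem ph_re (n k : ℤ × ℤ) (t : ℝ) : (ph n k t).re = Real.cos (Delta n k (n - k) * t) := by
  rw [ph, Complex.exp_ofReal_mul_I_re]

theorem ph_im (n k : ℤ × ℤ) (t : ℝ) : (ph n k t).im = Real.sin (Delta n k (n - k) * t) := by
  rw [ph, Complex.exp_ofReal_mul_I_im]

theorem norm_phInt_sq {n k : ℤ × ℤ} (hD : Delta n k (n - k) ≠ 0) (t : ℝ) :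
    ‖phInt n k t‖ ^ 2 = -2 * osc n k (n - k) t := by
  rw [phInt_eq hD, norm_div, norm_mul, Complex.norm_I, one_mul, Complex.norm_real, div_pow,
    Real.norm_eq_abs, sq_abs, ← Complex.normSq_eq_norm_sq, Complex.normSq_apply, Complex.sub_re,
    Complex.sub_im, ph_re, ph_im, Complex.one_re, Complex.one_im, osc]
  have := Real.sin_sq_add_cos_sq (Delta n k (n - k) * t)
  field_simp
  linarith

/-- The linear term in t is purely imaginary and drops out. The rest is half of |`phInt`|², so both
second order contributions carry the same `osc`. -/
theorem re_integral_phInt {n k : ℤ × ℤ} (hD : Delta n k (n - k) ≠ 0) (t : ℝ) :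
    (∫ τ in (0 : ℝ)..t, phInt n k τ).re = -osc n k (n - k) t := by
  have hD' : (Delta n k (n - k) : ℂ) ≠ 0 := by exact_mod_cast hD
  have h0 : ∫ τ in (0 : ℝ)..t, phInt n k τ = (phInt n k t - t) / (Complex.I * Delta n k (n - k)) := by
    simp_rw [phInt_eq hD]
    rw [intervalIntegral.integral_div, intervalIntegral.integral_sub
      ((continuous_ph n k).intervalIntegrable _ _) intervalIntegrable_const]
    congr 1
    have := phInt_eq hD t
    rw [phInt] at this
    rw [this]
    simp
  have h1 : (phInt n k t - t) / (Complex.I * Delta n k (n - k))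
      = ((-(1 / Delta n k (n - k) ^ 2) : ℝ) : ℂ) * (ph n k t - 1)
        + ((t / Delta n k (n - k) : ℝ) : ℂ) * Complex.I := by
    rw [phInt_eq hD]
    push_cast
    field_simp
    linear_combination (-Complex.I * Delta n k (n - k) * t + (ph n k t - 1)) * Complex.I_sq
  rw [h0, h1, Complex.add_re, Complex.re_ofReal_mul, Complex.re_ofReal_mul, Complex.sub_re, ph_re,
    Complex.one_re, Complex.I_re, osc]
  ring

/-! #### Expansions in the initial datum -/

theorem hasSum_intervalIntegral_of_norm_le {F : ℤ × ℤ → ℝ → ℂ} {b : ℤ × ℤ → ℝ} {L : ℝ}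
    (hF : ∀ k, ContinuousOn (F k) (Icc (-L) L)) (hb : Summable b)
    (hle : ∀ k, ∀ τ ∈ Icc (-L) L, ‖F k τ‖ ≤ b k) {t : ℝ} (ht : t ∈ Icc (-L) L) :
    HasSum (fun k => ∫ τ in (0 : ℝ)..t, F k τ) (∫ τ in (0 : ℝ)..t, ∑' k, F k τ) := by
  have hL : 0 ≤ L := by linarith [ht.1, ht.2]
  have hsub : uIoc 0 t ⊆ Icc (-L) L :=
    uIoc_subset_uIcc.trans (uIcc_subset_Icc ⟨by linarith, hL⟩ ht)
  refine intervalIntegral.hasSum_integral_of_dominated_convergence (fun k _ => b k) (fun k => ?_)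
    (fun k => ae_of_all _ fun τ hτ => hle k τ (hsub hτ)) (ae_of_all _ fun _ _ => hb)
    intervalIntegrable_const (ae_of_all _ fun τ hτ => ?_)
  · exact ((hF k).mono hsub).aestronglyMeasurable measurableSet_uIoc
  · exact (Summable.of_norm_bounded hb fun k => hle k τ (hsub hτ)).hasSum

theorem isPath_order1 {s M ε L : ℝ} {a : ℤ × ℤ → ℂ} (hs : 1 < s) (hε : 0 ≤ ε) (hL : 0 ≤ L)
    (ha : Bdd s M a) (h0 : ∀ n : ℤ × ℤ, n.1 = 0 → a n = 0) :
    ∃ φ, IsPath s L (ε * 2 ^ (s + 1) * (M * M)) (ε * 2 ^ (s + 1) * (M * M)) (order1 ε a) φ := by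
  have hp := IsPath.const (L := L) ha h0 (le_refl (0 : ℝ))
  exact ⟨_, (hp.duh hs hp hε hL).mono (by simp) le_rfl⟩

theorem order1_eq {s M : ℝ} {a : ℤ × ℤ → ℂ} (hs : 1 < s) (ha : Bdd s M a)
    (h0 : ∀ n : ℤ × ℤ, n.1 = 0 → a n = 0) (ε t : ℝ) (n : ℤ × ℤ) :
    order1 ε a t n
      = -(Complex.I * ε / 2) * n.1 * ∑' k, phInt n k t * (a k * a (n - k)) := by
  have hp := IsPath.const (L := |t|) ha h0 (le_refl (0 : ℝ))
  have ht : t ∈ Icc (-|t|) |t| := abs_le.1 le_rfl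
  rw [order1, duh]
  congr 1
  have := hasSum_intervalIntegral_of_norm_le (F := fun k τ => ph n k τ * a k * a (n - k))
    (L := |t|) (fun k => ((continuous_ph n k).mul_const _ |>.mul_const _).continuousOn)
    ((summable_wt_mul_wt hs n).mul_left (M * M)) (fun k τ hτ => by
      rw [norm_mul, norm_mul, norm_ph, one_mul]
      exact hp.norm_mul_le hp hτ n k) ht
  rw [show (fun τ => quad τ a a n) = fun τ => ∑' k, ph n k τ * a k * a (n - k) from rfl,
    ← this.tsum_eq]
  refine tsum_congr fun k => ?_
  rw [intervalIntegral.integral_mul_const, intervalIntegral.integral_mul_const, phInt, mul_assoc]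

theorem quad_comm (t : ℝ) (v w : ℤ × ℤ → ℂ) (n : ℤ × ℤ) : quad t v w n = quad t w v n := by
  rw [quad, quad, ← (Equiv.subLeft n).tsum_eq]
  refine tsum_congr fun k => ?_
  simp only [Equiv.subLeft_apply]
  rw [ph_sub_left, sub_sub_cancel]
  ring

theorem order2_eq {s M ε : ℝ} {a : ℤ × ℤ → ℂ} (hs : 1 < s) (hε : 0 ≤ ε) (ha : Bdd s M a)
    (h0 : ∀ n : ℤ × ℤ, n.1 = 0 → a n = 0) (t : ℝ) (n : ℤ × ℤ) :
    order2 ε a t n = -(Complex.I * ε) * n.1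
      * ∑' k, (∫ τ in (0 : ℝ)..t, ph n k τ * order1 ε a τ k) * a (n - k) := by
  have hp := IsPath.const (L := |t|) ha h0 (le_refl (0 : ℝ))
  obtain ⟨φ, hq⟩ := isPath_order1 hs hε (abs_nonneg t) ha h0
  have ht : t ∈ Icc (-|t|) |t| := abs_le.1 le_rfl
  have this := hasSum_intervalIntegral_of_norm_le
    (F := fun k τ => ph n k τ * order1 ε a τ k * a (n - k)) (L := |t|)
    (fun k => ((continuous_ph n k).continuousOn.mul (hq.continuousOn k)).mul continuousOn_const)
    ((summable_wt_mul_wt hs n).mul_left ((ε * 2 ^ (s + 1) * (M * M)) * M)) (fun k τ hτ => by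
      rw [norm_mul, norm_mul, norm_ph, one_mul]
      exact hq.norm_mul_le hp hτ n k) ht
  have h2 : ∫ τ in (0 : ℝ)..t, quad τ (order1 ε a τ) a n
      = ∑' k, (∫ τ in (0 : ℝ)..t, ph n k τ * order1 ε a τ k) * a (n - k) := by
    rw [show (fun τ => quad τ (order1 ε a τ) a n)
      = fun τ => ∑' k, ph n k τ * order1 ε a τ k * a (n - k) from rfl, ← this.tsum_eq]
    exact tsum_congr fun k => intervalIntegral.integral_mul_const _ _
  -- The two Duhamel terms of `order2` coincide by symmetry of `quad`, which turns ε/2 into ε.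
  rw [order2, duh, duh]
  simp_rw [quad_comm _ a]
  rw [h2]
  ring

/-! #### Expectations -/

theorem hasSum_integral_of_ae_norm_le {Ω : Type*} [MeasurableSpace Ω] {μ : Measure Ω}
    [IsProbabilityMeasure μ] {X : ℤ × ℤ → Ω → ℂ} {b : ℤ × ℤ → ℝ}
    (hX : ∀ k, AEStronglyMeasurable (X k) μ) (hb : Summable b)
    (hle : ∀ k, ∀ᵐ ω ∂μ, ‖X k ω‖ ≤ b k) :
    HasSum (fun k => ∫ ω, X k ω ∂μ) (∫ ω, ∑' k, X k ω ∂μ) := by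
  have hint : ∀ k, Integrable (X k) μ := fun k => Integrable.of_bound (hX k) _ (hle k)
  refine hasSum_integral_of_summable_integral_norm hint ?_
  refine Summable.of_nonneg_of_le (fun k => integral_nonneg fun _ => norm_nonneg _) (fun k => ?_) hb
  calc ∫ ω, ‖X k ω‖ ∂μ ≤ ∫ _, b k ∂μ :=
        integral_mono_ae (hint k).norm (integrable_const _) (hle k)
    _ = b k := by simp

/-- The contribution of the pair `{p, q}` to the correlations of products of two coefficients of
the initial datum. -/
def pairWeight {Ω : Type*} [MeasurableSpace Ω] (μ : Measure Ω) (g : ℤ × ℤ → Ω → ℂ)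
    (lam : ℤ × ℤ → ℂ) (p q : ℤ × ℤ) : ℝ :=
  if p = q then mom4 μ g * ‖lam p‖ ^ 4 else 2 * mom2 μ g ^ 2 * (‖lam p‖ ^ 2 * ‖lam q‖ ^ 2)

theorem datum_zero {Ω : Type*} {g : ℤ × ℤ → Ω → ℂ} {lam : ℤ × ℤ → ℂ} {ω : Ω} (n : ℤ × ℤ)
    (hn : n.1 = 0) : datum g lam ω n = 0 := by rw [datum, if_pos hn]

theorem measurable_comp_snd {Ω S : Type*} [MeasurableSpace Ω] [MeasurableSpace S]
    {Q : ℝ × S → ℂ} (hQ : Measurable Q) {D : Ω → S} (hD : Measurable D) :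
    Measurable (fun q : ℝ × Ω => Q (q.1, D q.2)) :=
  hQ.comp (measurable_fst.prodMk (hD.comp measurable_snd))

theorem measurable_mul_swap {Ω : Type*} [MeasurableSpace Ω] {p : ℝ → ℂ} (hp : Measurable p)
    {f : ℝ → Ω → ℂ} (hf : Measurable (fun q : ℝ × Ω => f q.1 q.2)) :
    Measurable (fun q : Ω × ℝ => p q.2 * f q.2 q.1) :=
  (hp.comp measurable_snd).mul (hf.comp measurable_swap)

theorem measurable_mul_mul {Ω : Type*} [MeasurableSpace Ω] {p : ℝ → ℂ} (hp : Measurable p)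
    {f : ℝ → Ω → ℂ} (hf : Measurable (fun q : ℝ × Ω => f q.1 q.2)) {r : Ω → ℂ}
    (hr : Measurable r) :
    Measurable (Function.uncurry fun (τ : ℝ) (ω : Ω) => p τ * f τ ω * r ω) :=
  ((hp.comp measurable_fst).mul hf).mul (hr.comp measurable_snd)

namespace RandomDatum

variable {Ω : Type*} [MeasurableSpace Ω] {μ : Measure Ω} [IsProbabilityMeasure μ] {s : ℝ}
  {g : ℤ × ℤ → Ω → ℂ} {lam : ℤ × ℤ → ℂ}

theorem integral_order1_mul_conj (h : RandomDatum μ s g lam) (ε t : ℝ) {n p q : ℤ × ℤ}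
    (hn : n.1 ≠ 0) (hp : p.1 ≠ 0) (hq : q.1 ≠ 0) (hpq : p + q = n) :
    ∫ ω, order1 ε (datum g lam ω) t n * conj (datum g lam ω p * datum g lam ω q) ∂μ
      = -(Complex.I * ε / 2) * n.1 * (phInt n p t * pairWeight μ g lam p q) := by
  have hq' : n - p = q := by rw [← hpq]; abel
  set M := embConst s with hM
  have hM0 : 0 ≤ M := by have := one_le_embConst s; linarith
  let X : ℤ × ℤ → Ω → ℂ := fun k ω => phInt n k t
    * (datum g lam ω k * datum g lam ω (n - k) * conj (datum g lam ω p * datum g lam ω q))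
  have hm := h.measurable_datum_apply
  have hXm : ∀ k, AEStronglyMeasurable (X k) μ := fun k =>
    ((((hm k).mul (hm (n - k))).mul (Complex.continuous_conj.measurable.comp
      ((hm p).mul (hm q)))).const_mul _).aestronglyMeasurable
  have hXb : ∀ k, ∀ᵐ ω ∂μ, ‖X k ω‖ ≤ |t| * (M * M) * (M * M) * (wt s k * wt s (n - k)) := by
    intro k
    filter_upwards [h.ae_bdd] with ω hω
    have e1 := hω.norm_le_wt' (datum_zero) k
    have e2 := hω.norm_le_wt' (datum_zero) (n - k)
    have e3 := hω.norm_le p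
    have e4 := hω.norm_le q
    have e5 := norm_phInt_le n k t
    simp only [X, norm_mul, RCLike.norm_conj]
    have w1 := wt_nonneg s k
    have w2 := wt_nonneg s (n - k)
    calc _ ≤ |t| * ((M * wt s k) * (M * wt s (n - k)) * (M * M)) := by gcongr
      _ = _ := by ring
  have hS := hasSum_integral_of_ae_norm_le hXm ((summable_wt_mul_wt h.one_lt n).mul_left _) hXb
  have hE : ∫ ω, order1 ε (datum g lam ω) t n * conj (datum g lam ω p * datum g lam ω q) ∂μ
      = -(Complex.I * ε / 2) * n.1 * ∫ ω, ∑' k, X k ω ∂μ := by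
    rw [← integral_const_mul]
    refine integral_congr_ae ?_
    filter_upwards [h.ae_bdd] with ω hω
    rw [order1_eq h.one_lt hω (datum_zero), mul_assoc, ← tsum_mul_right]
    congr 1
    exact tsum_congr fun k => by simp only [X]; ring
  have hval : ∀ k, ∫ ω, X k ω ∂μ = phInt n k t * ∫ ω, datum g lam ω k * datum g lam ω (n - k)
      * conj (datum g lam ω p * datum g lam ω q) ∂μ := fun k => integral_const_mul _ _
  have hz : ∀ k, k ∉ ({p, q} : Finset (ℤ × ℤ)) → ∫ ω, X k ω ∂μ = 0 := fun k hk => by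
    simp only [Finset.mem_insert, Finset.mem_singleton, not_or] at hk
    rw [hval]
    by_cases hk0 : k.1 = 0
    · simp [datum_zero k hk0]
    · rw [h.integral_four_eq_zero hk0 (by rwa [add_sub_cancel]) hk.1 hk.2, mul_zero]
  have hvp : ∫ ω, X p ω ∂μ = phInt n p t
      * ((if p = q then mom4 μ g * ‖lam p‖ ^ 4
        else mom2 μ g ^ 2 * (‖lam p‖ ^ 2 * ‖lam q‖ ^ 2) : ℝ) : ℂ) := by
    rw [hval, hq', h.integral_four_paired hp hq (by rwa [hpq])]
  rw [hE, ← hS.tsum_eq, tsum_eq_sum hz]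
  congr 1
  -- For p ≠ q the pairings k = p and k = q are distinct and contribute equally, hence the factor 2
  -- in `pairWeight`; for p = q there is a single pairing, with the fourth moment.
  by_cases he : p = q
  · rw [pairWeight, if_pos he, ← he, Finset.pair_eq_singleton, Finset.sum_singleton, hvp, if_pos he]
  · have hvq : ∫ ω, X q ω ∂μ = ∫ ω, X p ω ∂μ := by
      rw [hval, hval, hq', show n - q = p by rw [← hpq]; abel, ← hq', phInt_sub_left]
      congr 1
      congr 1
      funext ω
      ring
    rw [Finset.sum_pair he, hvq, hvp, pairWeight, if_neg he, if_neg he]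
    push_cast; ring

/-- The second moment of the first order term. -/
theorem hasSum_integral_order1_mul_conj_self (h : RandomDatum μ s g lam) {ε : ℝ} (hε : 0 ≤ ε)
    (t : ℝ) {n : ℤ × ℤ} (hn : n.1 ≠ 0) :
    HasSum (fun k => if k.1 ≠ 0 ∧ (n - k).1 ≠ 0 then
        -(ε ^ 2 / 2 * (n.1 : ℝ) ^ 2 * (osc n k (n - k) t * pairWeight μ g lam k (n - k))) else 0)
      (∫ ω, order1 ε (datum g lam ω) t n * conj (order1 ε (datum g lam ω) t n) ∂μ).re := by
  set M := embConst s with hM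
  have hM0 : 0 ≤ M := by have := one_le_embConst s; linarith
  set c : ℂ := -(Complex.I * ε / 2) * n.1 with hc
  have hK : (0 : ℝ) ≤ ε * 2 ^ (s + 1) * (M * M) := by positivity
  let X : ℤ × ℤ → Ω → ℂ := fun k ω => c * phInt n k t
    * (datum g lam ω k * datum g lam ω (n - k)) * conj (order1 ε (datum g lam ω) t n)
  have hm := h.measurable_datum_apply
  have hw : Measurable (fun ω => order1 ε (datum g lam ω) t n) :=
    ((MeasurableFamily.order1 ε).apply t n).comp h.measurable_datum
  have hXm : ∀ k, AEStronglyMeasurable (X k) μ := fun k =>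
    ((((hm k).mul (hm (n - k))).const_mul _).mul
      (Complex.continuous_conj.measurable.comp hw)).aestronglyMeasurable
  have hwb : ∀ᵐ ω ∂μ, ‖order1 ε (datum g lam ω) t n‖ ≤ ε * 2 ^ (s + 1) * (M * M) := by
    filter_upwards [h.ae_bdd] with ω hω
    obtain ⟨φ, hφ⟩ := isPath_order1 h.one_lt hε (abs_nonneg t) hω (datum_zero)
    exact (hφ.bdd t (abs_le.1 le_rfl)).norm_le n
  have hXb : ∀ k, ∀ᵐ ω ∂μ, ‖X k ω‖ ≤ ‖c‖ * |t| * (M * M) * (ε * 2 ^ (s + 1) * (M * M))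
      * (wt s k * wt s (n - k)) := by
    intro k
    filter_upwards [h.ae_bdd, hwb] with ω hω e3
    have e1 := hω.norm_le_wt' (datum_zero) k
    have e2 := hω.norm_le_wt' (datum_zero) (n - k)
    have e5 := norm_phInt_le n k t
    simp only [X, norm_mul, RCLike.norm_conj]
    have w1 := wt_nonneg s k
    have w2 := wt_nonneg s (n - k)
    calc _ ≤ ‖c‖ * |t| * ((M * wt s k) * (M * wt s (n - k))) * (ε * 2 ^ (s + 1) * (M * M)) := by
          gcongr
      _ = _ := by ring
  have hS := hasSum_integral_of_ae_norm_le hXm ((summable_wt_mul_wt h.one_lt n).mul_left _) hXb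
  have hE : ∫ ω, order1 ε (datum g lam ω) t n * conj (order1 ε (datum g lam ω) t n) ∂μ
      = ∫ ω, ∑' k, X k ω ∂μ := by
    refine integral_congr_ae ?_
    filter_upwards [h.ae_bdd] with ω hω
    simp only [X]
    rw [tsum_mul_right]
    congr 1
    rw [order1_eq h.one_lt hω (datum_zero), ← tsum_mul_left]
    exact tsum_congr fun k => by ring
  rw [hE]
  convert! Complex.hasSum_re hS using 1
  funext k
  split_ifs with hk
  · have h1 : ∫ ω, X k ω ∂μ = c * phInt n k t * conj (∫ ω, order1 ε (datum g lam ω) t n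
        * conj (datum g lam ω k * datum g lam ω (n - k)) ∂μ) := by
      rw [← integral_conj, ← integral_const_mul]
      congr 1
      funext ω
      simp only [X, map_mul, Complex.conj_conj]
      ring
    have h2 : ∫ ω, X k ω ∂μ
        = ((‖c‖ ^ 2 * ‖phInt n k t‖ ^ 2 * pairWeight μ g lam k (n - k) : ℝ) : ℂ) := by
      rw [h1, h.integral_order1_mul_conj ε t hn hk.1 hk.2 (add_sub_cancel k n), ← hc,
        map_mul (starRingEnd ℂ) c, map_mul (starRingEnd ℂ) (phInt n k t), Complex.conj_ofReal]
      push_cast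
      rw [← Complex.mul_conj', ← Complex.mul_conj']
      ring
    have h3 : ‖c‖ = ε / 2 * |(n.1 : ℝ)| := by
      rw [hc, norm_mul, Complex.norm_intCast, norm_neg, norm_div, norm_mul, Complex.norm_I]
      simp [abs_of_nonneg hε]
    rw [h2, Complex.ofReal_re, norm_phInt_sq (Delta_ne_zero hn hk.1 hk.2), h3, mul_pow, sq_abs]
    ring
  · have h1 : ∀ ω, X k ω = 0 := fun ω => by
      by_cases hk1 : k.1 = 0
      · simp only [X, datum_zero k hk1]; ring
      · have hk2 : (n - k).1 = 0 := by
          by_contra hk2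
          exact hk ⟨hk1, hk2⟩
        simp only [X, datum_zero _ hk2]; ring
    simp [h1]

/-- The correlation of the second order term with the initial datum. -/
theorem hasSum_integral_order2_mul_conj (h : RandomDatum μ s g lam) {ε : ℝ} (hε : 0 ≤ ε)
    (t : ℝ) {n : ℤ × ℤ} (hn : n.1 ≠ 0) :
    HasSum (fun k => if k.1 ≠ 0 ∧ (n - k).1 ≠ 0 then
        ε ^ 2 / 2 * ((n.1 : ℝ) * k.1) * (osc n k (n - k) t * pairWeight μ g lam n (k - n)) else 0)
      (∫ ω, order2 ε (datum g lam ω) t n * conj (datum g lam ω n) ∂μ).re := by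
  set M := embConst s with hM
  have hM0 : 0 ≤ M := by have := one_le_embConst s; linarith
  set c : ℂ := -(Complex.I * ε) * n.1 with hc
  set A : ℝ := ε * 2 ^ (s + 1) * (M * M) with hA
  have hA0 : 0 ≤ A := by positivity
  have hm := h.measurable_datum_apply
  have hwb : ∀ᵐ ω ∂μ, ∀ τ k, ‖order1 ε (datum g lam ω) τ k‖ ≤ A * wt s k := by
    filter_upwards [h.ae_bdd] with ω hω τ k
    obtain ⟨φ, hφ⟩ := isPath_order1 h.one_lt hε (abs_nonneg τ) hω datum_zero
    exact hφ.norm_le_wt (abs_le.1 le_rfl) k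
  have hwm : ∀ k, Measurable (fun q : ℝ × Ω => order1 ε (datum g lam q.2) q.1 k) := fun k =>
    measurable_comp_snd (MeasurableFamily.order1 ε k) h.measurable_datum
  have hwm' : ∀ k, Measurable (fun q : Ω × ℝ => ph n k q.2 * order1 ε (datum g lam q.1) q.2 k) :=
    fun k => measurable_mul_swap (continuous_ph n k).measurable
      (f := fun τ ω => order1 ε (datum g lam ω) τ k) (hwm k)
  let J : ℤ × ℤ → Ω → ℂ := fun k ω => ∫ τ in (0 : ℝ)..t, ph n k τ * order1 ε (datum g lam ω) τ k
  have hJm : ∀ k, Measurable (J k) := fun k =>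
    measurable_intervalIntegral (f := fun ω τ => ph n k τ * order1 ε (datum g lam ω) τ k)
      (hwm' k) measurable_const
  have hJb : ∀ᵐ ω ∂μ, ∀ k, ‖J k ω‖ ≤ A * wt s k * |t| := by
    filter_upwards [hwb] with ω hω k
    have := intervalIntegral.norm_integral_le_of_norm_le_const (a := (0 : ℝ)) (b := t)
      (C := A * wt s k) (f := fun τ => ph n k τ * order1 ε (datum g lam ω) τ k) fun τ _ => by
        rw [norm_mul, norm_ph, one_mul]; exact hω τ k
    rwa [sub_zero] at this
  let X : ℤ × ℤ → Ω → ℂ := fun k ω => c * (J k ω * datum g lam ω (n - k)) * conj (datum g lam ω n)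
  have hXm : ∀ k, AEStronglyMeasurable (X k) μ := fun k =>
    ((((hJm k).mul (hm (n - k))).const_mul _).mul
      (Complex.continuous_conj.measurable.comp (hm n))).aestronglyMeasurable
  have hXb : ∀ k, ∀ᵐ ω ∂μ, ‖X k ω‖ ≤ ‖c‖ * A * |t| * M * M * (wt s k * wt s (n - k)) := by
    intro k
    filter_upwards [h.ae_bdd, hJb] with ω hω e1
    have e1 := e1 k
    have e2 := hω.norm_le_wt' datum_zero (n - k)
    have e3 := hω.norm_le n
    simp only [X, norm_mul, RCLike.norm_conj]
    have w1 := wt_nonneg s k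
    have w2 := wt_nonneg s (n - k)
    calc _ ≤ ‖c‖ * ((A * wt s k * |t|) * (M * wt s (n - k))) * M := by gcongr
      _ = _ := by ring
  have hS := hasSum_integral_of_ae_norm_le hXm ((summable_wt_mul_wt h.one_lt n).mul_left _) hXb
  have hE : ∫ ω, order2 ε (datum g lam ω) t n * conj (datum g lam ω n) ∂μ
      = ∫ ω, ∑' k, X k ω ∂μ := by
    refine integral_congr_ae ?_
    filter_upwards [h.ae_bdd] with ω hω
    simp only [X]
    rw [tsum_mul_right, tsum_mul_left, order2_eq h.one_lt hε hω datum_zero]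
  rw [hE]
  convert! Complex.hasSum_re hS using 1
  funext k
  split_ifs with hk
  · have hnk : (-(n - k)).1 ≠ 0 := by simpa only [Prod.fst_neg, neg_ne_zero] using hk.2
    -- The expectation goes inside the time integral, so that at each time only a correlation of
    -- `order1` with two coefficients of the datum is left.
    have hsw : ∫ ω, X k ω ∂μ = c * ∫ τ in (0 : ℝ)..t, ∫ ω, ph n k τ
        * order1 ε (datum g lam ω) τ k * (datum g lam ω (n - k) * conj (datum g lam ω n)) ∂μ := by
      rw [intervalIntegral_integral_swap, ← integral_const_mul]
      · congr 1
        funext ω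
        rw [intervalIntegral.integral_mul_const]
        simp only [X, J]
        ring
      · have hmeas : Measurable (Function.uncurry fun (τ : ℝ) (ω : Ω) => ph n k τ
            * order1 ε (datum g lam ω) τ k * (datum g lam ω (n - k) * conj (datum g lam ω n))) :=
          measurable_mul_mul (continuous_ph n k).measurable
            (f := fun τ ω => order1 ε (datum g lam ω) τ k) (hwm k)
            ((hm (n - k)).mul (Complex.continuous_conj.measurable.comp (hm n)))
        have hfin : IsFiniteMeasure ((volume : Measure ℝ).restrict (uIoc 0 t)) :=
          ⟨by rw [Measure.restrict_apply_univ, uIoc, Real.volume_Ioc]; exact ENNReal.ofReal_lt_top⟩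
        refine Integrable.of_bound hmeas.aestronglyMeasurable (A * wt s k * (M * M)) ?_
        rw [Measure.ae_prod_iff_ae_ae (measurableSet_le hmeas.norm measurable_const)]
        refine ae_of_all _ fun τ => ?_
        filter_upwards [h.ae_bdd, hwb] with ω hω e1
        have e1 := e1 τ k
        have e2 := hω.norm_le (n - k)
        have e3 := hω.norm_le n
        have w1 := wt_nonneg s k
        simp only [Function.uncurry_apply_pair, norm_mul, norm_ph, one_mul, RCLike.norm_conj]
        gcongr
    -- The datum is real, so a_{n-k} conj(a_n) = conj(a_n a_{k-n}): a pair of frequencies with sum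
    -- k, as the correlation formula requires.
    have hin : ∀ τ, ∫ ω, ph n k τ * order1 ε (datum g lam ω) τ k
        * (datum g lam ω (n - k) * conj (datum g lam ω n)) ∂μ
        = -(Complex.I * ε / 2) * k.1 * pairWeight μ g lam n (k - n) * phInt n k τ := fun τ => by
      have h1 : ∀ ω, ph n k τ * order1 ε (datum g lam ω) τ k
          * (datum g lam ω (n - k) * conj (datum g lam ω n))
          = ph n k τ * (order1 ε (datum g lam ω) τ k
            * conj (datum g lam ω n * datum g lam ω (k - n))) := fun ω => by
        rw [map_mul, ← neg_sub n k, h.datum_neg, Complex.conj_conj]; ring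
      simp_rw [h1]
      rw [integral_const_mul, h.integral_order1_mul_conj ε τ hk.1 hn (by rwa [← neg_sub n k])
        (add_sub_cancel n k), ← phInt_swap (Delta_ne_zero hn hk.1 hk.2) τ]
      ring
    rw [hsw]
    simp_rw [hin]
    rw [intervalIntegral.integral_const_mul]
    have hcc : c * (-(Complex.I * ε / 2) * k.1 * pairWeight μ g lam n (k - n)
        * ∫ τ in (0 : ℝ)..t, phInt n k τ)
        = ((-(ε ^ 2 / 2 * (n.1 * k.1) * pairWeight μ g lam n (k - n)) : ℝ) : ℂ)
          * ∫ τ in (0 : ℝ)..t, phInt n k τ := by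
      rw [hc]
      push_cast
      linear_combination (ε ^ 2 / 2 * n.1 * k.1 * pairWeight μ g lam n (k - n)
        * ∫ τ in (0 : ℝ)..t, phInt n k τ) * Complex.I_sq
    rw [hcc, Complex.re_ofReal_mul, re_integral_phInt (Delta_ne_zero hn hk.1 hk.2)]
    ring
  · have h1 : ∀ᵐ ω ∂μ, X k ω = 0 := by
      filter_upwards [h.ae_bdd] with ω hω
      by_cases hk1 : k.1 = 0
      · have hz : ∀ τ, order1 ε (datum g lam ω) τ k = 0 := fun τ => by
          simp [order1, duh, hk1]
        simp [X, J, hz]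
      · have hk2 : (n - k).1 = 0 := by
          by_contra hk2
          exact hk ⟨hk1, hk2⟩
        simp only [X, datum_zero _ hk2]; ring
    rw [integral_congr_ae h1]
    simp

end RandomDatum

/-! ### The second order coefficient -/

theorem Delta_comm (n k l : ℤ × ℤ) : Delta n k l = Delta n l k := by
  rw [Delta, Delta, add_comm (disp k)]

theorem osc_comm (n k l : ℤ × ℤ) (t : ℝ) : osc n k l t = osc n l k t := by
  rw [osc, osc, Delta_comm]

theorem abs_osc_mul_le {n k : ℤ × ℤ} (hn : n.1 ≠ 0) (hk : k.1 ≠ 0) (hl : (n - k).1 ≠ 0) (t : ℝ) :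
    |osc n k (n - k) t| * (|(n.1 : ℝ)| * |(k.1 : ℝ)| * |((n - k).1 : ℝ)|) ^ 2 ≤ 1 := by
  have h1 := le_abs_Delta hn hk hl
  have hD := Delta_ne_zero hn hk hl
  have h2 : |Real.cos (Delta n k (n - k) * t) - 1| ≤ 2 := by
    rw [abs_le]
    constructor <;> linarith [Real.neg_one_le_cos (Delta n k (n - k) * t),
      Real.cos_le_one (Delta n k (n - k) * t)]
  set q := |(n.1 : ℝ)| * |(k.1 : ℝ)| * |((n - k).1 : ℝ)| with hq
  have hq0 : 0 ≤ q := by positivity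
  have h3 : q ^ 2 * 9 ≤ Delta n k (n - k) ^ 2 := by
    rw [← sq_abs (Delta n k (n - k))]
    nlinarith
  have hpos : 0 < Delta n k (n - k) ^ 2 := by positivity
  rw [osc, abs_div, abs_of_pos hpos, div_mul_eq_mul_div, div_le_one hpos]
  nlinarith [sq_nonneg q]

theorem abs_fst_le_two_mul {n k : ℤ × ℤ} (hk : k.1 ≠ 0) (hl : (n - k).1 ≠ 0) :
    |(n.1 : ℝ)| ≤ 2 * (|(k.1 : ℝ)| * |((n - k).1 : ℝ)|) := by
  have h1 := one_le_abs_intCast hk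
  have h2 := one_le_abs_intCast hl
  have h3 : |(n.1 : ℝ)| ≤ |(k.1 : ℝ)| + |((n - k).1 : ℝ)| := by
    rw [show (n.1 : ℝ) = (k.1 : ℝ) + ((n - k).1 : ℝ) by push_cast [Prod.fst_sub]; ring]
    exact abs_add_le _ _
  nlinarith

/-- Of the two powers of |k₁(n-k)₁| available, one is discarded. What is left controls n₁²k₁,
n₁²(n-k)₁ and, by |n₁| ≤ 2|k₁(n-k)₁|, also n₁³. -/
theorem abs_osc_mul_sq_mul_le {n k : ℤ × ℤ} (hn : n.1 ≠ 0) (hk : k.1 ≠ 0) (hl : (n - k).1 ≠ 0)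
    (t : ℝ) : |osc n k (n - k) t| * |(n.1 : ℝ)| ^ 2 * (|(k.1 : ℝ)| * |((n - k).1 : ℝ)|) ≤ 1 := by
  have h0 := abs_osc_mul_le hn hk hl t
  have h1 : 1 ≤ |(k.1 : ℝ)| * |((n - k).1 : ℝ)| :=
    one_le_mul_of_one_le_of_one_le (one_le_abs_intCast hk) (one_le_abs_intCast hl)
  set r := |(k.1 : ℝ)| * |((n - k).1 : ℝ)|
  calc |osc n k (n - k) t| * |(n.1 : ℝ)| ^ 2 * r
      ≤ |osc n k (n - k) t| * |(n.1 : ℝ)| ^ 2 * r ^ 2 := by gcongr; nlinarith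
    _ ≤ 1 := by rw [mul_assoc] at h0; rw [mul_pow] at h0; linarith

theorem abs_osc_mul_cube_le {n k : ℤ × ℤ} (hn : n.1 ≠ 0) (hk : k.1 ≠ 0) (hl : (n - k).1 ≠ 0)
    (t : ℝ) : |osc n k (n - k) t| * |(n.1 : ℝ)| ^ 3 ≤ 2 := by
  have h0 := abs_osc_mul_sq_mul_le hn hk hl t
  have h1 := abs_fst_le_two_mul hk hl
  set r := |(k.1 : ℝ)| * |((n - k).1 : ℝ)|
  calc |osc n k (n - k) t| * |(n.1 : ℝ)| ^ 3
      = |osc n k (n - k) t| * |(n.1 : ℝ)| ^ 2 * |(n.1 : ℝ)| := by ring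
    _ ≤ |osc n k (n - k) t| * |(n.1 : ℝ)| ^ 2 * (2 * r) := by gcongr
    _ ≤ 2 := by linarith

/-- The squared moduli `|λ_k|²`, extended by zero outside the admissible frequencies. -/
def energy (lam : ℤ × ℤ → ℂ) (k : ℤ × ℤ) : ℝ := if k.1 = 0 then 0 else ‖lam k‖ ^ 2

theorem energy_nonneg (lam : ℤ × ℤ → ℂ) (k : ℤ × ℤ) : 0 ≤ energy lam k := by
  rw [energy]; split_ifs <;> positivity

theorem energy_eq {lam : ℤ × ℤ → ℂ} {k : ℤ × ℤ} (hk : k.1 ≠ 0) : energy lam k = ‖lam k‖ ^ 2 :=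
  if_neg hk

/-- The convolution square of the `|λ_k|²`. -/
def energyConv (lam : ℤ × ℤ → ℂ) (n : ℤ × ℤ) : ℝ := ∑' k, energy lam k * energy lam (n - k)

/-- Of the two factors n₁, one is the prefactor of F and the other is √|n₁m₁| on the diagonal. -/
theorem sq_mul_abs_seriesTerm_le (lam : ℤ × ℤ → ℂ) {n : ℤ × ℤ} (hn : n.1 ≠ 0) (t : ℝ)
    (k : ℤ × ℤ) : |(n.1 : ℝ)| ^ 2 * |seriesTerm lam n t k|
      ≤ energy lam n * energy lam (n - k) + energy lam n * energy lam k
        + 2 * (energy lam k * energy lam (n - k)) := by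
  have e1 := energy_nonneg lam n
  have e2 := energy_nonneg lam k
  have e3 := energy_nonneg lam (n - k)
  rw [seriesTerm]
  split_ifs with hk
  · have h1 := abs_osc_mul_sq_mul_le hn hk.1 hk.2 t
    have h2 := abs_osc_mul_cube_le hn hk.1 hk.2 t
    have k1 := one_le_abs_intCast hk.1
    have k2 := one_le_abs_intCast hk.2
    rw [energy_eq hn, energy_eq hk.1, energy_eq hk.2] at *
    rw [abs_mul]
    set o := |osc n k (n - k) t|
    have ho : 0 ≤ o := abs_nonneg _
    have h3 : o * |(n.1 : ℝ)| ^ 2 * |(k.1 : ℝ)| ≤ 1 := le_trans (by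
      gcongr; exact le_mul_of_one_le_right (abs_nonneg _) k2) h1
    have h4 : o * |(n.1 : ℝ)| ^ 2 * |((n - k).1 : ℝ)| ≤ 1 := le_trans (by
      gcongr; exact le_mul_of_one_le_left (abs_nonneg _) k1) h1
    calc |(n.1 : ℝ)| ^ 2 * (o * |(k.1 : ℝ) * ‖lam n‖ ^ 2 * ‖lam (n - k)‖ ^ 2
            + ((n - k).1 : ℝ) * ‖lam n‖ ^ 2 * ‖lam k‖ ^ 2
            - (n.1 : ℝ) * ‖lam k‖ ^ 2 * ‖lam (n - k)‖ ^ 2|)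
        ≤ |(n.1 : ℝ)| ^ 2 * (o * (|(k.1 : ℝ)| * ‖lam n‖ ^ 2 * ‖lam (n - k)‖ ^ 2
            + |((n - k).1 : ℝ)| * ‖lam n‖ ^ 2 * ‖lam k‖ ^ 2
            + |(n.1 : ℝ)| * ‖lam k‖ ^ 2 * ‖lam (n - k)‖ ^ 2)) := by
          gcongr
          refine (abs_sub _ _).trans (add_le_add ((abs_add_le _ _).trans (le_of_eq ?_))
            (le_of_eq ?_)) <;> simp only [abs_mul, abs_pow, abs_norm]
      _ = (o * |(n.1 : ℝ)| ^ 2 * |(k.1 : ℝ)|) * (‖lam n‖ ^ 2 * ‖lam (n - k)‖ ^ 2)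
          + (o * |(n.1 : ℝ)| ^ 2 * |((n - k).1 : ℝ)|) * (‖lam n‖ ^ 2 * ‖lam k‖ ^ 2)
          + (o * |(n.1 : ℝ)| ^ 3) * (‖lam k‖ ^ 2 * ‖lam (n - k)‖ ^ 2) := by ring
      _ ≤ 1 * (‖lam n‖ ^ 2 * ‖lam (n - k)‖ ^ 2) + 1 * (‖lam n‖ ^ 2 * ‖lam k‖ ^ 2)
          + 2 * (‖lam k‖ ^ 2 * ‖lam (n - k)‖ ^ 2) := by gcongr
      _ = _ := by ring
  · rw [abs_zero, mul_zero]; positivity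

theorem summable_mul_sub {a b : ℤ × ℤ → ℝ} (ha : Summable a) (hb : Summable b) (ha0 : ∀ k, 0 ≤ a k)
    (hb0 : ∀ k, 0 ≤ b k) : Summable (fun p : (ℤ × ℤ) × (ℤ × ℤ) => a p.2 * b (p.1 - p.2)) := by
  have := ha.mul_of_nonneg hb ha0 hb0
  refine this.comp_injective (i := fun p : (ℤ × ℤ) × (ℤ × ℤ) => (p.2, p.1 - p.2)) ?_
  rintro ⟨n, k⟩ ⟨n', k'⟩ h
  simp only [Prod.mk.injEq] at h ⊢
  obtain ⟨rfl, h⟩ := h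
  exact ⟨sub_left_injective h, rfl⟩

/-! ### Weighted summability of the second order coefficient -/

section Energy

variable {s : ℝ} {lam : ℤ × ℤ → ℂ}

theorem summable_energy_of_weighted (hs : 0 ≤ s)
    (hW : Summable fun k => size k ^ (2 * s) * energy lam k) : Summable (energy lam) := by
  refine hW.of_nonneg_of_le (energy_nonneg lam) fun k => ?_
  by_cases hk : k.1 = 0
  · simp [energy, hk]
  · exact le_mul_of_one_le_left (energy_nonneg lam k)
      (Real.one_le_rpow (one_le_size hk) (by linarith))

theorem summable_energy_mul_sub (hE : Summable (energy lam)) (n : ℤ × ℤ) :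
    Summable (fun k => energy lam k * energy lam (n - k)) :=
  (summable_mul_sub hE hE (energy_nonneg lam) (energy_nonneg lam)).prod_factor n

theorem summable_seriesTerm_of_energy (hE : Summable (energy lam)) {n : ℤ × ℤ} (hn : n.1 ≠ 0)
    (t : ℝ) : Summable (seriesTerm lam n t) ∧
      |(n.1 : ℝ)| ^ 2 * |∑' k, seriesTerm lam n t k|
        ≤ 2 * (energy lam n * ∑' k, energy lam k) + 2 * energyConv lam n := by
  have hE' : Summable fun k => energy lam (n - k) :=
    hE.comp_injective (i := fun k => n - k) sub_right_injective
  have hC := summable_energy_mul_sub hE n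
  have hb := ((hE'.mul_left (energy lam n)).add (hE.mul_left (energy lam n))).add (hC.mul_left 2)
  have hle := sq_mul_abs_seriesTerm_le lam hn t
  have h1 : 1 ≤ |(n.1 : ℝ)| ^ 2 := one_le_pow₀ (one_le_abs_intCast hn)
  have hS : Summable (fun k => ‖seriesTerm lam n t k‖) :=
    hb.of_nonneg_of_le (fun _ => norm_nonneg _) fun k =>
      (le_mul_of_one_le_left (norm_nonneg _) h1).trans (hle k)
  refine ⟨hS.of_norm, ?_⟩
  have e : ∑' k, energy lam (n - k) = ∑' k, energy lam k := (Equiv.subLeft n).tsum_eq (energy lam)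
  calc |(n.1 : ℝ)| ^ 2 * |∑' k, seriesTerm lam n t k|
      ≤ |(n.1 : ℝ)| ^ 2 * ∑' k, ‖seriesTerm lam n t k‖ := by
        gcongr; exact norm_tsum_le_tsum_norm hS
    _ = ∑' k, |(n.1 : ℝ)| ^ 2 * ‖seriesTerm lam n t k‖ := tsum_mul_left.symm
    _ ≤ ∑' k, (energy lam n * energy lam (n - k) + energy lam n * energy lam k
        + 2 * (energy lam k * energy lam (n - k))) :=
        (hS.mul_left _).tsum_le_tsum hle hb
    _ = _ := by
        rw [((hE'.mul_left (energy lam n)).add (hE.mul_left (energy lam n))).tsum_add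
          (hC.mul_left 2), (hE'.mul_left (energy lam n)).tsum_add (hE.mul_left (energy lam n)),
          tsum_mul_left, tsum_mul_left, tsum_mul_left, e, energyConv]
        ring

/-- The two corrections cost no more than the series: |λ_n|⁴ is at most `energy lam n` times the
total energy, and |λ_{n/2}|⁴ is one term of `energyConv`. -/
theorem abs_mul_abs_diagF_le (hE : Summable (energy lam)) (m₂ m₄ : ℝ) {n : ℤ × ℤ} (hn : n.1 ≠ 0)
    (t : ℝ) : |(n.1 : ℝ)| * |diagF lam m₂ m₄ n t|
      ≤ (2 * m₂ ^ 2 + 4 * |m₄ - 2 * m₂ ^ 2|)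
        * (energy lam n * ∑' k, energy lam k + energyConv lam n) := by
  obtain ⟨-, hser⟩ := summable_seriesTerm_of_energy hE hn t
  have hC := summable_energy_mul_sub hE n
  have hC0 : ∀ k, 0 ≤ energy lam k * energy lam (n - k) := fun k =>
    mul_nonneg (energy_nonneg _ _) (energy_nonneg _ _)
  have hconv0 : 0 ≤ energyConv lam n := tsum_nonneg hC0
  have htot : energy lam n ≤ ∑' k, energy lam k := hE.le_tsum n fun k _ => energy_nonneg lam k
  have hA : |(n.1 : ℝ)| ^ 3 * |osc n (-n) (n + n) t| * ‖lam n‖ ^ 4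
      ≤ 2 * (energy lam n * ∑' k, energy lam k) := by
    have h1 := abs_osc_mul_cube_le (n := n) (k := -n) hn (by simpa using hn)
      (by rw [sub_neg_eq_add, Prod.fst_add]; omega) t
    rw [sub_neg_eq_add, mul_comm] at h1
    have h2 : ‖lam n‖ ^ 4 = energy lam n * energy lam n := by rw [energy_eq hn]; ring
    rw [h2]
    have := energy_nonneg lam n
    gcongr
  have hB : |(n.1 : ℝ)| ^ 3 * |if Even n.1 ∧ Even n.2 then
            (n.1 : ℝ) / 2 * osc n (n.1 / 2, n.2 / 2) (n.1 / 2, n.2 / 2) t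
              * ‖lam (n.1 / 2, n.2 / 2)‖ ^ 4
          else 0| ≤ |(n.1 : ℝ)| * energyConv lam n := by
    split_ifs with he
    · obtain ⟨⟨p, hp⟩, ⟨q, hq⟩⟩ := he
      have hk : ((n.1 / 2, n.2 / 2) : ℤ × ℤ) = (p, q) := by
        ext <;> simp <;> omega
      have hl : n - (p, q) = (p, q) := by ext <;> simp <;> omega
      have hp0 : p ≠ 0 := by omega
      have h1 := abs_osc_mul_cube_le (n := n) (k := (p, q)) hn hp0 (by rw [hl]; exact hp0) t
      rw [hl] at h1
      rw [hk]
      have h2 : ‖lam (p, q)‖ ^ 4 ≤ energyConv lam n := by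
        refine le_trans (le_of_eq ?_) (hC.le_tsum (p, q) fun k _ => hC0 k)
        rw [hl, energy_eq (k := (p, q)) hp0]; ring
      rw [abs_mul, abs_mul, abs_div, abs_two, abs_pow, abs_norm]
      calc |(n.1 : ℝ)| ^ 3 * (|(n.1 : ℝ)| / 2 * |osc n (p, q) (p, q) t| * ‖lam (p, q)‖ ^ 4)
          = |(n.1 : ℝ)| / 2 * (|osc n (p, q) (p, q) t| * |(n.1 : ℝ)| ^ 3) * ‖lam (p, q)‖ ^ 4 := by
            ring
        _ ≤ |(n.1 : ℝ)| / 2 * 2 * energyConv lam n := by gcongr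
        _ = _ := by ring
    · rw [abs_zero, mul_zero]; positivity
  set S := ∑' k, seriesTerm lam n t k
  set O := osc n (-n) (n + n) t
  set B := if Even n.1 ∧ Even n.2 then
            (n.1 : ℝ) / 2 * osc n (n.1 / 2, n.2 / 2) (n.1 / 2, n.2 / 2) t
              * ‖lam (n.1 / 2, n.2 / 2)‖ ^ 4
          else 0
  have hn1 := one_le_abs_intCast hn
  have hB' : |(n.1 : ℝ)| ^ 2 * |B| ≤ energyConv lam n := by
    refine le_of_mul_le_mul_left ?_ (by linarith : 0 < |(n.1 : ℝ)|)
    calc _ = |(n.1 : ℝ)| ^ 3 * |B| := by ring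
      _ ≤ _ := hB
  have hAT : 0 ≤ energy lam n * ∑' k, energy lam k := by
    have := energy_nonneg lam n
    exact mul_nonneg this (this.trans htot)
  calc |(n.1 : ℝ)| * |diagF lam m₂ m₄ n t|
      ≤ |(n.1 : ℝ)| * (|(n.1 : ℝ)| * m₂ ^ 2 * |S|
        + |(n.1 : ℝ)| * |m₄ - 2 * m₂ ^ 2| * (2 * |(n.1 : ℝ)| * |O| * ‖lam n‖ ^ 4 + |B|)) := by
        gcongr
        rw [diagF]
        refine (abs_add_le _ _).trans (add_le_add (le_of_eq ?_) ?_)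
        · simp only [abs_mul, abs_pow, sq_abs, S]
        · rw [abs_mul, abs_mul]
          gcongr
          refine (abs_sub _ _).trans (add_le_add (le_of_eq ?_) le_rfl)
          simp only [abs_mul, abs_pow, abs_norm, abs_two, O]
    _ = m₂ ^ 2 * (|(n.1 : ℝ)| ^ 2 * |S|) + |m₄ - 2 * m₂ ^ 2|
        * (2 * (|(n.1 : ℝ)| ^ 3 * |O| * ‖lam n‖ ^ 4) + |(n.1 : ℝ)| ^ 2 * |B|) := by ring
    _ ≤ m₂ ^ 2 * (2 * (energy lam n * ∑' k, energy lam k) + 2 * energyConv lam n)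
        + |m₄ - 2 * m₂ ^ 2| * (2 * (2 * (energy lam n * ∑' k, energy lam k))
          + energyConv lam n) := by gcongr
    _ ≤ _ := by nlinarith [abs_nonneg (m₄ - 2 * m₂ ^ 2)]

theorem summable_weighted_energyConv (hs : 0 ≤ s)
    (hW : Summable fun k => size k ^ (2 * s) * energy lam k) :
    Summable fun n => size n ^ (2 * s) * energyConv lam n := by
  have hE := summable_energy_of_weighted hs hW
  have hE0 := energy_nonneg lam
  have hW0 : ∀ k, 0 ≤ size k ^ (2 * s) * energy lam k := fun k =>
    mul_nonneg (Real.rpow_nonneg (size_nonneg k) _) (hE0 k)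
  have h1 := summable_mul_sub hW hE hW0 hE0
  have h2 := summable_mul_sub hE hW hE0 hW0
  refine ((h1.prod.add h2.prod).mul_left (2 ^ (2 * s))).of_nonneg_of_le (fun n =>
    mul_nonneg (Real.rpow_nonneg (size_nonneg n) _)
      (tsum_nonneg fun k => mul_nonneg (hE0 _) (hE0 _))) fun n => ?_
  have h1n := h1.prod_factor n
  have h2n := h2.prod_factor n
  rw [energyConv, ← tsum_mul_left, ← h1n.tsum_add h2n, ← tsum_mul_left]
  refine ((summable_energy_mul_sub hE n).mul_left _).tsum_le_tsum (fun k => ?_)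
    ((h1n.add h2n).mul_left _)
  calc size n ^ (2 * s) * (energy lam k * energy lam (n - k))
      ≤ (2 ^ (2 * s) * (size k ^ (2 * s) + size (n - k) ^ (2 * s)))
        * (energy lam k * energy lam (n - k)) := by
        have := mul_nonneg (hE0 k) (hE0 (n - k))
        gcongr
        exact size_rpow_le (by linarith) n k
    _ = _ := by ring

end Energy

theorem RandomDatum.secondOrder_eq {Ω : Type*} [MeasurableSpace Ω] {μ : Measure Ω} {s : ℝ}
    {g : ℤ × ℤ → Ω → ℂ} {lam : ℤ × ℤ → ℂ} (h : RandomDatum μ s g lam) {n : ℤ × ℤ} (hn : n.1 ≠ 0)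
    (m : ℤ × ℤ) (t : ℝ) :
    secondOrder μ g lam n m t = if n = m then diagF lam (mom2 μ g) (mom4 μ g) n t else 0 := by
  rw [secondOrder, h.integral_norm_g_pow hn 2, h.integral_norm_g_pow hn 4]
  rfl

namespace RandomDatum

variable {Ω : Type*} [MeasurableSpace Ω] {μ : Measure Ω} [IsProbabilityMeasure μ] {s : ℝ}
  {g : ℤ × ℤ → Ω → ℂ} {lam : ℤ × ℤ → ℂ}

theorem summable_weighted_energy (h : RandomDatum μ s g lam) :
    Summable fun k => size k ^ (2 * s) * energy lam k := by
  rw [← Function.Injective.summable_iff (g := fun k : Freq => (k : ℤ × ℤ)) Subtype.val_injective]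
  · refine summable_of_sum_le (c := 1 / mom2 μ g) (fun k =>
      mul_nonneg (Real.rpow_nonneg (size_nonneg _) _) (energy_nonneg lam _)) fun S => ?_
    refine (le_of_eq (Finset.sum_congr rfl fun k _ => ?_)).trans (h.sum_sq_lam_le S)
    rw [Function.comp_apply, energy_eq k.2, mul_pow, mul_comm 2 s, Real.rpow_mul (size_nonneg _),
      Real.rpow_two]
  · intro k hk
    have : k.1 = 0 := by
      by_contra h0
      exact hk ⟨⟨k, h0⟩, rfl⟩
    simp [energy, this]

theorem summable_energy (h : RandomDatum μ s g lam) : Summable (energy lam) :=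
  summable_energy_of_weighted (by linarith [h.one_lt]) h.summable_weighted_energy

/-- The weighted sum of the second order coefficients is bounded uniformly in time. -/
theorem exists_tsum_secondOrder_le (h : RandomDatum μ s g lam) : ∃ K : ℝ, ∀ t : ℝ,
    Summable (fun p : Freq × Freq =>
      √(|(p.1.1.1 : ℝ) * (p.2.1.1 : ℝ)|) * (size p.1 * size p.2) ^ s *
        |secondOrder μ g lam p.1 p.2 t|) ∧
    ∑' p : Freq × Freq, √(|(p.1.1.1 : ℝ) * (p.2.1.1 : ℝ)|) * (size p.1 * size p.2) ^ s *
        |secondOrder μ g lam p.1 p.2 t| ≤ K := by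
  have hs := h.one_lt
  have hW := h.summable_weighted_energy
  set B := 2 * mom2 μ g ^ 2 + 4 * |mom4 μ g - 2 * mom2 μ g ^ 2|
  set b : ℤ × ℤ → ℝ := fun n => B * (size n ^ (2 * s) * energy lam n * (∑' k, energy lam k)
    + size n ^ (2 * s) * energyConv lam n) with hb
  have hbs : Summable fun n : Freq => b n :=
    (((hW.mul_right _).add (summable_weighted_energyConv (by linarith) hW)).mul_left B).comp_injective
      Subtype.val_injective
  refine ⟨∑' n : Freq, b n, fun t => ?_⟩
  have hinj : Function.Injective (fun n : Freq => (n, n)) := fun n m hnm => (Prod.mk.inj hnm).1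
  set f : Freq × Freq → ℝ := fun p =>
    √(|(p.1.1.1 : ℝ) * (p.2.1.1 : ℝ)|) * (size p.1 * size p.2) ^ s *
        |secondOrder μ g lam p.1 p.2 t| with hf
  -- F vanishes off the diagonal, so the double sum is a sum over n.
  have hoff : ∀ p : Freq × Freq, p ∉ Set.range (fun n : Freq => (n, n)) → f p = 0 := by
    rintro ⟨n, m⟩ hp
    have hnm : (n : ℤ × ℤ) ≠ m := fun e => hp ⟨n, by rw [Subtype.ext e]⟩
    simp only [hf]
    rw [h.secondOrder_eq n.2, if_neg hnm, abs_zero, mul_zero]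
  have hle : ∀ n : Freq, f (n, n) ≤ b n := fun n => by
    simp only [hf, hb]
    have hsz : (size n * size n) ^ s = size n ^ (2 * s) := by
      rw [← sq, ← Real.rpow_two, ← Real.rpow_mul (size_nonneg _)]
    rw [h.secondOrder_eq n.2, if_pos rfl, abs_mul_self, Real.sqrt_mul_self_eq_abs, hsz]
    have h0 : 0 ≤ size n ^ (2 * s) := Real.rpow_nonneg (size_nonneg _) _
    calc _ = size n ^ (2 * s) * (|(n.1.1 : ℝ)| * |diagF lam (mom2 μ g) (mom4 μ g) n t|) := by ring
      _ ≤ size n ^ (2 * s)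
          * (B * (energy lam n * ∑' k, energy lam k + energyConv lam n)) :=
        mul_le_mul_of_nonneg_left (abs_mul_abs_diagF_le h.summable_energy _ _ n.2 t) h0
      _ = _ := by ring
  have hf0 : ∀ p, 0 ≤ f p := fun p => mul_nonneg (mul_nonneg (Real.sqrt_nonneg _)
    (Real.rpow_nonneg (mul_nonneg (size_nonneg _) (size_nonneg _)) _)) (abs_nonneg _)
  have hdiag : Summable fun n : Freq => f (n, n) := hbs.of_nonneg_of_le (fun _ => hf0 _) hle
  refine ⟨(hinj.summable_iff hoff).1 hdiag, ?_⟩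
  rw [← hinj.tsum_eq (Function.support_subset_iff'.2 hoff)]
  exact hdiag.tsum_le_tsum hle hbs

end RandomDatum

/-! ### The diagonal second order moment -/

/-- Splits the weight into its value for complex Gaussian variables, where m₄ = 2m₂², and the
defect, present only when the two frequencies coincide. -/
theorem pairWeight_eq {Ω : Type*} [MeasurableSpace Ω] (μ : Measure Ω) (g : ℤ × ℤ → Ω → ℂ)
    (lam : ℤ × ℤ → ℂ) (p q : ℤ × ℤ) :
    pairWeight μ g lam p q = 2 * mom2 μ g ^ 2 * (‖lam p‖ ^ 2 * ‖lam q‖ ^ 2)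
      + if p = q then (mom4 μ g - 2 * mom2 μ g ^ 2) * ‖lam p‖ ^ 4 else 0 := by
  rw [pairWeight]
  split_ifs with hpq
  · rw [hpq]; ring
  · ring

theorem hasSum_half_term (n : ℤ × ℤ) (lam : ℤ × ℤ → ℂ) (t : ℝ) :
    HasSum (fun k : ℤ × ℤ => if k = n - k then
        (n.1 : ℝ) / 2 * osc n k (n - k) t * ‖lam k‖ ^ 4 else 0)
      (if Even n.1 ∧ Even n.2 then
        (n.1 : ℝ) / 2 * osc n (n.1 / 2, n.2 / 2) (n.1 / 2, n.2 / 2) t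
          * ‖lam (n.1 / 2, n.2 / 2)‖ ^ 4 else 0) := by
  split_ifs with he
  · obtain ⟨⟨p, hp⟩, ⟨q, hq⟩⟩ := he
    have hk : ((n.1 / 2, n.2 / 2) : ℤ × ℤ) = (p, q) := by
      ext <;> simp <;> omega
    have hl : n - (p, q) = (p, q) := by ext <;> simp <;> omega
    rw [hk]
    convert! hasSum_single (p, q) (f := fun k : ℤ × ℤ => if k = n - k then
        (n.1 : ℝ) / 2 * osc n k (n - k) t * ‖lam k‖ ^ 4 else 0) (fun k hkp => ?_) using 1
    · rw [hl, if_pos rfl]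
    · refine if_neg fun h0 => hkp ?_
      have h1 := congrArg Prod.fst h0
      have h2 := congrArg Prod.snd h0
      simp only [Prod.fst_sub, Prod.snd_sub] at h1 h2
      ext <;> simp <;> omega
  · convert! hasSum_zero using 1
    funext k
    refine if_neg fun h0 => he ?_
    have h1 := congrArg Prod.fst h0
    have h2 := congrArg Prod.snd h0
    simp only [Prod.fst_sub, Prod.snd_sub] at h1 h2
    exact ⟨⟨k.1, by omega⟩, ⟨k.2, by omega⟩⟩

namespace RandomDatum

variable {Ω : Type*} [MeasurableSpace Ω] {μ : Measure Ω} [IsProbabilityMeasure μ] {s : ℝ}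
  {g : ℤ × ℤ → Ω → ℂ} {lam : ℤ × ℤ → ℂ}

/-- The diagonal second order moment of the expansion in powers of `ε`. -/
theorem re_integral_second_order (h : RandomDatum μ s g lam) {ε : ℝ} (hε : 0 ≤ ε) (t : ℝ)
    {n : ℤ × ℤ} (hn : n.1 ≠ 0) :
    (∫ ω, order1 ε (datum g lam ω) t n * conj (order1 ε (datum g lam ω) t n) ∂μ).re
      + 2 * (∫ ω, order2 ε (datum g lam ω) t n * conj (datum g lam ω n) ∂μ).re
      = ε ^ 2 * diagF lam (mom2 μ g) (mom4 μ g) n t := by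
  have h1 := h.hasSum_integral_order1_mul_conj_self hε t hn
  have h2 := h.hasSum_integral_order2_mul_conj hε t hn
  -- The second order correlation occurs twice: one copy is kept and the other is reindexed by k ↦ n
  -- - k, which produces the coefficients k₁ and l₁ of the series.
  have h3 := (Equiv.subLeft n).hasSum_iff.2 h2
  have hser := (summable_seriesTerm_of_energy h.summable_energy hn t).1.hasSum
  have d1 := hasSum_half_term n lam t
  -- The defect of the two copies sits where the paired frequencies n and k - n, respectively n and
  -- -k, coincide, that is k = 2n and k = -n. Each gives n₁·`osc`, together the coefficient 2n₁.
  have d2 := hasSum_single (n + n) (f := fun k : ℤ × ℤ => if k = n + n then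
    (k.1 : ℝ) / 2 * osc n k (n - k) t * ‖lam n‖ ^ 4 else 0) fun k hk => if_neg hk
  have d3 := hasSum_single (-n) (f := fun k : ℤ × ℤ => if k = -n then
    ((n - k).1 : ℝ) / 2 * osc n k (n - k) t * ‖lam n‖ ^ 4 else 0) fun k hk => if_neg hk
  have hL := (h1.add h2).add h3
  have hR := (hser.mul_left (ε ^ 2 * (n.1 * mom2 μ g ^ 2))).add
    (((d2.add d3).sub d1).mul_left (ε ^ 2 * (n.1 * (mom4 μ g - 2 * mom2 μ g ^ 2))))
  have hval : ∀ {x y : ℝ} {p q : ℤ × ℤ → ℝ}, HasSum p x → HasSum q y → (∀ k, p k = q k) → x = y :=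
    fun hp hq hpq => hp.unique ((funext hpq : _ = _) ▸ hq)
  have key := hval hL hR fun k => ?_
  · rw [if_pos rfl, if_pos rfl, sub_neg_eq_add, show n - (n + n) = -n by abel,
      osc_comm n (n + n)] at key
    rw [diagF]
    push_cast [Prod.fst_add] at key
    linear_combination key
  · simp only [Function.comp_apply, Equiv.subLeft_apply, sub_sub_cancel, seriesTerm]
    by_cases hk : k.1 ≠ 0 ∧ (n - k).1 ≠ 0
    · have hl1 : ‖lam (k - n)‖ = ‖lam (n - k)‖ := by rw [← neg_sub n k, h.norm_lam_neg hk.2]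
      have hl2 : ‖lam (n - k - n)‖ = ‖lam k‖ := by
        rw [show n - k - n = -k by abel, h.norm_lam_neg hk.1]
      have c1 : (n = k - n) ↔ (k = n + n) :=
        ⟨fun e => by nth_rewrite 1 [e]; abel, fun e => by rw [e]; abel⟩
      have c2 : (n = n - k - n) ↔ (k = -n) :=
        ⟨fun e => by nth_rewrite 1 [e]; abel, fun e => by rw [e]; abel⟩
      rw [if_pos hk, if_pos hk, if_pos ⟨hk.2, hk.1⟩, if_pos hk, pairWeight_eq, pairWeight_eq,
        pairWeight_eq, hl1, hl2, osc_comm n (n - k) k]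
      simp only [c1, c2]
      have hfst : (n.1 : ℝ) = (k.1 : ℝ) + ((n - k).1 : ℝ) := by push_cast [Prod.fst_sub]; ring
      split_ifs <;> ring
    · have hk' : ¬((n - k).1 ≠ 0 ∧ k.1 ≠ 0) := fun e => hk ⟨e.2, e.1⟩
      rw [if_neg hk, if_neg hk, if_neg hk', if_neg hk, if_neg, if_neg, if_neg]
      · ring
      · rintro e
        have := congrArg Prod.fst e
        simp only [Prod.fst_sub] at this hk
        omega
      · rintro e
        have := congrArg Prod.fst e
        simp only [Prod.fst_sub, Prod.fst_neg] at this hk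
        omega
      · rintro e
        have := congrArg Prod.fst e
        simp only [Prod.fst_sub, Prod.fst_add] at this hk
        omega

end RandomDatum

/-! ### The expansion of the correlations -/

/-- The term of order `j` of the expansion of the interaction representation, for `j ≤ 3`. -/
def expansionTerm (ε : ℝ) : ℕ → (ℤ × ℤ → ℂ) → ℝ → ℤ × ℤ → ℂ
  | 0 => fun a _ => a
  | 1 => order1 ε
  | 2 => order2 ε
  | 3 => order3 ε
  | _ => fun _ _ _ => 0

theorem measurableFamily_expansionTerm (ε : ℝ) : ∀ j, MeasurableFamily (expansionTerm ε j)
  | 0 => .datum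
  | 1 => .order1 ε
  | 2 => .order2 ε
  | 3 => .order3 ε
  | _ + 4 => fun _ => measurable_const

theorem equivariant_expansionTerm {χ : ℤ × ℤ → ℂ} {c : ℂ} (hχ : ∀ n k, χ k * χ (n - k) = χ n)
    (ε : ℝ) : ∀ j, Equivariant χ c (j + 1) (expansionTerm ε j)
  | 0 => .datum
  | 1 => .order1 hχ ε
  | 2 => .order2 hχ ε
  | 3 => .order3 hχ ε
  | _ + 4 => fun _ _ _ => by simp [expansionTerm]

theorem wt_le_min_rpow {s : ℝ} (hs : 0 ≤ s) {n m : ℤ × ℤ} (hn : n.1 ≠ 0) (hm : m.1 ≠ 0) :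
    wt s n ≤ min (size n) (size m) ^ (-s) :=
  Real.rpow_le_rpow_of_nonpos (lt_min (by linarith [one_le_size hn]) (by linarith [one_le_size hm]))
    (min_le_left _ _) (by linarith)

theorem abs_fst_mul_wt_le_one {s : ℝ} (hs : 1 ≤ s) {n : ℤ × ℤ} (hn : n.1 ≠ 0) :
    |(n.1 : ℝ)| * wt s n ≤ 1 := by
  have h1 := one_le_size hn
  calc |(n.1 : ℝ)| * wt s n ≤ size n * size n ^ (-s) :=
        mul_le_mul_of_nonneg_right (abs_fst_le_size n) (wt_nonneg s n)
    _ = size n ^ (1 - s) := by rw [sub_eq_add_neg, Real.rpow_add (by linarith), Real.rpow_one]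
    _ ≤ 1 := Real.rpow_le_one_of_one_le_of_nonpos h1 (by linarith)

/-- Two regimes. For |t| ≥ 1 the product of sizes ε⁴(1+|t|)² is at most 2ε⁴|t|(1+|t|)^{7/5}. For |t|
≤ 1 the vanishing of r at time 0 gives |t| and a loss |m₁|, paid by |m|^{-s} since s > 1; the decay
in the bound then comes from the factor f. -/
theorem HasOrder.norm_mul_norm_le {s ε C t : ℝ} {i j : ℕ} {f r : ℝ → ℤ × ℤ → ℂ} (hs : 1 < s)
    (hC : 0 ≤ C) (hε : 0 ≤ ε) (hij : i + j = 4) (hf : HasOrder s |t| ε i C f)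
    (hr : HasOrder s |t| ε j C r) {n m : ℤ × ℤ} (hn : n.1 ≠ 0) (hm : m.1 ≠ 0) (h0 : r 0 m = 0) :
    ‖f t n‖ * ‖r t m‖ ≤ 4 * C ^ 2 * ε ^ 4
      * (min (size n) (size m) ^ (-s) * (|t| * (1 + |t|) ^ (7 / 5 : ℝ))) := by
  have ht : t ∈ Icc (-|t|) |t| := abs_le.1 le_rfl
  have ht0 := abs_nonneg t
  set ρ := √(1 + |t|) with hρ
  have hρ1 : 1 ≤ ρ := Real.one_le_sqrt.2 (by linarith)
  have hρ2 : ρ ^ 2 = 1 + |t| := Real.sq_sqrt (by linarith)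
  have hf1 := hf.norm_le ht n
  have hmin := wt_le_min_rpow (by linarith : 0 ≤ s) hn hm
  have hwn := wt_nonneg s n
  have hwm := wt_nonneg s m
  have hmin0 : 0 ≤ min (size n) (size m) ^ (-s) := hwn.trans hmin
  have hp : 0 ≤ (1 + |t|) ^ (7 / 5 : ℝ) := Real.rpow_nonneg (by linarith) _
  have hpow : (ε * ρ) ^ i * (ε * ρ) ^ j = ε ^ 4 * (1 + |t|) ^ 2 := by
    rw [← pow_add, hij, mul_pow, ← hρ2]; ring
  rcases le_total 1 |t| with h1 | h1
  · have hr1 := hr.norm_le ht m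
    have hwm1 := wt_le_one (by linarith : 0 ≤ s) hm
    have hb : (1 + |t|) ^ 2 ≤ 2 * (|t| * (1 + |t|) ^ (7 / 5 : ℝ)) := by
      have e1 : (1 + |t|) ^ 2 = (1 + |t|) ^ (7 / 5 : ℝ) * (1 + |t|) ^ (3 / 5 : ℝ) := by
        rw [← Real.rpow_add (by linarith), ← Real.rpow_two]; norm_num
      have e2 : (1 + |t|) ^ (3 / 5 : ℝ) ≤ 1 + |t| := by
        conv_rhs => rw [← Real.rpow_one (1 + |t|)]
        exact Real.rpow_le_rpow_of_exponent_le (by linarith) (by norm_num)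
      rw [e1]
      nlinarith
    calc ‖f t n‖ * ‖r t m‖ ≤ (C * (ε * ρ) ^ i * wt s n) * (C * (ε * ρ) ^ j * wt s m) := by
          gcongr
      _ = C ^ 2 * ((ε * ρ) ^ i * (ε * ρ) ^ j) * (wt s n * wt s m) := by ring
      _ ≤ C ^ 2 * (ε ^ 4 * (2 * (|t| * (1 + |t|) ^ (7 / 5 : ℝ))))
          * (min (size n) (size m) ^ (-s) * 1) := by
          rw [hpow]; gcongr
      _ = 2 * (C ^ 2 * ε ^ 4
          * (min (size n) (size m) ^ (-s) * (|t| * (1 + |t|) ^ (7 / 5 : ℝ)))) := by ring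
      _ ≤ 4 * (C ^ 2 * ε ^ 4
          * (min (size n) (size m) ^ (-s) * (|t| * (1 + |t|) ^ (7 / 5 : ℝ)))) := by
          gcongr; norm_num
      _ = _ := by ring
  · have hr1 := hr.norm_le_of_zero ht0 hm h0 ht
    have hmw := abs_fst_mul_wt_le_one hs.le hm
    have hp1 : 1 ≤ (1 + |t|) ^ (7 / 5 : ℝ) := Real.one_le_rpow (by linarith) (by norm_num)
    calc ‖f t n‖ * ‖r t m‖ ≤ (C * (ε * ρ) ^ i * wt s n)
          * (|(m.1 : ℝ)| * (C * (ε * ρ) ^ j / ρ * wt s m) * |t|) := by gcongr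
      _ ≤ (C * (ε * ρ) ^ i * wt s n) * (|(m.1 : ℝ)| * (C * (ε * ρ) ^ j * wt s m) * |t|) := by
          gcongr
          exact div_le_self (by positivity) hρ1
      _ = C ^ 2 * ((ε * ρ) ^ i * (ε * ρ) ^ j) * (wt s n * ((|(m.1 : ℝ)| * wt s m) * |t|)) := by
          ring
      _ ≤ C ^ 2 * (ε ^ 4 * (1 + 1) ^ 2) * (min (size n) (size m) ^ (-s) * (1 * |t|)) := by
          rw [hpow]; gcongr
      _ = 4 * C ^ 2 * ε ^ 4 * (min (size n) (size m) ^ (-s) * (|t| * 1)) := by ring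
      _ ≤ _ := by gcongr

/-- The expansion of the products of two coefficients of a solution, path by path. -/
theorem exists_norm_mul_sub_expansion_le {s : ℝ} (hs : 1 < s) :
    ∃ C T₁ ε₁ : ℝ, 0 < C ∧ 0 < T₁ ∧ 0 < ε₁ ∧ ∀ (ε T : ℝ) (a : ℤ × ℤ → ℂ) (v : ℝ → ℤ × ℤ → ℂ),
      0 ≤ ε → ε < ε₁ → T * ε ^ (5 / 3 : ℝ) ≤ T₁ → Bdd s (embConst s) a →
      IsInteraction s ε T a v → ∀ t ∈ Icc (-T) T, ∀ n m : ℤ × ℤ, n.1 ≠ 0 → m.1 ≠ 0 →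
        (∀ j < 4, ‖expansionTerm ε j a t n‖ ≤ C) ∧ ‖v t n‖ ≤ C ∧
        ‖v t n * conj (v t m) - ∑ i ∈ Finset.range 4, ∑ j ∈ Finset.range (4 - i),
            expansionTerm ε i a t n * conj (expansionTerm ε j a t m)‖
          ≤ 20 * C ^ 2 * ε ^ 4
            * (min (size n) (size m) ^ (-s) * (|t| * (1 + |t|) ^ (7 / 5 : ℝ))) := by
  have hM := one_le_embConst s
  set M := embConst s
  obtain ⟨C₀, hC₀, hC⟩ := exists_hasOrder_expansion hs hM
  set K : ℝ := 2 ^ (s + 1) * M with hK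
  have hK1 : 1 ≤ K := one_le_mul_of_one_le_of_one_le
    (Real.one_le_rpow one_le_two (by linarith)) hM
  -- The thresholds are the two smallness conditions of the bootstrap, with K = 2^(s+1)·M.
  refine ⟨C₀ + 1, 1 / (32 * K ^ 2), 1 / (16 * K), by positivity, by positivity, by positivity, ?_⟩
  intro ε T a v hε hε1 hT1 ha hv t ht n m hn hm
  have hC := fun L h1 h2 h3 h4 => hC ε T L a v hε h1 h2 h3 ha hv h4
  have hT : 0 ≤ T := by linarith [ht.1, ht.2]
  have hL := abs_nonneg t
  have hLT : |t| ≤ T := abs_le.2 ht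
  rw [lt_div_iff₀ (by positivity)] at hε1
  rw [le_div_iff₀ (by positivity)] at hT1
  have hε1' : ε ≤ 1 / 16 := by nlinarith
  -- The estimates hold up to times of order ε^{-2}; the restriction to ε^{-5/3} is stronger because
  -- ε ≤ 1.
  have hεT : ε ^ 2 * T ≤ T * ε ^ (5 / 3 : ℝ) := by
    have e1 : ε ^ 2 = ε ^ (5 / 3 : ℝ) * ε ^ (1 / 3 : ℝ) := by
      rw [← Real.rpow_add_of_nonneg hε (by norm_num) (by norm_num), ← Real.rpow_two]; norm_num
    have e2 : ε ^ (1 / 3 : ℝ) ≤ 1 := Real.rpow_le_one hε (by linarith) (by norm_num)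
    have e3 : 0 ≤ ε ^ (5 / 3 : ℝ) := Real.rpow_nonneg hε _
    rw [e1]
    nlinarith [mul_nonneg hT e3]
  have hεT0 : 0 ≤ T * ε ^ (5 / 3 : ℝ) := mul_nonneg hT (Real.rpow_nonneg hε _)
  have hεT2 : T * ε ^ (5 / 3 : ℝ) ≤ 1 / 32 := by
    have hK2 : 1 ≤ K ^ 2 := one_le_pow₀ hK1
    nlinarith
  have hb := hv.bdd hs hε hM ha (by rw [mul_assoc ε]; linarith)
    (by
      calc 32 * (ε ^ 2 * T) * (2 ^ (s + 1) * M) ^ 2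
          ≤ 32 * (T * ε ^ (5 / 3 : ℝ)) * (2 ^ (s + 1) * M) ^ 2 := by gcongr
        _ ≤ 1 := by linarith) hT
  have hδ : ε * √(1 + |t|) ≤ 1 := by
    refine abs_le_one_iff_mul_self_le_one.2 ?_ |> (le_abs_self _).trans
    have e1 : √(1 + |t|) * √(1 + |t|) = 1 + |t| := Real.mul_self_sqrt (by linarith)
    have e2 : ε ^ 2 * |t| ≤ ε ^ 2 * T := by gcongr
    calc ε * √(1 + |t|) * (ε * √(1 + |t|)) = ε ^ 2 * (√(1 + |t|) * √(1 + |t|)) := by ring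
      _ = ε ^ 2 + ε ^ 2 * |t| := by rw [e1]; ring
      _ ≤ 1 := by nlinarith
  have hδ0 : 0 ≤ ε * √(1 + |t|) := by positivity
  obtain ⟨ov, oa, o1, o2, o3, r1, r2, r3, r4⟩ := hC |t| hL hLT hδ fun τ hτ =>
    hb τ (Icc_subset_Icc (by linarith) hLT hτ)
  have hCC : C₀ ≤ C₀ + 1 := by linarith
  have ht' : t ∈ Icc (-|t|) |t| := abs_le.1 le_rfl
  have hsmall : ∀ {j : ℕ} {f : ℝ → ℤ × ℤ → ℂ}, HasOrder s |t| ε j C₀ f → ‖f t n‖ ≤ C₀ + 1 :=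
    fun {j f} hf => calc
      ‖f t n‖ ≤ C₀ * (ε * √(1 + |t|)) ^ j * wt s n := hf.norm_le ht' n
      _ ≤ C₀ * 1 * 1 := by
        have := wt_le_one (by linarith : 0 ≤ s) hn
        have := wt_nonneg s n
        have := pow_le_one₀ (n := j) hδ0 hδ
        gcongr
      _ ≤ C₀ + 1 := by linarith
  refine ⟨fun j hj => ?_, hsmall ov, ?_⟩
  · interval_cases j
    exacts [hsmall oa, hsmall o1, hsmall o2, hsmall o3]
  · have z1 : ∀ k, rem1 a v 0 k = 0 := fun k => by rw [rem1, hv.initial, sub_self]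
    have z2 : ∀ k, rem2 ε a v 0 k = 0 := fun k => by rw [rem2, z1, order1, IsPath.duh_zero, sub_zero]
    have z3 : ∀ k, rem3 ε a v 0 k = 0 := fun k => by
      rw [rem3, z2, order2, IsPath.duh_zero, IsPath.duh_zero]; simp
    have z4 : ∀ k, rem4 ε a v 0 k = 0 := fun k => by
      rw [rem4, z3, order3, IsPath.duh_zero, IsPath.duh_zero, IsPath.duh_zero]; simp
    -- For each i ≤ 3, the terms of order less than 4 - i subtracted from v_m leave the remainder of
    -- order 4 - i. Together with `rem4` at n, every product has total order exactly 4.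
    have hexp : v t n * conj (v t m) - ∑ i ∈ Finset.range 4, ∑ j ∈ Finset.range (4 - i),
            expansionTerm ε i a t n * conj (expansionTerm ε j a t m)
        = a n * conj (rem4 ε a v t m) + order1 ε a t n * conj (rem3 ε a v t m)
          + order2 ε a t n * conj (rem2 ε a v t m) + order3 ε a t n * conj (rem1 a v t m)
          + rem4 ε a v t n * conj (v t m) := by
      simp only [Finset.sum_range_succ, Finset.sum_range_zero, expansionTerm, rem4, rem3, rem2,
        rem1, map_sub, Nat.sub_zero, Nat.reduceSub]
      ring
    rw [hexp]
    set B := min (size n) (size m) ^ (-s) * (|t| * (1 + |t|) ^ (7 / 5 : ℝ)) with hB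
    have hB0 : 0 ≤ B := mul_nonneg (Real.rpow_nonneg (le_min (size_nonneg n) (size_nonneg m)) _)
      (mul_nonneg hL (Real.rpow_nonneg (by linarith) _))
    have b1 := HasOrder.norm_mul_norm_le hs hC₀ hε (by norm_num) oa r4 hn hm (z4 m)
    have b2 := HasOrder.norm_mul_norm_le hs hC₀ hε (by norm_num) o1 r3 hn hm (z3 m)
    have b3 := HasOrder.norm_mul_norm_le hs hC₀ hε (by norm_num) o2 r2 hn hm (z2 m)
    have b4 := HasOrder.norm_mul_norm_le hs hC₀ hε (by norm_num) o3 r1 hn hm (z1 m)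
    have b5 := HasOrder.norm_mul_norm_le hs hC₀ hε (by norm_num) ov r4 hm hn (z4 n)
    rw [min_comm, mul_comm ‖v t m‖] at b5
    rw [← hB] at b1 b2 b3 b4 b5
    have hD : 4 * C₀ ^ 2 * ε ^ 4 * B * 5 ≤ 20 * (C₀ + 1) ^ 2 * ε ^ 4 * B := by
      calc 4 * C₀ ^ 2 * ε ^ 4 * B * 5 = 20 * C₀ ^ 2 * ε ^ 4 * B := by ring
        _ ≤ _ := by gcongr
    refine le_trans ?_ hD
    refine (norm_add_le _ _).trans ?_
    refine (add_le_add_left ((norm_add_le _ _).trans (add_le_add_left ((norm_add_le _ _).trans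
      (add_le_add_left (norm_add_le _ _) _)) _)) _).trans ?_
    simp only [norm_mul, RCLike.norm_conj]
    linarith

namespace RandomDatum

variable {Ω : Type*} [MeasurableSpace Ω] {μ : Measure Ω} [IsProbabilityMeasure μ] {s : ℝ}
  {g : ℤ × ℤ → Ω → ℂ} {lam : ℤ × ℤ → ℂ}

/-- The expectation of the terms of order at most three. -/
theorem sum_integral_expansionTerm (h : RandomDatum μ s g lam) {ε : ℝ} (hε : 0 ≤ ε) (t : ℝ)
    {n : ℤ × ℤ} (hn : n.1 ≠ 0) (m : ℤ × ℤ) :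
    ∑ i ∈ Finset.range 4, ∑ j ∈ Finset.range (4 - i),
      ∫ ω, expansionTerm ε i (datum g lam ω) t n * conj (expansionTerm ε j (datum g lam ω) t m) ∂μ
      = (if n = m then ((mom2 μ g * ‖lam n‖ ^ 2 : ℝ) : ℂ) else 0)
        + (ε : ℂ) ^ 2 * (secondOrder μ g lam n m t : ℂ) := by
  have hz : ∀ i j, (n ≠ m ∨ Odd (i + 1 + (j + 1))) →
      ∫ ω, expansionTerm ε i (datum g lam ω) t n * conj (expansionTerm ε j (datum g lam ω) t m) ∂μ
        = 0 := fun i j hij =>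
    h.integral_mul_conj_eq_zero (measurableFamily_expansionTerm ε i)
      (measurableFamily_expansionTerm ε j) (fun χ c hχ => equivariant_expansionTerm hχ ε i)
      (fun χ c hχ => equivariant_expansionTerm hχ ε j) t hij
  rw [h.secondOrder_eq hn]
  by_cases hnm : n = m
  · subst hnm
    rw [if_pos rfl, if_pos rfl]
    have hre := h.re_integral_second_order hε t hn
    simp only [Finset.sum_range_succ, Finset.sum_range_zero, Nat.sub_zero, Nat.reduceSub, zero_add]
    -- The products of odd total order vanish. Orders (0,0), (1,1), (2,0) and (0,2) survive, the
    -- last two being conjugate.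
    rw [hz 0 1 (.inr (by decide)), hz 0 3 (.inr (by decide)), hz 1 0 (.inr (by decide)),
      hz 1 2 (.inr (by decide)), hz 2 1 (.inr (by decide)), hz 3 0 (.inr (by decide))]
    have h00 : ∫ ω, expansionTerm ε 0 (datum g lam ω) t n
        * conj (expansionTerm ε 0 (datum g lam ω) t n) ∂μ = ((mom2 μ g * ‖lam n‖ ^ 2 : ℝ) : ℂ) := by
      rw [← h.integral_norm_datum_sq hn, ← integral_complex_ofReal]
      refine integral_congr_ae (ae_of_all _ fun ω => ?_)
      simp only [expansionTerm, Complex.mul_conj']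
      push_cast; rfl
    have hconj : ∀ F G : Ω → ℂ, ∫ ω, G ω * conj (F ω) ∂μ = conj (∫ ω, F ω * conj (G ω) ∂μ) :=
      fun F G => by
        rw [← integral_conj]
        congr 1
        funext ω
        rw [map_mul, Complex.conj_conj, mul_comm]
    set Z := ∫ ω, order2 ε (datum g lam ω) t n * conj (datum g lam ω n) ∂μ
    have h20 : ∫ ω, expansionTerm ε 2 (datum g lam ω) t n
        * conj (expansionTerm ε 0 (datum g lam ω) t n) ∂μ = Z := rfl
    have h02 : ∫ ω, expansionTerm ε 0 (datum g lam ω) t n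
        * conj (expansionTerm ε 2 (datum g lam ω) t n) ∂μ = conj Z :=
      hconj (fun ω => order2 ε (datum g lam ω) t n) (fun ω => datum g lam ω n)
    set Y := ∫ ω, order1 ε (datum g lam ω) t n * conj (order1 ε (datum g lam ω) t n) ∂μ
    have h11 : ∫ ω, expansionTerm ε 1 (datum g lam ω) t n
        * conj (expansionTerm ε 1 (datum g lam ω) t n) ∂μ = Y := rfl
    have hY : (Y.re : ℂ) = Y := Complex.conj_eq_iff_re.1
      (hconj (fun ω => order1 ε (datum g lam ω) t n) (fun ω => order1 ε (datum g lam ω) t n)).symm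
    have hZ : Z + conj Z = ((2 * Z.re : ℝ) : ℂ) := Complex.add_conj Z
    rw [h00, h20, h02, h11]
    have hre' : (ε : ℂ) ^ 2 * (diagF lam (mom2 μ g) (mom4 μ g) n t : ℂ)
        = Y + ((2 * Z.re : ℝ) : ℂ) := by
      rw [← hY]
      exact_mod_cast hre.symm
    rw [hre', ← hZ]
    ring
  · rw [if_neg hnm, if_neg hnm, Complex.ofReal_zero, mul_zero, add_zero]
    exact Finset.sum_eq_zero fun i _ => Finset.sum_eq_zero fun j _ => hz i j (.inl hnm)

end RandomDatum

/-- The expansion of the correlations of a random solution. -/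
theorem exists_norm_integral_coeff_sub_le {s : ℝ} (hs : 1 < s) :
    ∃ C T₁ ε₁ : ℝ, 0 < C ∧ 0 < T₁ ∧ 0 < ε₁ ∧ ∀ {Ω : Type*} [MeasurableSpace Ω] {μ : Measure Ω}
      [IsProbabilityMeasure μ] {g : ℤ × ℤ → Ω → ℂ} {lam : ℤ × ℤ → ℂ}, RandomDatum μ s g lam →
      ∀ {ε : ℝ}, 0 ≤ ε → ε < ε₁ → ∀ {T : ℝ}, 0 < T → T * ε ^ (5 / 3 : ℝ) ≤ T₁ →
      ∀ {u : ℝ → Ω → ℝ × ℝ → ℝ}, IsRandomSolution μ s ε T g lam u →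
      ∀ {n m : ℤ × ℤ}, n.1 ≠ 0 → m.1 ≠ 0 → ∀ t ∈ Icc (-T) T,
        Integrable (fun ω => coeff (u t ω) n * conj (coeff (u t ω) m)) μ ∧
        ‖∫ ω, coeff (u t ω) n * conj (coeff (u t ω) m) ∂μ
          - ((if n = m then (((∫ ω, ‖g n ω‖ ^ 2 ∂μ) * ‖lam n‖ ^ 2 : ℝ) : ℂ) else 0)
            + (ε : ℂ) ^ 2 * (secondOrder μ g lam n m t : ℂ))‖
          ≤ C * ε ^ 4 * (min (size n) (size m) ^ (-s) * (|t| * (1 + |t|) ^ (7 / 5 : ℝ))) := by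
  obtain ⟨C, T₁, ε₁, hC, hT₁, hε₁, hmain⟩ := exists_norm_mul_sub_expansion_le hs
  refine ⟨20 * C ^ 2, T₁, ε₁, by positivity, hT₁, hε₁, ?_⟩
  intro Ω _ μ _ g lam h ε hε hε1 T hT hT1 u hu n m hn hm t ht
  have hpath : ∀ᵐ ω ∂μ, Bdd s (embConst s) (datum g lam ω) ∧
      IsInteraction s ε T (datum g lam ω) (interaction (fun τ => u τ ω)) := by
    filter_upwards [h.ae_bdd, hu.path] with ω h1 h2
    exact ⟨h1, h2.isInteraction hs hT.le⟩
  have hall := hpath.mono fun ω hω (p q : ℤ × ℤ) (hp : p.1 ≠ 0) (hq : q.1 ≠ 0) =>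
    hmain ε T _ _ hε hε1 hT1 hω.1 hω.2 t ht p q hp hq
  set v : Ω → ℤ × ℤ → ℂ := fun ω => interaction (fun τ => u τ ω) t with hv
  set θ : ℤ × ℤ → ℂ := fun p => Complex.exp ((-(disp p * t) : ℝ) * Complex.I) with hθ
  have hθ1 : ∀ p, ‖θ p‖ = 1 := fun p => Complex.norm_exp_ofReal_mul_I _
  have hvu : ∀ ω p, v ω p = θ p * coeff (u t ω) p := fun ω p => rfl
  have hum : ∀ p : ℤ × ℤ, p.1 ≠ 0 → AEStronglyMeasurable (fun ω => coeff (u t ω) p) μ :=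
    fun p hp => (hu.measurable_coeff t ht p hp).aestronglyMeasurable
  have hconj : ∀ {F : Ω → ℂ}, AEStronglyMeasurable F μ →
      AEStronglyMeasurable (fun ω => conj (F ω)) μ := fun hF =>
    Complex.continuous_conj.comp_aestronglyMeasurable hF
  have hub : ∀ p : ℤ × ℤ, p.1 ≠ 0 → ∀ᵐ ω ∂μ, ‖coeff (u t ω) p‖ ≤ C := fun p hp => by
    filter_upwards [hall] with ω hω
    have := (hω p p hp hp).2.1
    rwa [norm_interaction] at this
  have hui : Integrable (fun ω => coeff (u t ω) n * conj (coeff (u t ω) m)) μ := by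
    refine Integrable.of_bound ((hum n hn).mul (hconj (hum m hm))) (C * C) ?_
    filter_upwards [hub n hn, hub m hm] with ω h1 h2
    rw [norm_mul, RCLike.norm_conj]
    gcongr
  refine ⟨hui, ?_⟩
  have hvv : ∀ ω, v ω n * conj (v ω m)
      = θ n * conj (θ m) * (coeff (u t ω) n * conj (coeff (u t ω) m)) := fun ω => by
    rw [hvu, hvu, map_mul]; ring
  have hvi : Integrable (fun ω => v ω n * conj (v ω m)) μ := by
    simp_rw [hvv]; exact hui.const_mul _
  have hterm : ∀ j p, Measurable (fun ω => expansionTerm ε j (datum g lam ω) t p) := fun j p =>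
    ((measurableFamily_expansionTerm ε j).apply t p).comp h.measurable_datum
  have hti : ∀ i < 4, ∀ j < 4, Integrable (fun ω => expansionTerm ε i (datum g lam ω) t n
      * conj (expansionTerm ε j (datum g lam ω) t m)) μ := fun i hi j hj => by
    refine Integrable.of_bound ((hterm i n).aestronglyMeasurable.mul
      (hconj (hterm j m).aestronglyMeasurable)) (C * C) ?_
    filter_upwards [hall] with ω hω
    rw [norm_mul, RCLike.norm_conj]
    have h1 := (hω n m hn hm).1 i hi
    have h2 := (hω m n hm hn).1 j hj
    gcongr
  have hsum : ∫ ω, ∑ i ∈ Finset.range 4, ∑ j ∈ Finset.range (4 - i),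
      expansionTerm ε i (datum g lam ω) t n * conj (expansionTerm ε j (datum g lam ω) t m) ∂μ
      = (if n = m then ((mom2 μ g * ‖lam n‖ ^ 2 : ℝ) : ℂ) else 0)
        + (ε : ℂ) ^ 2 * (secondOrder μ g lam n m t : ℂ) := by
    rw [← h.sum_integral_expansionTerm hε t hn m, integral_finsetSum]
    · refine Finset.sum_congr rfl fun i hi => integral_finsetSum _ fun j hj => ?_
      simp only [Finset.mem_range] at hi hj
      exact hti i hi j (by omega)
    · intro i hi
      refine integrable_finsetSum _ fun j hj => ?_
      simp only [Finset.mem_range] at hi hj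
      exact hti i hi j (by omega)
  have hsi : Integrable (fun ω => ∑ i ∈ Finset.range 4, ∑ j ∈ Finset.range (4 - i),
      expansionTerm ε i (datum g lam ω) t n * conj (expansionTerm ε j (datum g lam ω) t m)) μ :=
    integrable_finsetSum _ fun i hi => integrable_finsetSum _ fun j hj => by
      simp only [Finset.mem_range] at hi hj
      exact hti i hi j (by omega)
  have hE : ‖∫ ω, v ω n * conj (v ω m) ∂μ
      - ((if n = m then ((mom2 μ g * ‖lam n‖ ^ 2 : ℝ) : ℂ) else 0)
        + (ε : ℂ) ^ 2 * (secondOrder μ g lam n m t : ℂ))‖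
      ≤ 20 * C ^ 2 * ε ^ 4
        * (min (size n) (size m) ^ (-s) * (|t| * (1 + |t|) ^ (7 / 5 : ℝ))) := by
    rw [← hsum, ← integral_sub hvi hsi]
    refine (norm_integral_le_of_norm_le_const (C := 20 * C ^ 2 * ε ^ 4
        * (min (size n) (size m) ^ (-s) * (|t| * (1 + |t|) ^ (7 / 5 : ℝ)))) ?_).trans ?_
    · filter_upwards [hall] with ω hω
      exact (hω n m hn hm).2.2
    · simp
  have hg2 : ∫ ω, ‖g n ω‖ ^ 2 ∂μ = mom2 μ g := h.integral_norm_g_pow hn 2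
  rw [hg2]
  simp_rw [hvv] at hE
  rw [integral_const_mul] at hE
  -- Back from v to u: on the diagonal the phases cancel, and off the diagonal the main term is
  -- zero, so that only moduli matter.
  by_cases hnm : n = m
  · subst hnm
    have h1 : θ n * conj (θ n) = 1 := by rw [Complex.mul_conj', hθ1]; simp
    rwa [h1, one_mul] at hE
  · rw [h.secondOrder_eq hn, if_neg hnm, if_neg hnm] at hE ⊢
    simp only [Complex.ofReal_zero, mul_zero, add_zero, sub_zero, norm_mul, RCLike.norm_conj, hθ1,
      one_mul] at hE ⊢
    exact hE

end KPII

end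

/-! ### The main theorem -/

theorem theorem1 (s : ℝ) (hs : 1 < s) :
    -- the constants depend on `s` only
    ∃ C T₁ ε₁ : ℝ, 0 < C ∧ 0 < T₁ ∧ 0 < ε₁ ∧
      ∀ (Ω : Type*) [MeasurableSpace Ω] (μ : Measure Ω) [IsProbabilityMeasure μ]
        (g : ℤ × ℤ → Ω → ℂ) (lam : ℤ × ℤ → ℂ),
        (∀ n : ℤ × ℤ, 0 < n.1 → Measurable (g n)) →
        -- the `g n` with `n₁ > 0` are independent and identically distributed
        iIndepFun (fun n : {n : ℤ × ℤ // 0 < n.1} => g n) μ →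
        (∀ n m : ℤ × ℤ, 0 < n.1 → 0 < m.1 → IdentDistrib (g n) (g m) μ μ) →
        -- their law is invariant under rotations
        (∀ n : ℤ × ℤ, 0 < n.1 → ∀ θ : ℝ,
          IdentDistrib (fun ω => Complex.exp (Complex.I * θ) * g n ω) (g n) μ μ) →
        (∀ n : ℤ × ℤ, 0 < n.1 → ∀ ω, g (-n) ω = conj (g n ω)) →
        (∀ n : ℤ × ℤ, 0 < n.1 → lam (-n) = conj (lam n)) →
        -- the initial datum has norm one in `L^∞(Ω, H^s)`
        essSup (fun ω => KPII.hsNorm s (fun n => lam n * g n ω)) μ = 1 →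
        -- all quantities in the formula for `F` are well defined
        (∀ n : KPII.Freq, Integrable (fun ω => ‖g n ω‖ ^ 2) μ ∧
          Integrable (fun ω => ‖g n ω‖ ^ 4) μ ∧
          ∀ t : ℝ, Summable (KPII.seriesTerm lam n t)) ∧
        -- the weighted sum of the second order terms is bounded uniformly in time
        (∃ K : ℝ, ∀ t : ℝ,
          Summable (fun p : KPII.Freq × KPII.Freq =>
            √(|(p.1.1.1 : ℝ) * (p.2.1.1 : ℝ)|) * (KPII.size p.1 * KPII.size p.2) ^ s *
              |KPII.secondOrder μ g lam p.1 p.2 t|) ∧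
          ∑' p : KPII.Freq × KPII.Freq,
            √(|(p.1.1.1 : ℝ) * (p.2.1.1 : ℝ)|) * (KPII.size p.1 * KPII.size p.2) ^ s *
              |KPII.secondOrder μ g lam p.1 p.2 t| ≤ K) ∧
        -- the expansion of the moments; `T * ε ^ (5 / 3) ≤ T₁` is `T ≤ T₁ ε ^ (-5 / 3)`,
        -- and no restriction on `T` when `ε = 0`
        (∀ ε ∈ Ico (0 : ℝ) ε₁, ∀ T : ℝ, 0 < T → T * ε ^ (5 / 3 : ℝ) ≤ T₁ →
          ∀ u : ℝ → Ω → ℝ × ℝ → ℝ, KPII.IsRandomSolution μ s ε T g lam u →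
            ∃ R : KPII.Freq → KPII.Freq → ℝ → ℂ,
              ∀ (n m : KPII.Freq), ∀ t ∈ Icc (-T) T,
                Integrable (fun ω => KPII.coeff (u t ω) n * conj (KPII.coeff (u t ω) m)) μ ∧
                ∫ ω, KPII.coeff (u t ω) n * conj (KPII.coeff (u t ω) m) ∂μ =
                  (if n = m then (((∫ ω, ‖g n ω‖ ^ 2 ∂μ) * ‖lam n‖ ^ 2 : ℝ) : ℂ) else 0)
                    + (ε : ℂ) ^ 2 * (KPII.secondOrder μ g lam n m t : ℂ)
                    + (ε : ℂ) ^ 4 * R n m t ∧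
                ‖R n m t‖ ≤ C * (min (KPII.size n) (KPII.size m)) ^ (-s) *
                  (|t| * (1 + |t|) ^ (7 / 5 : ℝ))) := by
  obtain ⟨C, T₁, ε₁, hC, hT₁, hε₁, hmain⟩ := KPII.exists_norm_integral_coeff_sub_le hs
  refine ⟨C, T₁, ε₁, hC, hT₁, hε₁, ?_⟩
  intro Ω _ μ _ g lam h1 h2 h3 h4 h5 h6 h7
  have h : KPII.RandomDatum μ s g lam := ⟨hs, h1, h2, h3, h4, h5, h6, h7⟩
  refine ⟨fun n => ⟨h.integrable_norm_g_pow n.2 2, h.integrable_norm_g_pow n.2 4, fun t =>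
    (KPII.summable_seriesTerm_of_energy h.summable_energy n.2 t).1⟩,
    h.exists_tsum_secondOrder_le, ?_⟩
  intro ε hε T hT hT1 u hu
  -- R is the error divided by ε⁴. For ε = 0 the error bound is itself zero, so R = 0 is admissible.
  refine ⟨fun n m t => if ε = 0 then 0 else
    (∫ ω, KPII.coeff (u t ω) n * conj (KPII.coeff (u t ω) m) ∂μ
      - ((if n = m then (((∫ ω, ‖g n ω‖ ^ 2 ∂μ) * ‖lam n‖ ^ 2 : ℝ) : ℂ) else 0)
        + (ε : ℂ) ^ 2 * (KPII.secondOrder μ g lam n m t : ℂ))) / (ε : ℂ) ^ 4, fun n m t ht => ?_⟩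
  obtain ⟨hint, hle⟩ := hmain h hε.1 hε.2 hT hT1 hu n.2 m.2 t ht
  simp only [← Subtype.ext_iff] at hle
  beta_reduce
  rcases hε.1.eq_or_lt with h0 | h0
  · rw [← h0, zero_pow four_ne_zero, mul_zero, zero_mul, norm_le_zero_iff, sub_eq_zero] at hle
    refine ⟨hint, ?_, ?_⟩
    · rw [if_pos h0.symm, ← h0, hle, mul_zero, add_zero]
    · rw [if_pos h0.symm, norm_zero]
      exact mul_nonneg (mul_nonneg hC.le (Real.rpow_nonneg (le_min (KPII.size_nonneg _)
        (KPII.size_nonneg _)) _)) (mul_nonneg (abs_nonneg t)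
          (Real.rpow_nonneg (by linarith [abs_nonneg t]) _))
  · have hε4 : (ε : ℂ) ^ 4 ≠ 0 := pow_ne_zero _ (by exact_mod_cast h0.ne')
    refine ⟨hint, ?_, ?_⟩
    · rw [if_neg h0.ne', mul_div_cancel₀ _ hε4]
      ring
    · rw [if_neg h0.ne', norm_div, norm_pow, Complex.norm_real, Real.norm_of_nonneg h0.le,
        div_le_iff₀ (by positivity)]
      exact hle.trans (le_of_eq (by ring))
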